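/- **Notation.** Let $\tau\in\mathbb H$ with $\tau_2=\operatorname{Im}\tau$, $q=e^{2\pi i\tau}$ and $y_z=e^{2\pi i z}$; fractional powers are $q^a=e^{2\pi i a\tau}$, $y_z^a=e^{2\pi i a z}$, and $\sqrt{-i\tau}$ is the principal branch. For integers $k\ge 1$ and $r$ put $$\vartheta_{k,r}(\tau;z)=\sum_{m\equiv r\,(2k)}q^{m^2/4k}e^{2\pi i m z},\qquad \theta_{11}(\tau;z)=\sum_{n\in\mathbb Z}q^{(n+1/2)^2/2}e^{2\pi i(z+1/2)(n+1/2)}.$$ For $K\ge 0$ and $0\le l\le K$ let $$\chi^{(K)}_{l}(\tau;z)=\frac{\vartheta_{K+2,l+1}(\tau;z/2)-\vartheta_{K+2,-l-1}(\tau;z/2)}{\vartheta_{2,1}(\tau;z/2)-\vartheta_{2,-1}(\tau;z/2)}$$ be the affine $SU(2)$ character of level $K$ (entire in $z$, all singularities of the quotient being removable). For $K\ge1$ the string functions $c^{(K)}_{l,r}(\tau)$, $r\in\mathbb Z/2K$, are the coefficients in $\chi^{(K)}_l(\tau;z)=\sum_{r\in\mathbb Z/2K}c^{(K)}_{l,r}(\tau)\,\vartheta_{K,r}(\tau;z/2)$.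 For $k\ge3$, $0\le l\le k-2$ and $r,s\in\mathbb Z$ put $$\chi^{l,s,k}_r(\tau;z)=\sum_{n\in\mathbb Z/(k-2)}c^{(k-2)}_{l,r-s+4n}(\tau)\,\vartheta_{2k(k-2),\,2r+k(4n-s)}(\tau;z/2k),$$ and for $k=2$ put $\chi^{0,s,2}_r=1$ if $r\equiv s\pmod 4$ and $0$ otherwise. The $N=2$ minimal-model characters used here are $$C^{l,k}_r\!\left[{1\atop 1}\right](\tau;z)=i\left(\chi^{l,1,k}_r(\tau;z)-\chi^{l,3,k}_r(\tau;z)\right).$$ For $k\ge2$, $1\le j,j'\le k-1$, $w\in\mathbb C$ and $u,v\in\mathbb C\setminus(\mathbb Z\tau+\mathbb Z)$ define $$\mu^{k,j,j'}(\tau;v,u,w)=\frac{y_v^{j'/k}}{\theta_{11}(\tau;u)}\sum_{n\in\mathbb Z}\frac{q^{n^2/k}q^{j'n/k}}{1-y_vq^n}\left(\frac{y_u\,y_w^{1-2/k}}{y_v^{1-2/k}}\right)^{n}C^{j-1,k}_{2n+j'}\!\left[{1\atop 1}\right](\tau;w-v).$$ With $E(x)=2\int_0^x e^{-\pi t^2}\,dt$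 and, for $x\in\mathbb C$, $x_2=\operatorname{Im}x$, define $$R_{k,r}(\tau;x)=\sum_{n\equiv r\,(2k)}\Big[\operatorname{sgn}(n+\tfrac12)-E\big((n+2kx_2/\tau_2)\sqrt{\tau_2/k}\big)\Big]e^{-\pi i n^2\tau/2k-2\pi i n x},$$ $$\widehat R_{k,r}(\tau;x)=R_{k,r}(\tau;x/2)-R_{k,-r}(\tau;x/2),\qquad \widehat{\mathcal S}^{(k)}_{l,l'}=\sqrt{2/k}\,\sin\frac{\pi l l'}{k}.$$ Finally define the completion, where $\delta_{j,j'\,(\mathrm{mod}\,2)}$ is $1$ if $j\equiv j'\pmod 2$ and $0$ otherwise: $$\begin{aligned}\tilde\mu^{k,j,j'}(\tau;v,u,w)=\tfrac12\big[\mu^{k,j,j'}+\mu^{k,k-j,k-j'}\big](\tau;v,u,w)-\tfrac14\,\delta_{j,j'\,(\mathrm{mod}\,2)}\Big[&\chi^{(k-2)}_{j-1}(\tau;u-v+w)\,\widehat R_{k,j'}(\tau;u-v+w(1-\tfrac2k))\\&+\chi^{(k-2)}_{k-j-1}(\tau;u-v+w)\,\widehat R_{k,k-j'}(\tau;u-v+w(1-\tfrac2k))\Big].\end{aligned}$$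 **Theorem.** Let $k\ge2$, $1\le j,j'\le k-1$, $\tau\in\mathbb H$, $w\in\mathbb C$ and $u,v\in\mathbb C\setminus(\mathbb Z\tau+\mathbb Z)$. The series defining $\mu^{k,j,j'}(\tau;v,u,w)$ and, for all $r\in\mathbb Z$ and $x\in\mathbb C$, the series defining $R_{k,r}(\tau;x)$ converge absolutely, and (a) $\displaystyle\tilde\mu^{k,j,j'}(\tau+1;v,u,w)=e^{-\pi i/4}\,e^{\pi i(j^2-j'^2)/2k}\,\tilde\mu^{k,j,j'}(\tau;v,u,w)$; (b) $\displaystyle\sum_{p,p'=1}^{k-1}\widehat{\mathcal S}^{(k)}_{j,p}\,\widehat{\mathcal S}^{(k)}_{j',p'}\,\tilde\mu^{k,p,p'}\Big(-\frac1\tau;\frac v\tau,\frac u\tau,\frac w\tau\Big)=-\sqrt{-i\tau}\;e^{-\pi i(u-v)^2/\tau}\,e^{\pi i w^2(1-2/k)/\tau}\,\tilde\mu^{k,j,j'}(\tau;v,u,w).$ -/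

import Mathlib

open scoped Topology

noncomputable section

namespace AppellLerch

/-- The index `k` theta function
`ϑ_{k,r}(τ;z) = ∑_{m ≡ r mod 2k} q^{m²/4k} y^m`, with `m = 2kn + r`, `n ∈ ℤ`. -/
def theta (k : ℕ) (r : ℤ) (τ z : ℂ) : ℂ :=
  ∑' n : ℤ, Complex.exp
    (2 * Real.pi * Complex.I * τ * ((2 * k * n + r : ℂ) ^ 2 / (4 * k))
      + 2 * Real.pi * Complex.I * z * (2 * k * n + r : ℂ))

/-- The Jacobi theta function
`θ₁₁(τ;z) = ∑_{n ∈ ℤ} q^{(n+1/2)²/2} e^{2πi (z+1/2)(n+1/2)}`. -/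
def theta11 (τ z : ℂ) : ℂ :=
  ∑' n : ℤ, Complex.exp
    (2 * Real.pi * Complex.I * τ * ((n + 1 / 2 : ℂ) ^ 2 / 2)
      + 2 * Real.pi * Complex.I * (z + 1 / 2) * (n + 1 / 2 : ℂ))

/-- The affine `SU(2)` character of level `K`,
`χ_l^{(K)}(τ;z) = (ϑ_{K+2,l+1} - ϑ_{K+2,-l-1})(τ;z/2) / (ϑ_{2,1} - ϑ_{2,-1})(τ;z/2)`.
It is an entire function of `z`: the quotient has removable singularities, at the zeros of the
denominator, and the value there is the limit. -/
def su2Char (K : ℕ) (l : ℤ) (τ z : ℂ) : ℂ :=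
  Filter.limUnder (𝓝[≠] z) fun ζ : ℂ =>
    (theta (K + 2) (l + 1) τ (ζ / 2) - theta (K + 2) (-(l + 1)) τ (ζ / 2))
      / (theta 2 1 τ (ζ / 2) - theta 2 (-1) τ (ζ / 2))

/-- The string functions `c^{(K)}_{l,r}(τ)` of level `K ≥ 1`, that is the coefficients in
`χ_l^{(K)}(τ;z) = ∑_{r ∈ ℤ/2K} c^{(K)}_{l,r}(τ) ϑ_{K,r}(τ;z/2)`. In the variable `t = z/2`
the coefficient of `e^{2πi r t}` is `c^{(K)}_{l,r}(τ) q^{r²/4K}`, and it is extracted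
by integrating over a period. -/
def stringFunction (K : ℕ) (l r : ℤ) (τ : ℂ) : ℂ :=
  Complex.exp (-(2 * Real.pi * Complex.I * τ * ((r : ℂ) ^ 2 / (4 * K))))
    * ∫ t in (0 : ℝ)..1, su2Char K l τ (2 * (t : ℂ))
        * Complex.exp (-(2 * Real.pi * Complex.I * r * t))

/-- The characters `χ_r^{l,s,k}(τ;z)` of the supersymmetric coset `SU(2)_k/U(1)`, for
`0 ≤ l ≤ k - 2`: for `k ≥ 3`
`χ_r^{l,s,k}(τ;z) = ∑_{n ∈ ℤ/(k-2)} c^{(k-2)}_{l,r-s+4n}(τ) ϑ_{2k(k-2),2r+k(4n-s)}(τ;z/2k)`,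
while for `k = 2`, where only `l = 0` occurs, `χ_r^{0,s,2} = δ_{r,s mod 4}`. -/
def cosetChar (k : ℕ) (l s r : ℤ) (τ z : ℂ) : ℂ :=
  if k = 2 then (if r ≡ s [ZMOD 4] then 1 else 0)
  else ∑ n ∈ Finset.range (k - 2),
    stringFunction (k - 2) l (r - s + 4 * n) τ
      * theta (2 * k * (k - 2)) (2 * r + k * (4 * n - s)) τ (z / (2 * k))

/-- The minimal model characters
`C^{l,k}_r[a b](τ;z) = e^{πi ab/2} (χ_r^{l,a,k}(τ;z) + (-1)^b χ_r^{l,a+2,k}(τ;z))`. -/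
def minimalChar (k : ℕ) (l r : ℤ) (a b : ℕ) (τ z : ℂ) : ℂ :=
  Complex.exp (Real.pi * Complex.I * a * b / 2)
    * (cosetChar k l a r τ z + (-1) ^ b * cosetChar k l (a + 2) r τ z)

/-- The `n`-th term of the series in `mu`:
`q^{n²/k + j'n/k} / (1 - y_v qⁿ) * (y_u y_w^{1-2/k} / y_v^{1-2/k})ⁿ
  * C^{j-1,k}_{2n+j'}[1 1](τ;w-v)`. -/
def muTerm (k : ℕ) (j j' : ℤ) (τ v u w : ℂ) (n : ℤ) : ℂ :=
  Complex.exp (2 * Real.pi * Complex.I * τ * ((n : ℂ) ^ 2 / k + j' * n / k))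
    / (1 - Complex.exp (2 * Real.pi * Complex.I * (v + n * τ)))
    * Complex.exp (2 * Real.pi * Complex.I * n * (u + (1 - 2 / k) * (w - v)))
    * minimalChar k (j - 1) (2 * n + j') 1 1 τ (w - v)

/-- The three-variable Appell-Lerch-type sum `μ^{k,j,j'}(τ;v,u,w)`. -/
def mu (k : ℕ) (j j' : ℤ) (τ v u w : ℂ) : ℂ :=
  Complex.exp (2 * Real.pi * Complex.I * v * (j' / k)) / theta11 τ u
    * ∑' n : ℤ, muTerm k j j' τ v u w n

/-- `E(x) = 2 ∫₀ˣ e^{-π t²} dt`. -/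
def errorE (x : ℝ) : ℝ :=
  2 * ∫ t in (0 : ℝ)..x, Real.exp (-(Real.pi * t ^ 2))

/-- The term `(sgn(n + 1/2) - E((n + 2k u₂/τ₂) √(τ₂/k))) e^{-πi n²τ/2k - 2πi n u}`, where
`u₂`, `τ₂` are imaginary parts. -/
def RTerm (k : ℕ) (τ u : ℂ) (n : ℤ) : ℂ :=
  ((Real.sign ((n : ℝ) + 1 / 2)
      - errorE (((n : ℝ) + 2 * k * u.im / τ.im) * Real.sqrt (τ.im / k)) : ℝ) : ℂ)
    * Complex.exp (-(Real.pi * Complex.I * (n : ℂ) ^ 2 * τ / (2 * k))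
        - 2 * Real.pi * Complex.I * n * u)

/-- The function `R_{k,r}(τ;u)`: the sum of the above terms over `n ≡ r mod 2k`. -/
def R (k : ℕ) (r : ℤ) (τ u : ℂ) : ℂ :=
  ∑' m : ℤ, RTerm k τ u (r + 2 * k * m)

/-- `R̂_{k,r}(τ;u) = R_{k,r}(τ;u/2) - R_{k,-r}(τ;u/2)`. -/
def RHat (k : ℕ) (r : ℤ) (τ u : ℂ) : ℂ :=
  R k r τ (u / 2) - R k (-r) τ (u / 2)

/-- The matrix `Ŝ^{(k)}_{l,l'} = √(2/k) sin(π l l'/k)`. -/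
def SHat (k : ℕ) (l l' : ℤ) : ℂ :=
  ((Real.sqrt (2 / k) * Real.sin (Real.pi * l * l' / k) : ℝ) : ℂ)

/-- The completion `μ̃^{k,j,j'}(τ;v,u,w)`; the correction is present only for
`j ≡ j' mod 2`. -/
def muTilde (k : ℕ) (j j' : ℤ) (τ v u w : ℂ) : ℂ :=
  1 / 2 * (mu k j j' τ v u w + mu k (k - j) (k - j') τ v u w)
    - 1 / 4 * (if j ≡ j' [ZMOD 2] then 1 else 0)
      * (su2Char (k - 2) (j - 1) τ (u - v + w) * RHat k j' τ (u - v + w * (1 - 2 / k))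
        + su2Char (k - 2) (k - j - 1) τ (u - v + w)
          * RHat k (k - j') τ (u - v + w * (1 - 2 / k)))

end AppellLerch

end

noncomputable section

namespace AppellLerch

/-! Behaviour under τ ↦ τ + 1 is visible termwise. The difficulty is τ ↦ -1/τ, and the idea is to
write the completed sum as an integral over a torus whose integrand is visibly modular. The
error-function correction comes out of this integral and is never transformed by itself.

Put k = K + 2, x = aτ + b and ω = u - v + w(1 - 2/k). The integrand `lerchKernel` is a product of
χ_{j-1}(2(x + w/k)), θ₁₁(w - v - 2(x + w/k)), the Kronecker function `kronFn` in (v, ω - 2x), and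
the complex conjugate of ϑ_{k,r}(x), with exponential normalizations. Every factor has a classical
S-law. The quadratic exponents in a, b cancel, so the kernel at (a, b) for τ is a finite combination
of kernels at (-b, a) for -1/τ (`lerchKernel_S`). The poles of the kernel are simple, hence
integrable in two dimensions (`integrable_lerchKernel`), and integration yields `torusIntegral_S`.

The same integral is computed by unfolding. The Kronecker function has a different Lambert-type
expansion in each horizontal strip between its poles, so the theta coefficients `lerchCoef` of the
meromorphic factor depend on the strip number N. Integration over b extracts them, and the series of
the conjugate theta function unfolds the a-integral to ℝ. What remains is the Gaussian integral of a
step function of a (`integral_lerchKernel`). Summation by parts over its jumps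
(`integral_step_gauss`) gives the coefficient in one strip, which is an Appell-Lerch sum by `mu_eq`,
plus the jumps weighted by sgn and E. In a jump the denominators 1 - y_v qⁿ cancel and leave θ₁₁(u)
χ(u - v + w) times an exponential (`lerchStep_zero`). These weighted jumps form the series R
(`integral_lerchCoef`).

Antisymmetrizing in r produces μ̃ up to an explicit factor (`torusIntegral_sub_neg`) and turns the
finite Fourier matrix of ϑ_{k,r} into the sine matrix Ŝ, which gives `muTilde_S`. The minimal-model
characters enter only through `minimalChar_eq`: they are Fourier coefficients of χ·θ₁₁. -/

/-- The normalized exponential `e(z) = exp(2πiz)`. -/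
def ex (z : ℂ) : ℂ := Complex.exp (2 * Real.pi * Complex.I * z)

lemma ex_add (a b : ℂ) : ex (a + b) = ex a * ex b := by
  simp only [ex, mul_add, Complex.exp_add]

lemma ex_zero : ex 0 = 1 := by simp [ex]

lemma ex_ne_zero (a : ℂ) : ex a ≠ 0 := Complex.exp_ne_zero _

lemma ex_neg (a : ℂ) : ex (-a) = (ex a)⁻¹ := by
  simp only [ex, mul_neg, Complex.exp_neg]

lemma ex_int (n : ℤ) : ex n = 1 := by
  rw [ex, mul_comm, Complex.exp_int_mul_two_pi_mul_I]

lemma ex_add_int (a : ℂ) (n : ℤ) : ex (a + n) = ex a := by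
  rw [ex_add, ex_int, mul_one]

lemma ex_half : ex (1 / 2) = -1 := by
  rw [ex, ← Complex.exp_pi_mul_I]; congr 1; ring

lemma ex_eq_one_iff (a : ℂ) : ex a = 1 ↔ ∃ n : ℤ, a = n := by
  rw [ex, Complex.exp_eq_one_iff]
  refine exists_congr fun n => ?_
  rw [mul_comm, mul_left_inj' Complex.two_pi_I_ne_zero]

lemma ex_eq_of_sub_int {a b : ℂ} (n : ℤ) (h : a = b + n) : ex a = ex b := by
  rw [h, ex_add_int]

lemma norm_ex (a : ℂ) : ‖ex a‖ = Real.exp (-(2 * Real.pi * a.im)) := by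
  rw [ex, Complex.norm_exp]; simp

lemma ex_zpow (a : ℂ) (n : ℤ) : ex a ^ n = ex (n * a) := by
  rw [ex, ex, ← Complex.exp_int_mul]; congr 1; ring

lemma differentiable_ex : Differentiable ℂ ex := by
  unfold ex; fun_prop

lemma continuous_ex : Continuous ex := differentiable_ex.continuous

lemma tsum_int_eq_sum_range {f : ℤ → ℂ} (hf : Summable f) {n : ℕ} (hn : 0 < n) :
    ∑' m : ℤ, f m = ∑ p ∈ Finset.range n, ∑' m : ℤ, f (n * m + p) := by
  have : NeZero n := ⟨hn.ne'⟩
  have h := (Int.divModEquiv n).symm.summable_iff.mpr hf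
  rw [← (Int.divModEquiv n).symm.tsum_eq f, ← (Equiv.prodComm _ _).tsum_eq]
  rw [← (Equiv.prodComm _ _).summable_iff] at h
  refine (h.tsum_prod' fun p => h.prod_factor p).trans ?_
  rw [tsum_fintype, Finset.sum_range]
  refine Finset.sum_congr rfl fun p _ => tsum_congr fun m => ?_
  simp [mul_comm]

/-! ### Theta functions of index `k` -/

lemma theta_def (k : ℕ) (r : ℤ) (τ z : ℂ) :
    theta k r τ z = ∑' n : ℤ,
      ex (τ * ((2 * k * n + r : ℂ) ^ 2 / (4 * k)) + z * (2 * k * n + r : ℂ)) := by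
  unfold theta ex
  refine tsum_congr fun n => ?_
  congr 1; ring

lemma ex_theta_term {k : ℕ} (hk : 0 < k) (r n : ℤ) (τ z : ℂ) :
    ex (τ * ((2 * k * n + r : ℂ) ^ 2 / (4 * k)) + z * (2 * k * n + r : ℂ))
      = ex (τ * r ^ 2 / (4 * k) + z * r)
        * jacobiTheta₂_term n (r * τ + 2 * k * z) (2 * k * τ) := by
  have : (k : ℂ) ≠ 0 := by exact_mod_cast hk.ne'
  unfold ex jacobiTheta₂_term
  rw [← Complex.exp_add]; congr 1; field_simp; ring

lemma im_two_mul_pos {k : ℕ} (hk : 0 < k) {τ : ℂ} (hτ : 0 < τ.im) : 0 < (2 * k * τ : ℂ).im := by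
  have : (2 * k * τ : ℂ) = ((2 * k : ℝ) : ℂ) * τ := by push_cast; ring
  rw [this, Complex.im_ofReal_mul]; positivity

lemma hasSum_theta {k : ℕ} (hk : 0 < k) (r : ℤ) {τ : ℂ} (hτ : 0 < τ.im) (z : ℂ) :
    HasSum (fun n : ℤ =>
      ex (τ * ((2 * k * n + r : ℂ) ^ 2 / (4 * k)) + z * (2 * k * n + r : ℂ)))
      (theta k r τ z) := by
  rw [theta_def]
  refine Summable.hasSum ?_
  simp_rw [ex_theta_term hk]
  exact ((summable_jacobiTheta₂_term_iff _ _).mpr (im_two_mul_pos hk hτ)).mul_left _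

lemma theta_eq_jacobi {k : ℕ} (hk : 0 < k) (r : ℤ) (τ z : ℂ) :
    theta k r τ z = ex (τ * r ^ 2 / (4 * k) + z * r)
      * jacobiTheta₂ (r * τ + 2 * k * z) (2 * k * τ) := by
  rw [theta_def, jacobiTheta₂, ← tsum_mul_left]
  exact tsum_congr fun n => ex_theta_term hk r n τ z

lemma differentiable_theta {k : ℕ} (hk : 0 < k) (r : ℤ) {τ : ℂ} (hτ : 0 < τ.im) :
    Differentiable ℂ (theta k r τ) := by
  have : theta k r τ = fun z => ex (τ * r ^ 2 / (4 * k) + z * r)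
      * jacobiTheta₂ (r * τ + 2 * k * z) (2 * k * τ) := by
    ext z; exact theta_eq_jacobi hk r τ z
  rw [this]
  intro z
  refine DifferentiableAt.mul (differentiable_ex.differentiableAt.comp z (by fun_prop)) ?_
  exact (differentiableAt_jacobiTheta₂_fst _ (im_two_mul_pos hk hτ)).comp z (by fun_prop)

lemma theta_neg (k : ℕ) (r : ℤ) (τ z : ℂ) : theta k r τ (-z) = theta k (-r) τ z := by
  rw [theta_def, theta_def, ← (Equiv.neg ℤ).tsum_eq]
  refine tsum_congr fun n => ?_
  simp only [Equiv.neg_apply, Int.cast_neg]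
  congr 1; ring

lemma theta_add_two_mul (k : ℕ) (r : ℤ) (τ z : ℂ) :
    theta k (r + 2 * k) τ z = theta k r τ z := by
  rw [theta_def, theta_def, ← (Equiv.addRight (1 : ℤ)).tsum_eq (fun n : ℤ =>
      ex (τ * ((2 * k * n + r : ℂ) ^ 2 / (4 * k)) + z * (2 * k * n + r : ℂ)))]
  refine tsum_congr fun n => ?_
  simp only [Equiv.coe_addRight]
  push_cast
  congr 1; ring

lemma theta_add_half {k : ℕ} (r : ℤ) (τ z : ℂ) :
    theta k r τ (z + 1 / 2) = ex (r / 2) * theta k r τ z := by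
  rw [theta_def, theta_def, ← tsum_mul_left]
  refine tsum_congr fun n => ?_
  rw [← ex_add]
  refine ex_eq_of_sub_int (k * n) ?_
  push_cast; ring

lemma theta_add_half_tau {k : ℕ} (hk : 0 < k) (r : ℤ) (τ z : ℂ) :
    theta k r τ (z + τ / 2) = ex (-(k * τ / 4) - k * z) * theta k (r + k) τ z := by
  have : (k : ℂ) ≠ 0 := by exact_mod_cast hk.ne'
  rw [theta_def, theta_def, ← tsum_mul_left]
  refine tsum_congr fun n => ?_
  rw [← ex_add]
  push_cast
  congr 1; field_simp; ring

lemma theta_tau_add_one {k : ℕ} (hk : 0 < k) (r : ℤ) (τ z : ℂ) :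
    theta k r (τ + 1) z = ex (r ^ 2 / (4 * k)) * theta k r τ z := by
  have : (k : ℂ) ≠ 0 := by exact_mod_cast hk.ne'
  rw [theta_def, theta_def, ← tsum_mul_left]
  refine tsum_congr fun n => ?_
  rw [← ex_add]
  refine ex_eq_of_sub_int (k * n ^ 2 + n * r) ?_
  push_cast; field_simp; ring

lemma im_neg_one_div_pos {τ : ℂ} (hτ : 0 < τ.im) : 0 < (-1 / τ).im := by
  have hτ0 : τ ≠ 0 := by rintro rfl; simp at hτ
  rw [neg_div, one_div, Complex.neg_im, Complex.inv_im, neg_div, neg_neg]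
  exact div_pos hτ (Complex.normSq_pos.mpr hτ0)

/-- A positive real factor splits off the principal logarithm additively, so no branch of the square
root is crossed. -/
lemma sqrt_two_mul {k : ℕ} (hk : 0 < k) {τ : ℂ} (hτ : 0 < τ.im) :
    (-Complex.I * (2 * k * τ)) ^ (1 / 2 : ℂ)
      = (Real.sqrt (2 * k) : ℂ) * (-(Complex.I * τ)) ^ (1 / 2 : ℂ) := by
  have hτ0 : τ ≠ 0 := by rintro rfl; simp at hτ
  have h2 : (-Complex.I * (2 * k * τ)) = ((2 * k : ℝ) : ℂ) * (-(Complex.I * τ)) := by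
    push_cast; ring
  have h3 : (-(Complex.I * τ)) ≠ 0 := by simp [hτ0]
  have hk' : (0 : ℝ) < 2 * k := by positivity
  rw [h2, Complex.cpow_def_of_ne_zero (by simp [hτ0, hk.ne']), Complex.cpow_def_of_ne_zero h3,
    Complex.log_ofReal_mul hk' h3, add_mul, Complex.exp_add, Real.sqrt_eq_rpow]
  congr 1
  rw [Complex.ofReal_cpow hk'.le, Complex.cpow_def_of_ne_zero (by simp [hk.ne'])]
  congr 1
  rw [Complex.ofReal_log hk'.le]; norm_num

/-- As a Jacobi theta function of modulus 2kτ, ϑ_{k,r} inverts by the standard functional equation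
into a series of modulus -1/(2kτ). Splitting its summation index mod 2k produces the finite Fourier
transform. -/
lemma theta_S {k : ℕ} (hk : 0 < k) (r : ℤ) {τ : ℂ} (hτ : 0 < τ.im) (z : ℂ) :
    theta k r τ z = 1 / ((Real.sqrt (2 * k) : ℂ) * (-(Complex.I * τ)) ^ (1 / 2 : ℂ))
      * ex (-(k * z ^ 2 / τ))
      * ∑ p ∈ Finset.range (2 * k), ex (r * p / (2 * k)) * theta k p (-1 / τ) (z / τ) := by
  have hk0 : (k : ℂ) ≠ 0 := by exact_mod_cast hk.ne'
  have hτ0 : τ ≠ 0 := by rintro rfl; simp at hτ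
  have him : 0 < (-1 / (2 * k * τ) : ℂ).im := by
    exact im_neg_one_div_pos (im_two_mul_pos hk hτ)
  rw [theta_eq_jacobi hk, jacobiTheta₂_functional_equation, sqrt_two_mul hk hτ, jacobiTheta₂,
    tsum_int_eq_sum_range ((summable_jacobiTheta₂_term_iff _ _).mpr him)
      (show 0 < 2 * k by positivity), Finset.mul_sum, Finset.mul_sum, Finset.mul_sum]
  refine Finset.sum_congr rfl fun p _ => ?_
  rw [theta_def, ← tsum_mul_left, ← tsum_mul_left, ← tsum_mul_left, ← tsum_mul_left]
  refine tsum_congr fun n => ?_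
  rw [jacobiTheta₂_term]
  have h : ∀ x : ℂ, Complex.exp x = ex (x / (2 * Real.pi * Complex.I)) := fun x => by
    rw [ex, mul_div_cancel₀ _ Complex.two_pi_I_ne_zero]
  rw [h, h]
  have hE : ∀ A a b c d e f : ℂ, a + b + c = d + e + f + (n * r : ℤ) →
      ex a * (A * ex b * ex c) = A * ex d * (ex e * ex f) := by
    intro A a b c d e f h
    have : ex (a + b + c) = ex (d + e + f) := ex_eq_of_sub_int _ h
    simp only [ex_add] at this
    linear_combination A * this
  refine hE _ _ _ _ _ _ _ ?_
  have : (Real.pi : ℂ) ≠ 0 := by exact_mod_cast Real.pi_ne_zero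
  have := Complex.I_ne_zero
  push_cast
  field_simp
  ring

/-! ### The odd theta functions `ϑ_{k,r} - ϑ_{k,-r}` -/

/-- The odd combination `ϑ_{k,r}(τ;x/2) - ϑ_{k,-r}(τ;x/2)`. -/
def oddTheta (k : ℕ) (r : ℤ) (τ x : ℂ) : ℂ := theta k r τ (x / 2) - theta k (-r) τ (x / 2)

lemma differentiable_oddTheta {k : ℕ} (hk : 0 < k) (r : ℤ) {τ : ℂ} (hτ : 0 < τ.im) :
    Differentiable ℂ (oddTheta k r τ) := by
  have h1 := differentiable_theta hk r hτ
  have h2 := differentiable_theta hk (-r) hτ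
  unfold oddTheta
  fun_prop

lemma oddTheta_neg (k : ℕ) (r : ℤ) (τ x : ℂ) : oddTheta k r τ (-x) = -oddTheta k r τ x := by
  unfold oddTheta
  rw [neg_div, theta_neg, theta_neg, neg_neg]; ring

lemma ex_neg_half_int (r : ℤ) : ex (-r / 2) = ex (r / 2) :=
  ex_eq_of_sub_int (-r) (by push_cast; ring)

lemma oddTheta_add_one {k : ℕ} (r : ℤ) (τ x : ℂ) :
    oddTheta k r τ (x + 1) = ex (r / 2) * oddTheta k r τ x := by
  unfold oddTheta
  rw [add_div, theta_add_half, theta_add_half, Int.cast_neg, ex_neg_half_int]; ring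

lemma oddTheta_add_tau {k : ℕ} (hk : 0 < k) (r : ℤ) (τ x : ℂ) :
    oddTheta k r τ (x + τ) = -ex (-(k * τ / 4) - k * x / 2) * oddTheta k (k - r) τ x := by
  unfold oddTheta
  rw [add_div, theta_add_half_tau hk, theta_add_half_tau hk,
    ← theta_add_two_mul k (-(k - r)), show -((k : ℤ) - r) + 2 * k = r + k by ring,
    show -r + (k : ℤ) = k - r by ring, mul_div_assoc]
  ring_nf

lemma oddTheta_tau_add_one {k : ℕ} (hk : 0 < k) (r : ℤ) (τ x : ℂ) :
    oddTheta k r (τ + 1) x = ex (r ^ 2 / (4 * k)) * oddTheta k r τ x := by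
  unfold oddTheta
  rw [theta_tau_add_one hk, theta_tau_add_one hk]
  push_cast
  rw [neg_sq]; ring

lemma oddTheta_add_two_tau {k : ℕ} (hk : 0 < k) (r : ℤ) (τ x : ℂ) :
    oddTheta k r τ (x + 2 * τ) = ex (-(k * τ) - k * x) * oddTheta k r τ x := by
  rw [two_mul, ← add_assoc, oddTheta_add_tau hk, oddTheta_add_tau hk, sub_sub_cancel,
    ← mul_assoc, neg_mul_neg, ← ex_add]
  congr 2; ring

lemma oddTheta_add_two_tau_mul {k : ℕ} (hk : 0 < k) (r : ℤ) (τ x : ℂ) (m : ℤ) :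
    oddTheta k r τ (x + 2 * m * τ) = ex (-(k * m ^ 2 * τ) - k * m * x) * oddTheta k r τ x := by
  induction m using Int.induction_on with
  | zero => simp [ex_zero]
  | succ i ih =>
    rw [show x + 2 * ((i + 1 : ℤ) : ℂ) * τ = (x + 2 * (i : ℤ) * τ) + 2 * τ by push_cast; ring,
      oddTheta_add_two_tau hk, ih, ← mul_assoc, ← ex_add]
    congr 2; push_cast; ring
  | pred i ih =>
    have h := oddTheta_add_two_tau hk r τ (x + 2 * ((-i - 1 : ℤ) : ℂ) * τ)
    rw [show x + 2 * ((-i - 1 : ℤ) : ℂ) * τ + 2 * τ = x + 2 * ((-i : ℤ) : ℂ) * τ by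
      push_cast; ring, ih] at h
    rw [← mul_right_inj' (ex_ne_zero
      (-(k * τ) - k * (x + 2 * ((-i - 1 : ℤ) : ℂ) * τ))), ← h, ← mul_assoc, ← ex_add]
    congr 2; push_cast; ring

lemma oddTheta_add_two_mul_int {k : ℕ} (r : ℤ) (τ x : ℂ) (n : ℤ) :
    oddTheta k r τ (x + n) = ex (n * r / 2) * oddTheta k r τ x := by
  induction n using Int.induction_on with
  | zero => simp [ex_zero]
  | succ i ih =>
    push_cast at ih ⊢
    rw [← add_assoc, oddTheta_add_one, ih, ← mul_assoc, ← ex_add]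
    congr 2; ring
  | pred i ih =>
    have h := oddTheta_add_one (k := k) r τ (x + ((-i - 1 : ℤ) : ℂ))
    rw [show x + ((-i - 1 : ℤ) : ℂ) + 1 = x + ((-i : ℤ) : ℂ) by push_cast; ring, ih] at h
    rw [← mul_right_inj' (ex_ne_zero (r / 2 : ℂ)), ← h, ← mul_assoc, ← ex_add]
    congr 2; push_cast; ring

/-- The points P = mτ + n and -P differ by 2mτ + 2n, a quasi-period whose factor is 1 at this point.
Oddness then forces f(P) = -f(P). -/
lemma oddTheta_lattice {k : ℕ} (hk : 0 < k) (r : ℤ) (τ : ℂ) (m n : ℤ) :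
    oddTheta k r τ (m * τ + n) = 0 := by
  have h1 := oddTheta_add_two_tau_mul hk r τ (-m * τ + n) m
  have h2 := oddTheta_add_two_mul_int (k := k) r τ (-(m * τ + n)) (2 * n)
  rw [show -(m : ℂ) * τ + n + 2 * m * τ = m * τ + n by ring,
    show (-(m : ℂ) * τ + n) = -(m * τ + n) + ((2 * n : ℤ) : ℂ) by push_cast; ring, h2,
    oddTheta_neg, show ex (((2 * n : ℤ) : ℂ) * r / 2) = 1 by
      rw [← ex_int (n * r)]; congr 1; push_cast; ring,
    show ex (-(k * m ^ 2 * τ) - k * m * (-(m * τ + n) + ((2 * n : ℤ) : ℂ))) = 1 by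
      rw [← ex_int (-(k * m * n))]; congr 1; push_cast; ring] at h1
  linear_combination h1 / 2

/-- An odd 2k-periodic c vanishes at 0 and k, and the remaining residues pair as p and 2k - p. This
reduces Fourier sums mod 2k to sine sums over 1, …, k - 1. -/
lemma sum_range_two_mul_odd {k : ℕ} (hk : 0 < k) (c f : ℤ → ℂ)
    (hc : ∀ p, c (-p) = -c p) (hf : ∀ p, f (p + 2 * k) = f p) (hc' : ∀ p, c (p + 2 * k) = c p) :
    ∑ p ∈ Finset.range (2 * k), c p * f p
      = ∑ p ∈ Finset.Icc (1 : ℤ) (k - 1), c p * (f p - f (-p)) := by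
  have c0 : c 0 = 0 := by
    have := hc 0
    rw [neg_zero] at this; linear_combination this / 2
  have ck : c k = 0 := by
    have h1 := hc k
    have h2 := hc' (-k)
    rw [show -(k : ℤ) + 2 * k = k by ring] at h2
    rw [← h2] at h1; linear_combination h1 / 2
  have e1 : ∑ p ∈ Finset.Icc (1 : ℤ) (k - 1), c p * (f p - f (-p))
      = ∑ p ∈ Finset.Ico 1 k, c p * (f p - f (-p)) := by
    symm
    refine Finset.sum_bij (fun p _ => (p : ℤ)) ?_ ?_ ?_ ?_
    · intro p hp; simp only [Finset.mem_Ico, Finset.mem_Icc] at *; omega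
    · intro a _ b _ h; exact_mod_cast h
    · intro b hb
      simp only [Finset.mem_Icc] at hb
      exact ⟨b.toNat, by simp only [Finset.mem_Ico]; omega, by omega⟩
    · intros; rfl
  rw [e1, two_mul, Finset.sum_range_add, Finset.sum_range_eq_add_Ico _ hk,
    Finset.sum_range_eq_add_Ico _ hk]
  simp only [Nat.cast_zero, c0, zero_mul, zero_add, add_zero, ck]
  simp_rw [mul_sub]
  rw [Finset.sum_sub_distrib, sub_eq_add_neg]
  congr 1
  rw [← Finset.sum_neg_distrib]
  refine Finset.sum_nbij' (fun p => k - p) (fun p => k - p) ?_ ?_ ?_ ?_ ?_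
  · intro p hp; simp only [Finset.mem_Ico] at *; omega
  · intro p hp; simp only [Finset.mem_Ico] at *; omega
  · intro p hp; simp only [Finset.mem_Ico] at *; omega
  · intro p hp; simp only [Finset.mem_Ico] at *; omega
  · intro p hp
    simp only [Finset.mem_Ico] at hp
    have h1 : ((k + p : ℕ) : ℤ) = -((k - p : ℕ) : ℤ) + 2 * k := by omega
    rw [h1, hf, hc', hc]; ring

lemma ex_sub_ex_neg (x : ℂ) : ex (x / 2) - ex (-(x / 2)) = 2 * Complex.I * Complex.sin (Real.pi * x) := by
  unfold ex
  rw [Complex.sin]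
  rw [show 2 * (Real.pi : ℂ) * Complex.I * (x / 2) = Real.pi * x * Complex.I by ring,
    show 2 * (Real.pi : ℂ) * Complex.I * (-(x / 2)) = -(Real.pi * x) * Complex.I by ring]
  linear_combination (Complex.exp (Real.pi * x * Complex.I) - Complex.exp (-(Real.pi * x) * Complex.I)) * Complex.I_sq

lemma SHat_eq {k : ℕ} (hk : 0 < k) (l p : ℤ) :
    SHat k l p = 1 / (Real.sqrt (2 * k) : ℂ) * (2 * Complex.sin (Real.pi * (l * p / k))) := by
  have h : Real.sqrt (2 / k) = 2 / Real.sqrt (2 * k) := by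
    have hk' : (0 : ℝ) < k := by exact_mod_cast hk
    rw [eq_div_iff (by positivity), ← Real.sqrt_mul (by positivity),
      show (2 / k * (2 * k) : ℝ) = 2 ^ 2 by field_simp]
    exact Real.sqrt_sq (by norm_num)
  unfold SHat
  rw [h]; push_cast
  rw [show (Real.pi : ℂ) * l * p / k = Real.pi * (l * p / k) by ring]; ring

lemma oddTheta_S {k : ℕ} (hk : 0 < k) (r : ℤ) {τ : ℂ} (hτ : 0 < τ.im) (x : ℂ) :
    oddTheta k r τ x = Complex.I / (-(Complex.I * τ)) ^ (1 / 2 : ℂ) * ex (-(k * x ^ 2 / (4 * τ)))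
      * ∑ p ∈ Finset.Icc (1 : ℤ) (k - 1), SHat k r p * oddTheta k p (-1 / τ) (x / τ) := by
  have hk0 : (k : ℂ) ≠ 0 := by exact_mod_cast hk.ne'
  have hτ0 : τ ≠ 0 := by rintro rfl; simp at hτ
  rw [oddTheta, theta_S hk r hτ, theta_S hk (-r) hτ, ← mul_sub, ← Finset.sum_sub_distrib]
  have key := sum_range_two_mul_odd hk
    (fun p => ex (r * p / (2 * k)) - ex (-(r * p / (2 * k))))
    (fun p => theta k p (-1 / τ) (x / 2 / τ))
    (fun p => by push_cast; rw [show (r : ℂ) * -p / (2 * k) = -(r * p / (2 * k)) by ring]; ring_nf)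
    (fun p => theta_add_two_mul k p _ _)
    (fun p => by
      congr 1
      · refine ex_eq_of_sub_int r ?_
        push_cast; field_simp
      · refine ex_eq_of_sub_int (-r) ?_
        push_cast; field_simp; ring)
  have h2 : ∀ p : ℕ, ex (r * p / (2 * k)) * theta k p (-1 / τ) (x / 2 / τ)
      - ex ((-r : ℤ) * p / (2 * k)) * theta k p (-1 / τ) (x / 2 / τ)
      = (ex (r * (p : ℤ) / (2 * k)) - ex (-(r * (p : ℤ) / (2 * k))))
        * theta k p (-1 / τ) (x / 2 / τ) := by
    intro p
    push_cast
    rw [show -(r : ℂ) * p / (2 * k) = -(r * p / (2 * k)) by ring]; ring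
  rw [Finset.sum_congr rfl fun p _ => h2 p, key, Finset.mul_sum, Finset.mul_sum]
  refine Finset.sum_congr rfl fun p _ => ?_
  rw [SHat_eq hk, oddTheta, show (r : ℂ) * p / (2 * k) = (r * p / k) / 2 by ring, ex_sub_ex_neg,
    show x / 2 / τ = x / τ / 2 by ring,
    show -((k : ℂ) * (x / 2) ^ 2 / τ) = -(k * x ^ 2 / (4 * τ)) by field_simp; ring]
  ring

/-! ### The Jacobi theta function `θ₁₁` -/

/-- The coefficients of the series of `θ₁₁`. -/
def theta11Coeff (τ : ℂ) (m : ℤ) : ℂ := ex (τ * ((m + 1 / 2 : ℂ) ^ 2 / 2) + (m + 1 / 2) / 2)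

lemma theta11_term (τ z : ℂ) (n : ℤ) :
    Complex.exp (2 * Real.pi * Complex.I * τ * ((n + 1 / 2 : ℂ) ^ 2 / 2)
      + 2 * Real.pi * Complex.I * (z + 1 / 2) * (n + 1 / 2 : ℂ))
      = theta11Coeff τ n * ex ((n + 1 / 2) * z) := by
  rw [theta11Coeff, ← ex_add, ex]; congr 1; ring

lemma theta11Coeff_mul (τ z : ℂ) (n : ℤ) : theta11Coeff τ n * ex ((n + 1 / 2) * z)
    = ex (τ / 8 + (z + 1 / 2) / 2) * jacobiTheta₂_term n (z + 1 / 2 + τ / 2) τ := by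
  rw [theta11Coeff, jacobiTheta₂_term, ← ex_add, ex, ex, ← Complex.exp_add]
  congr 1; ring

lemma summable_theta11 {τ : ℂ} (hτ : 0 < τ.im) (z : ℂ) :
    Summable fun n : ℤ => theta11Coeff τ n * ex ((n + 1 / 2) * z) := by
  simp_rw [theta11Coeff_mul]
  exact ((summable_jacobiTheta₂_term_iff _ _).mpr hτ).mul_left _

lemma hasSum_theta11 {τ : ℂ} (hτ : 0 < τ.im) (z : ℂ) :
    HasSum (fun n : ℤ => theta11Coeff τ n * ex ((n + 1 / 2) * z)) (theta11 τ z) := by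
  have : theta11 τ z = ∑' n : ℤ, theta11Coeff τ n * ex ((n + 1 / 2) * z) :=
    tsum_congr fun n => theta11_term τ z n
  rw [this]
  exact (summable_theta11 hτ z).hasSum

lemma ex_quarter : ex (1 / 4) = Complex.I := by
  rw [ex, show 2 * (Real.pi : ℂ) * Complex.I * (1 / 4) = Real.pi / 2 * Complex.I by ring,
    Complex.exp_pi_div_two_mul_I]

/-- Even and odd n in the series of θ₁₁ are the classes 1 and -1 mod 4 of 2n + 1, and the phases
e^{πi(n+1/2)} are i and -i. Thus θ₁₁ is also the denominator of the SU(2) characters up to a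
constant, and its zeros decide their removable singularities. -/
lemma theta11_eq_oddTheta {τ : ℂ} (hτ : 0 < τ.im) (z : ℂ) :
    theta11 τ z = Complex.I * oddTheta 2 1 τ z := by
  rw [← (hasSum_theta11 hτ z).tsum_eq, tsum_int_eq_sum_range (n := 2) (summable_theta11 hτ z) (by norm_num),
    oddTheta, mul_sub, sub_eq_add_neg]
  simp only [Finset.sum_range_succ, Finset.sum_range_zero, zero_add]
  congr 1
  · rw [theta_def, ← tsum_mul_left]
    refine tsum_congr fun n => ?_
    rw [theta11Coeff, ← ex_quarter, ← ex_add, ← ex_add]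
    refine ex_eq_of_sub_int n ?_
    push_cast; ring
  · rw [← theta_add_two_mul, theta_def, ← tsum_mul_left, ← tsum_neg]
    refine tsum_congr fun n => ?_
    rw [theta11Coeff, ← ex_quarter, ← ex_add, ← ex_add, ← neg_one_mul, ← ex_half, ← ex_add]
    refine ex_eq_of_sub_int n ?_
    push_cast; ring

lemma theta11_eq_oddTheta' {τ : ℂ} (hτ : 0 < τ.im) :
    theta11 τ = fun z => Complex.I * oddTheta 2 1 τ z :=
  funext (theta11_eq_oddTheta hτ)

lemma differentiable_theta11 {τ : ℂ} (hτ : 0 < τ.im) : Differentiable ℂ (theta11 τ) := by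
  rw [theta11_eq_oddTheta' hτ]
  exact (differentiable_oddTheta two_pos 1 hτ).const_mul _

lemma theta11_neg {τ : ℂ} (hτ : 0 < τ.im) (z : ℂ) : theta11 τ (-z) = -theta11 τ z := by
  simp only [theta11_eq_oddTheta hτ, oddTheta_neg]; ring

lemma theta11_add_one {τ : ℂ} (hτ : 0 < τ.im) (z : ℂ) : theta11 τ (z + 1) = -theta11 τ z := by
  simp only [theta11_eq_oddTheta hτ, oddTheta_add_one]
  rw [Int.cast_one, ex_half]; ring

lemma theta11_add_tau {τ : ℂ} (hτ : 0 < τ.im) (z : ℂ) :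
    theta11 τ (z + τ) = -ex (-(τ / 2) - z) * theta11 τ z := by
  simp only [theta11_eq_oddTheta hτ, oddTheta_add_tau two_pos]
  push_cast
  rw [show -(2 * τ / 4) - 2 * z / 2 = -(τ / 2) - z by ring]
  ring

lemma theta11_lattice {τ : ℂ} (hτ : 0 < τ.im) (m n : ℤ) : theta11 τ (m * τ + n) = 0 := by
  rw [theta11_eq_oddTheta hτ, oddTheta_lattice two_pos, mul_zero]

lemma theta11_add_int {τ : ℂ} (hτ : 0 < τ.im) (z : ℂ) (n : ℤ) :
    theta11 τ (z + n) = ex (n / 2) * theta11 τ z := by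
  rw [theta11_eq_oddTheta hτ, theta11_eq_oddTheta hτ, oddTheta_add_two_mul_int]
  push_cast; rw [mul_one]; ring

lemma theta11_tau_add_one {τ : ℂ} (hτ : 0 < τ.im) (z : ℂ) :
    theta11 (τ + 1) z = ex (1 / 8) * theta11 τ z := by
  have hτ' : 0 < (τ + 1).im := by simpa using hτ
  rw [theta11_eq_oddTheta hτ, theta11_eq_oddTheta hτ', oddTheta_tau_add_one two_pos]
  push_cast
  norm_num; ring

/-! ### The Kronecker series -/

lemma summable_exp_neg_abs {c : ℝ} (hc : 0 < c) :
    Summable fun n : ℤ => Real.exp (-(c * |(n : ℝ)|)) := by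
  have h : Summable fun n : ℕ => Real.exp (-(c * n)) := by
    have : (fun n : ℕ => Real.exp (-(c * n))) = fun n : ℕ => Real.exp (-c) ^ n := by
      ext n; rw [← Real.exp_nat_mul]; congr 1; ring
    rw [this]
    exact summable_geometric_of_lt_one (Real.exp_pos _).le (by simpa using hc)
  refine Summable.of_nat_of_neg ?_ ?_ <;> simpa using h

lemma exists_bound_inv_one_sub (y q : ℂ) (hq : ‖q‖ < 1) :
    ∃ M : ℝ, 0 ≤ M ∧ ∀ n : ℕ, ‖(1 - y * q ^ n)⁻¹‖ ≤ M := by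
  have h1 : Filter.Tendsto (fun n : ℕ => ‖(1 - y * q ^ n)⁻¹‖) Filter.atTop (𝓝 1) := by
    have := ((tendsto_pow_atTop_nhds_zero_of_norm_lt_one hq).const_mul y).const_sub 1
    rw [mul_zero, sub_zero] at this
    simpa using (this.inv₀ one_ne_zero).norm
  obtain ⟨M, hM⟩ := h1.bddAbove_range
  exact ⟨M, (norm_nonneg _).trans (hM ⟨0, rfl⟩), fun n => hM ⟨n, rfl⟩⟩

/-- `v` does not lie in the lattice `ℤτ + ℤ`. -/
def OffLattice (τ v : ℂ) : Prop := ∀ a b : ℤ, v ≠ a * τ + b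

lemma OffLattice.one_sub_ne_zero {τ v : ℂ} (hv : OffLattice τ v) (n : ℤ) :
    1 - ex (v + n * τ) ≠ 0 := by
  intro h
  obtain ⟨m, hm⟩ := (ex_eq_one_iff _).mp (sub_eq_zero.mp h).symm
  refine hv (-n) m ?_
  push_cast
  linear_combination hm

/-- The coefficients of the Kronecker series minus those of the geometric series. -/
def kronCoeff (τ v : ℂ) (n : ℤ) : ℂ := 1 / (1 - ex (v + n * τ)) - if 0 ≤ n then 1 else 0

lemma norm_ex_mul (n : ℤ) (z : ℂ) : ‖ex (n * z)‖ = Real.exp (-(2 * Real.pi * (n * z.im))) := by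
  rw [norm_ex]; simp

/-- With X = y_v qⁿ, the difference is X/(1 - X) for n ≥ 0 and -X⁻¹/(1 - X⁻¹) for n < 0. Both decay
like |q|^{|n|}, so after removal of the geometric series the Kronecker series converges for |Im ξ| <
τ₂, including at ξ = 0. -/
lemma exists_bound_kronCoeff {τ v : ℂ} (hτ : 0 < τ.im) (hv : OffLattice τ v) :
    ∃ M : ℝ, 0 ≤ M ∧ ∀ n : ℤ,
      ‖kronCoeff τ v n‖ ≤ M * Real.exp (-(2 * Real.pi * τ.im * |(n : ℝ)|)) := by
  have hq : ‖ex τ‖ < 1 := by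
    rw [norm_ex]; rw [Real.exp_lt_one_iff]
    have := Real.pi_pos; simp only [neg_lt_zero]; positivity
  obtain ⟨M₁, hM₁0, hM₁⟩ := exists_bound_inv_one_sub (ex v) (ex τ) hq
  obtain ⟨M₂, hM₂0, hM₂⟩ := exists_bound_inv_one_sub (ex (-v)) (ex τ) hq
  refine ⟨‖ex v‖ * M₁ + ‖ex (-v)‖ * M₂, by positivity, fun n => ?_⟩
  have hX := hv.one_sub_ne_zero n
  obtain ⟨m, rfl | rfl⟩ := n.eq_nat_or_neg
  · have e1 : ex (v + (m : ℤ) * τ) = ex v * ex τ ^ m := by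
      rw [ex_add, ← ex_zpow]; simp
    have e2 : kronCoeff τ v m = ex v * ex ((m : ℤ) * τ) * (1 - ex v * ex τ ^ m)⁻¹ := by
      rw [kronCoeff, if_pos (Int.natCast_nonneg m), ← e1, ← ex_add]
      field_simp; ring
    rw [e2, norm_mul, norm_mul, norm_ex_mul, Int.cast_natCast, Nat.abs_cast,
      show 2 * Real.pi * (m * τ.im) = 2 * Real.pi * τ.im * m by ring]
    have h0 : 0 ≤ ‖ex v‖ * Real.exp (-(2 * Real.pi * τ.im * m)) := by positivity
    have h1 : 0 ≤ ‖ex (-v)‖ * M₂ * Real.exp (-(2 * Real.pi * τ.im * m)) := by positivity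
    nlinarith [mul_le_mul_of_nonneg_left (hM₁ m) h0]
  · rcases Nat.eq_zero_or_pos m with rfl | hm
    · have e2 : kronCoeff τ v (-(0 : ℕ) : ℤ) = ex v * (1 - ex v * ex τ ^ 0)⁻¹ := by
        have hX' : 1 - ex v ≠ 0 := by simpa using hX
        simp only [kronCoeff, Nat.cast_zero, neg_zero, le_refl, if_true, Int.cast_zero, zero_mul,
          add_zero, pow_zero, mul_one]
        field_simp; ring
      rw [e2, norm_mul]
      have := mul_le_mul_of_nonneg_left (hM₁ 0) (norm_nonneg (ex v))
      have h2 : 0 ≤ ‖ex (-v)‖ * M₂ := by positivity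
      simp; simp at this; linarith
    · have e1 : ex (-v) * ex τ ^ m = (ex (v + ((-m : ℤ) : ℂ) * τ))⁻¹ := by
        rw [← ex_neg, ← zpow_natCast, ex_zpow, ← ex_add]; congr 1; push_cast; ring
      have hX' : ex (v + ((-m : ℤ) : ℂ) * τ) - 1 ≠ 0 := by
        intro h; apply hX; linear_combination -h
      have e2 : kronCoeff τ v (-m) = -(ex (-v) * ex ((m : ℤ) * τ) * (1 - ex (-v) * ex τ ^ m)⁻¹) := by
        have h3 : ex (-v) * ex ((m : ℤ) * τ) = ex (-v) * ex τ ^ m := by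
          rw [← ex_zpow, zpow_natCast]
        rw [h3, e1, kronCoeff, if_neg (by omega)]
        have := ex_ne_zero (v + ((-m : ℤ) : ℂ) * τ)
        generalize ex (v + ((-m : ℤ) : ℂ) * τ) = E at *
        have : 1 - E⁻¹ ≠ 0 := by
          intro h; apply hX; field_simp at h; linear_combination -h
        field_simp
        ring
      rw [e2, norm_neg, norm_mul, norm_mul, norm_ex_mul, Int.cast_natCast]
      have h4 : |(((-m : ℤ)) : ℝ)| = m := by push_cast; rw [abs_neg, Nat.abs_cast]
      rw [h4, show 2 * Real.pi * (m * τ.im) = 2 * Real.pi * τ.im * m by ring]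
      have h0 : 0 ≤ ‖ex (-v)‖ * Real.exp (-(2 * Real.pi * τ.im * m)) := by positivity
      have h1 : 0 ≤ ‖ex v‖ * M₁ * Real.exp (-(2 * Real.pi * τ.im * m)) := by positivity
      nlinarith [mul_le_mul_of_nonneg_left (hM₂ m) h0]

/-- The Kronecker series `∑ₙ y_ξⁿ / (1 - y_v qⁿ)`. -/
def kron (τ v ξ : ℂ) : ℂ := ∑' n : ℤ, ex (n * ξ) / (1 - ex (v + n * τ))

lemma kron_term_eq (τ v ξ : ℂ) (n : ℤ) : ex (n * ξ) / (1 - ex (v + n * τ))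
    = (if 0 ≤ n then ex (n * ξ) else 0) + kronCoeff τ v n * ex (n * ξ) := by
  rw [kronCoeff]; split_ifs <;> ring

lemma hasSum_geometric_int {ξ : ℂ} (hξ : 0 < ξ.im) :
    HasSum (fun n : ℤ => if 0 ≤ n then ex (n * ξ) else 0) (1 / (1 - ex ξ)) := by
  have h : HasSum (fun n : ℕ => ex ξ ^ n) (1 / (1 - ex ξ)) := by
    rw [one_div]
    refine hasSum_geometric_of_norm_lt_one ?_
    rw [norm_ex, Real.exp_lt_one_iff]
    have := Real.pi_pos; simp only [neg_lt_zero]; positivity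
  refine (Function.Injective.hasSum_iff (Nat.cast_injective (R := ℤ)) ?_).mp ?_
  · intro x hx
    rw [if_neg]
    intro h0; exact hx ⟨x.toNat, by simpa using h0⟩
  · convert h using 2 with n
    simp [← ex_zpow]

lemma norm_kronCoeff_mul_le {τ v : ℂ} {M : ℝ} (hM0 : 0 ≤ M)
    (hM : ∀ n : ℤ, ‖kronCoeff τ v n‖ ≤ M * Real.exp (-(2 * Real.pi * τ.im * |(n : ℝ)|)))
    {ξ : ℂ} {b : ℝ} (hb : |ξ.im| ≤ b) (n : ℤ) :
    ‖kronCoeff τ v n * ex (n * ξ)‖ ≤ M * Real.exp (-(2 * Real.pi * (τ.im - b) * |(n : ℝ)|)) := by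
  rw [norm_mul, norm_ex_mul]
  have h1 : Real.exp (-(2 * Real.pi * (n * ξ.im))) ≤ Real.exp (2 * Real.pi * (b * |(n : ℝ)|)) := by
    rw [Real.exp_le_exp, ← mul_neg]
    refine mul_le_mul_of_nonneg_left ?_ (by positivity)
    calc -(n * ξ.im) ≤ |(n : ℝ) * ξ.im| := neg_le_abs _
      _ = |ξ.im| * |(n : ℝ)| := by rw [abs_mul, mul_comm]
      _ ≤ b * |(n : ℝ)| := mul_le_mul_of_nonneg_right hb (abs_nonneg _)
  calc _ ≤ M * Real.exp (-(2 * Real.pi * τ.im * |(n : ℝ)|))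
        * Real.exp (2 * Real.pi * (b * |(n : ℝ)|)) :=
        mul_le_mul (hM n) h1 (Real.exp_pos _).le (by positivity)
    _ = _ := by rw [mul_assoc, ← Real.exp_add]; congr 2; ring

lemma summable_kronCoeff_mul {τ v ξ : ℂ} (hv : OffLattice τ v) (hξ : |ξ.im| < τ.im) :
    Summable fun n : ℤ => kronCoeff τ v n * ex (n * ξ) := by
  have hτ : 0 < τ.im := (abs_nonneg _).trans_lt hξ
  obtain ⟨M, hM0, hM⟩ := exists_bound_kronCoeff hτ hv
  have hc : 0 < 2 * Real.pi * (τ.im - |ξ.im|) := by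
    have := Real.pi_pos; have := sub_pos.mpr hξ; positivity
  exact ((summable_exp_neg_abs hc).mul_left M).of_norm_bounded
    (norm_kronCoeff_mul_le hM0 hM le_rfl)

lemma hasSum_kron {τ v ξ : ℂ} (hv : OffLattice τ v) (hξ : 0 < ξ.im) (hξ' : ξ.im < τ.im) :
    HasSum (fun n : ℤ => ex (n * ξ) / (1 - ex (v + n * τ))) (kron τ v ξ) := by
  refine Summable.hasSum ?_
  simp_rw [kron_term_eq]
  exact (hasSum_geometric_int hξ).summable.add
    (summable_kronCoeff_mul hv (by rwa [abs_of_pos hξ]))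

lemma kron_eq_add {τ v ξ : ℂ} (hv : OffLattice τ v) (hξ : 0 < ξ.im) (hξ' : ξ.im < τ.im) :
    kron τ v ξ = 1 / (1 - ex ξ) + ∑' n : ℤ, kronCoeff τ v n * ex (n * ξ) := by
  rw [kron, ← (hasSum_geometric_int hξ).tsum_eq,
    ← (hasSum_geometric_int hξ).summable.tsum_add
      (summable_kronCoeff_mul hv (by rwa [abs_of_pos hξ]))]
  exact tsum_congr fun n => kron_term_eq τ v ξ n

/-- Behaviour of the Kronecker series at its pole `ξ = 0`. -/
lemma tendsto_one_sub_mul_kron {τ v : ℂ} (hτ : 0 < τ.im) (hv : OffLattice τ v) :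
    Filter.Tendsto (fun ε : ℝ => (1 - ex (ε * Complex.I)) * kron τ v (ε * Complex.I))
      (𝓝[>] 0) (𝓝 1) := by
  obtain ⟨M, hM0, hM⟩ := exists_bound_kronCoeff hτ hv
  have hc : 0 < 2 * Real.pi * (τ.im - τ.im / 2) := by
    have := Real.pi_pos; have : 0 < τ.im - τ.im / 2 := by linarith
    positivity
  have hsum := (summable_exp_neg_abs hc).mul_left M
  -- For ε < τ₂/2 a single summable series dominates the regular part, so only the geometric part
  -- survives in the limit.
  have hε : ∀ᶠ ε : ℝ in 𝓝[>] 0, 0 < ε ∧ ε < τ.im / 2 := by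
    filter_upwards [Ioo_mem_nhdsGT (half_pos hτ)] with ε h using h
  have hex : Filter.Tendsto (fun ε : ℝ => 1 - ex (ε * Complex.I)) (𝓝[>] 0) (𝓝 0) := by
    have : Continuous fun ε : ℝ => 1 - ex (ε * Complex.I) :=
      continuous_const.sub (continuous_ex.comp (by fun_prop))
    have h := this.tendsto 0
    simp only [Complex.ofReal_zero, zero_mul, ex_zero, sub_self] at h
    exact h.mono_left nhdsWithin_le_nhds
  have hz : Filter.Tendsto (fun ε : ℝ => (1 - ex (ε * Complex.I))
      * ∑' n : ℤ, kronCoeff τ v n * ex (n * (ε * Complex.I))) (𝓝[>] 0) (𝓝 0) := by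
    refine Filter.Tendsto.zero_mul_isBoundedUnder_le hex ?_
    refine Filter.isBoundedUnder_of_eventually_le
      (a := ∑' n : ℤ, M * Real.exp (-(2 * Real.pi * (τ.im - τ.im / 2) * |(n : ℝ)|))) ?_
    filter_upwards [hε] with ε h
    refine tsum_of_norm_bounded hsum.hasSum (norm_kronCoeff_mul_le hM0 hM ?_)
    simp only [Complex.mul_im, Complex.ofReal_re, Complex.I_im, mul_one, Complex.ofReal_im,
      Complex.I_re, mul_zero, add_zero]
    rw [abs_of_pos h.1]; exact h.2.le
  have h1 := hz.const_add 1
  rw [add_zero] at h1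
  refine h1.congr' ?_
  filter_upwards [hε] with ε h
  have him : ((ε : ℂ) * Complex.I).im = ε := by simp
  rw [kron_eq_add hv (by rw [him]; exact h.1) (by rw [him]; linarith [h.2]), mul_add,
    mul_one_div_cancel]
  intro h0
  have h2 : ‖ex (ε * Complex.I)‖ = 1 := by
    rw [← sub_eq_zero.mp h0, norm_one]
  rw [norm_ex, him, Real.exp_eq_one_iff] at h2
  have := mul_pos Real.two_pi_pos h.1
  linarith

lemma theta11Coeff_succ (τ : ℂ) (m : ℤ) :
    theta11Coeff τ (m + 1) = -ex (τ * (m + 1)) * theta11Coeff τ m := by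
  rw [theta11Coeff, theta11Coeff, ← neg_one_mul (ex _), ← ex_half, ← ex_add, ← ex_add]
  congr 1; push_cast; ring

lemma exists_bound_inv_one_sub_ex {τ v : ℂ} (hτ : 0 < τ.im) (hv : OffLattice τ v) :
    ∃ M : ℝ, 0 ≤ M ∧ ∀ n : ℤ, ‖1 / (1 - ex (v + n * τ))‖ ≤ M := by
  obtain ⟨M, hM0, hM⟩ := exists_bound_kronCoeff hτ hv
  refine ⟨M + 1, by positivity, fun n => ?_⟩
  have h1 : 1 / (1 - ex (v + n * τ)) = kronCoeff τ v n + if 0 ≤ n then 1 else 0 := by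
    rw [kronCoeff]; ring
  rw [h1]
  refine (norm_add_le _ _).trans <| add_le_add ((hM n).trans ?_) (by split_ifs <;> simp)
  refine mul_le_of_le_one_right hM0 ?_
  rw [Real.exp_le_one_iff]
  have := Real.pi_pos
  simp only [Left.neg_nonpos_iff]; positivity

lemma summable_theta11Coeff {τ : ℂ} (hτ : 0 < τ.im) (z : ℂ) :
    Summable fun n : ℤ => theta11Coeff τ n * ex (n * z) := by
  have := (summable_theta11 hτ z).mul_left (ex (-(z / 2)))
  refine this.congr fun n => ?_
  rw [mul_left_comm, ← ex_add]; congr 2; ring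

/-- In the Cauchy product of the two series, the coefficient D_N of y_ξ^{N+1/2} satisfies the
first-order recurrence D_{N+1} = -q^{N+1} y_v D_N. The coefficients of θ₁₁(ξ + v) satisfy it too, up
to the fixed factor y_v^{1/2}, so the two series are proportional. -/
lemma exists_kron_mul_theta11 {τ v : ℂ} (hτ : 0 < τ.im) (hv : OffLattice τ v) :
    ∃ d : ℂ, ∀ ξ : ℂ, 0 < ξ.im → ξ.im < τ.im →
      kron τ v ξ * theta11 τ ξ = d * theta11 τ (ξ + v) := by
  obtain ⟨M, hM0, hM⟩ := exists_bound_inv_one_sub_ex hτ hv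
  set D : ℤ → ℂ := fun N => ∑' n : ℤ, theta11Coeff τ (N - n) * (1 / (1 - ex (v + n * τ))) with hD
  have hS0 : ∀ (N : ℤ) (z : ℂ), Summable fun n : ℤ => theta11Coeff τ (N - n) * ex ((N - n : ℤ) * z) :=
    fun N z => (Equiv.subLeft N).summable_iff.mpr (summable_theta11Coeff hτ z)
  have hS : ∀ N, Summable fun n : ℤ => theta11Coeff τ (N - n) * (1 / (1 - ex (v + n * τ))) := by
    intro N
    have := ((hS0 N 0).norm).mul_right M
    refine this.of_norm_bounded fun n => ?_
    rw [norm_mul, mul_zero, ex_zero, mul_one]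
    exact mul_le_mul_of_nonneg_left (hM n) (norm_nonneg _)
  have hrec : ∀ N, D (N + 1) = -ex (τ * (N + 1) + v) * D N := by
    intro N
    -- The inhomogeneous term of the recurrence is θ₁₁(τ;τ) up to a factor, and τ is a lattice
    -- point.
    have h0 : ∑' n : ℤ, theta11Coeff τ (N - n) * ex ((N - n : ℤ) * τ) = 0 := by
      refine ((Equiv.subLeft N).tsum_eq (fun n : ℤ => theta11Coeff τ n * ex (n * τ))).trans ?_
      have h1 := (hasSum_theta11 hτ τ).tsum_eq
      have h2 := theta11_lattice hτ 1 0
      simp only [Int.cast_one, one_mul, Int.cast_zero, add_zero] at h2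
      rw [h2] at h1
      have h3 : ∀ n : ℤ, theta11Coeff τ n * ex ((n + 1 / 2) * τ)
          = theta11Coeff τ n * ex (n * τ) * ex (τ / 2) := by
        intro n; rw [mul_assoc, ← ex_add]; congr 2; ring
      rw [tsum_congr h3, tsum_mul_right] at h1
      exact (mul_eq_zero.mp h1).resolve_right (ex_ne_zero _)
    -- Uses 1/(1 - X) = 1 + X/(1 - X) with X = y_v qⁿ; the product of X with q^{N+1-n} no longer
    -- depends on n.
    have h4 : ∀ n : ℤ, theta11Coeff τ (N + 1 - n) * (1 / (1 - ex (v + n * τ)))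
        = -ex τ * (theta11Coeff τ (N - n) * ex ((N - n : ℤ) * τ))
          + -ex (τ * (N + 1) + v) * (theta11Coeff τ (N - n) * (1 / (1 - ex (v + n * τ)))) := by
      intro n
      have hX := hv.one_sub_ne_zero n
      rw [show N + 1 - n = (N - n) + 1 by ring, theta11Coeff_succ]
      have e1 : ex (τ * (((N - n : ℤ) : ℂ) + 1)) = ex τ * ex ((N - n : ℤ) * τ) := by
        rw [← ex_add]; congr 1; ring
      have e2 : ex (τ * (N + 1) + v) = ex τ * ex ((N - n : ℤ) * τ) * ex (v + n * τ) := by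
        rw [← ex_add, ← ex_add]; congr 1; push_cast; ring
      rw [e1, e2]
      generalize ex (v + n * τ) = E at *
      field_simp; ring
    rw [hD]
    simp only
    rw [tsum_congr h4, ((hS0 N τ).mul_left _).tsum_add ((hS N).mul_left _), tsum_mul_left,
      tsum_mul_left, h0]
    ring
  have ha0 : ∀ m, theta11Coeff τ m ≠ 0 := fun m => ex_ne_zero _
  have hform : ∀ N : ℤ, D N = D 0 / theta11Coeff τ 0 * (theta11Coeff τ N * ex (N * v)) := by
    have hstep : ∀ N : ℤ, theta11Coeff τ (N + 1) * ex ((N + 1 : ℤ) * v)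
        = -ex (τ * (N + 1) + v) * (theta11Coeff τ N * ex (N * v)) := by
      intro N
      rw [theta11Coeff_succ, ex_add, show (((N + 1 : ℤ)) : ℂ) * v = N * v + v by push_cast; ring,
        ex_add]; ring
    intro N
    induction N using Int.induction_on with
    | zero => simp [ex_zero, ha0]
    | succ i ih => rw [hrec, ih, hstep]; ring
    | pred i ih =>
      have h1 := hrec (-i - 1)
      have h2 := hstep (-i - 1)
      rw [sub_add_cancel] at h1 h2
      rw [h1, h2] at ih
      rw [← mul_right_inj' (neg_ne_zero.mpr (ex_ne_zero (τ * (((-i - 1 : ℤ) : ℂ) + 1) + v))), ih]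
      ring
  refine ⟨D 0 / theta11Coeff τ 0 * ex (-(v / 2)), fun ξ hξ hξ' => ?_⟩
  have hA := (hasSum_kron hv hξ hξ').summable.norm
  have hB := (summable_theta11 hτ ξ).norm
  have hprod := summable_mul_of_summable_norm hA hB
  -- Reindexing of the double series by total degree: (N, n) ↦ (n, N - n).
  let e : ℤ × ℤ ≃ ℤ × ℤ :=
    ⟨fun p => (p.2, p.1 - p.2), fun p => (p.1 + p.2, p.1), fun p => by simp, fun p => by simp⟩
  rw [kron, ← (hasSum_theta11 hτ ξ).tsum_eq, tsum_mul_tsum_of_summable_norm hA hB, ← e.tsum_eq]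
  rw [← e.summable_iff] at hprod
  refine (hprod.tsum_prod' fun N => hprod.prod_factor N).trans ?_
  rw [← (hasSum_theta11 hτ (ξ + v)).tsum_eq, ← tsum_mul_left]
  refine tsum_congr fun N => ?_
  have h5 : ∀ n : ℤ, ((fun x : ℤ × ℤ => ex (x.1 * ξ) / (1 - ex (v + x.1 * τ)) *
      (theta11Coeff τ x.2 * ex ((x.2 + 1 / 2) * ξ))) ∘ e) (N, n)
      = ex ((N + 1 / 2) * ξ) * (theta11Coeff τ (N - n) * (1 / (1 - ex (v + n * τ)))) := by
    intro n
    simp only [Function.comp_apply, e, Equiv.coe_fn_mk]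
    have : ex ((N + 1 / 2) * ξ) = ex (n * ξ) * ex ((((N - n : ℤ) : ℂ) + 1 / 2) * ξ) := by
      rw [← ex_add]; congr 1; push_cast; ring
    rw [this]; ring
  rw [tsum_congr h5, tsum_mul_left]
  have h6 := hform N
  rw [hD] at h6
  simp only at h6
  rw [h6]
  have : ex ((N + 1 / 2) * (ξ + v)) * ex (-(v / 2)) = ex ((N + 1 / 2) * ξ) * ex (N * v) := by
    rw [← ex_add, ← ex_add]; congr 1; ring
  linear_combination -(∑' n : ℤ, theta11Coeff τ (0 - n) * (1 / (1 - ex (v + n * τ)))) / theta11Coeff τ 0 * theta11Coeff τ N * this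

/-! ### Fourier coefficients -/

lemma hasSum_of_eq {ι : Type*} {f g : ι → ℂ} {a : ℂ} (h : ∀ n, f n = g n) (hf : HasSum f a) :
    HasSum g a := (funext h : f = g) ▸ hf

lemma integral_ex_int (n : ℤ) : ∫ t in (0 : ℝ)..1, ex (n * t) = if n = 0 then 1 else 0 := by
  split_ifs with h
  · simp [h, ex_zero]
  · have hc : (2 * Real.pi * Complex.I * n : ℂ) ≠ 0 :=
      mul_ne_zero Complex.two_pi_I_ne_zero (by exact_mod_cast h)
    have := integral_exp_mul_complex (a := 0) (b := 1) hc
    simp only [ex]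
    simp_rw [← mul_assoc]
    rw [this]
    have h1 := ex_int n
    rw [ex] at h1
    simp [h1]

/-- Termwise integration of an absolutely convergent trigonometric series against a continuous
function. -/
lemma integral_mul_tsum {f : ℝ → ℂ} (hf : Continuous f) {c : ℤ → ℂ} (hc : Summable c) (a : ℤ → ℤ) :
    HasSum (fun n => c n * ∫ t in (0 : ℝ)..1, f t * ex (a n * t))
      (∫ t in (0 : ℝ)..1, f t * ∑' n : ℤ, c n * ex (a n * t)) := by
  have hcont : ∀ n : ℤ, Continuous fun t : ℝ => c n * (f t * ex (a n * t)) := fun n =>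
    continuous_const.mul (hf.mul (continuous_ex.comp (by fun_prop)))
  let F : ℤ → C(ℝ, ℂ) := fun n => ⟨_, hcont n⟩
  obtain ⟨B, hB⟩ := (isCompact_uIcc (a := (0 : ℝ)) (b := 1)).exists_bound_of_continuousOn
    hf.continuousOn
  have hex : ∀ (n : ℤ) (t : ℝ), ‖ex (n * t)‖ = 1 := fun n t => by rw [norm_ex]; simp
  have hsum : Summable fun n => ‖(F n).restrict
      (⟨Set.uIcc 0 1, isCompact_uIcc⟩ : TopologicalSpace.Compacts ℝ)‖ := by
    refine (hc.norm.mul_right B).of_nonneg_of_le (fun _ => norm_nonneg _) fun n => ?_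
    have hB0 : 0 ≤ B := (norm_nonneg _).trans (hB 0 (by simp))
    refine (ContinuousMap.norm_le _ (by positivity)).mpr fun t => ?_
    change ‖c n * (f t * ex (a n * (t : ℝ)))‖ ≤ _
    rw [norm_mul, norm_mul, hex, mul_one]
    exact mul_le_mul_of_nonneg_left (hB t t.2) (norm_nonneg _)
  have h := intervalIntegral.hasSum_intervalIntegral_of_summable_norm hsum
  have e : ∫ t in (0 : ℝ)..1, f t * ∑' n : ℤ, c n * ex (a n * t)
      = ∫ t in (0 : ℝ)..1, ∑' n : ℤ, F n t := by
    refine intervalIntegral.integral_congr fun t _ => ?_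
    change f t * ∑' n : ℤ, c n * ex (a n * t) = ∑' n : ℤ, c n * (f t * ex (a n * t))
    rw [← tsum_mul_left]
    exact tsum_congr fun n => by ring
  rw [e]
  exact hasSum_of_eq (fun n => intervalIntegral.integral_const_mul _ _) h

/-- Fourier coefficients of a series are its coefficients. -/
lemma integral_tsum_ex {c : ℤ → ℂ} (hc : Summable c) (m : ℤ) :
    ∫ t in (0 : ℝ)..1, (∑' n : ℤ, c n * ex (n * t)) * ex (-(m * t)) = c m := by
  have h := (integral_mul_tsum (f := fun t => ex (-(m * t)))
    (continuous_ex.comp (by fun_prop)) hc id).tsum_eq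
  simp_rw [mul_comm (∑' n : ℤ, _) (ex _)]
  simp only [id] at h
  rw [← h, tsum_eq_single m]
  · have : ∀ t : ℝ, ex (-(m * t)) * ex (m * t) = 1 := fun t => by
      rw [← ex_add, neg_add_cancel, ex_zero]
    simp [this]
  · intro n hn
    have : ∀ t : ℝ, ex (-(m * t)) * ex (n * t) = ex ((n - m : ℤ) * t) := fun t => by
      rw [← ex_add]; congr 1; push_cast; ring
    simp_rw [this]
    rw [integral_ex_int, if_neg (sub_ne_zero.mpr hn), mul_zero]

/-! ### Zeros of `θ₁₁` -/

/-- If θ₁₁ vanished identically, so would its Fourier coefficients, but these are exponentials. -/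
lemma exists_theta11_ne_zero {τ : ℂ} (hτ : 0 < τ.im) : ∃ z, theta11 τ z ≠ 0 := by
  by_contra! h
  have h1 := integral_tsum_ex (c := theta11Coeff τ)
    (by simpa [ex_zero] using summable_theta11Coeff hτ 0) 0
  have h2 : ∀ t : ℝ, ∑' n : ℤ, theta11Coeff τ n * ex (n * t) = 0 := by
    intro t
    have h3 := (hasSum_theta11 hτ t).tsum_eq
    have h4 : ∀ n : ℤ, theta11Coeff τ n * ex ((n + 1 / 2) * t)
        = theta11Coeff τ n * ex (n * t) * ex (t / 2) := by
      intro n; rw [mul_assoc, ← ex_add]; congr 2; ring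
    rw [tsum_congr h4, tsum_mul_right, h] at h3
    exact (mul_eq_zero.mp h3).resolve_right (ex_ne_zero _)
  simp only [h2, zero_mul, intervalIntegral.integral_zero] at h1
  exact ex_ne_zero _ h1.symm

/-- The constant in Kronecker's formula, `-θ₁₁'(0)/2πi`. -/
def kronConst (τ : ℂ) : ℂ := -deriv (theta11 τ) 0 / (2 * Real.pi * Complex.I)

lemma theta11_zero {τ : ℂ} (hτ : 0 < τ.im) : theta11 τ 0 = 0 := by
  simpa using theta11_lattice hτ 0 0

lemma tendsto_I_mul : Filter.Tendsto (fun ε : ℝ => (ε : ℂ) * Complex.I) (𝓝[>] 0) (𝓝[≠] 0) := by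
  refine tendsto_nhdsWithin_iff.mpr ⟨?_, ?_⟩
  · have : Continuous fun ε : ℝ => (ε : ℂ) * Complex.I := by fun_prop
    have h := this.tendsto 0
    simp only [Complex.ofReal_zero, zero_mul] at h
    exact h.mono_left nhdsWithin_le_nhds
  · filter_upwards [self_mem_nhdsWithin] with ε (hε : 0 < ε)
    simp [hε.ne']

lemma tendsto_theta11_div {τ : ℂ} (hτ : 0 < τ.im) :
    Filter.Tendsto (fun z => theta11 τ z / (1 - ex z)) (𝓝[≠] 0) (𝓝 (kronConst τ)) := by
  have h1 := ((differentiable_theta11 hτ) 0).hasDerivAt.tendsto_slope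
  have hex : HasDerivAt ex (2 * Real.pi * Complex.I) 0 := by
    have : HasDerivAt (fun z : ℂ => 2 * Real.pi * Complex.I * z) (2 * Real.pi * Complex.I) 0 := by
      simpa using (hasDerivAt_id (0 : ℂ)).const_mul (2 * Real.pi * Complex.I)
    have h := this.cexp
    simp only [mul_zero, Complex.exp_zero, one_mul] at h
    exact h
  have h2 := hex.tendsto_slope
  have h3 := (h1.div h2 Complex.two_pi_I_ne_zero).neg
  rw [kronConst, neg_div]
  refine h3.congr' ?_
  filter_upwards [self_mem_nhdsWithin] with z (hz : z ≠ 0)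
  rw [Pi.div_apply, slope_def_field, slope_def_field, theta11_zero hτ, ex_zero, sub_zero, sub_zero,
    div_div_div_cancel_right₀ hz, ← div_neg, neg_sub]

/-- Kronecker's formula, up to the nonvanishing of `θ₁₁(v)`. -/
lemma kron_mul_theta11_mul {τ v ξ : ℂ} (hτ : 0 < τ.im) (hv : OffLattice τ v) (hξ : 0 < ξ.im)
    (hξ' : ξ.im < τ.im) :
    kron τ v ξ * theta11 τ ξ * theta11 τ v = kronConst τ * theta11 τ (ξ + v) := by
  obtain ⟨d, hd⟩ := exists_kron_mul_theta11 hτ hv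
  -- The constant d is found by letting ξ → 0 along the imaginary axis. The identity stays
  -- multiplied by θ₁₁(v), whose nonvanishing is itself deduced from this formula below.
  suffices h : d * theta11 τ v = kronConst τ by
    rw [hd ξ hξ hξ', ← h]; ring
  have h1 := (tendsto_one_sub_mul_kron hτ hv).mul ((tendsto_theta11_div hτ).comp tendsto_I_mul)
  rw [one_mul] at h1
  have h2 : Filter.Tendsto (fun ε : ℝ => d * theta11 τ (ε * Complex.I + v)) (𝓝[>] 0)
      (𝓝 (d * theta11 τ v)) := by
    have : Continuous fun ε : ℝ => d * theta11 τ (ε * Complex.I + v) :=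
      continuous_const.mul ((differentiable_theta11 hτ).continuous.comp (by fun_prop))
    have h := this.tendsto 0
    simp only [Complex.ofReal_zero, zero_mul, zero_add] at h
    exact h.mono_left nhdsWithin_le_nhds
  refine tendsto_nhds_unique h2 (h1.congr' ?_)
  filter_upwards [Ioo_mem_nhdsGT hτ] with ε hε
  have him : ((ε : ℂ) * Complex.I).im = ε := by simp
  rw [← hd _ (by rw [him]; exact hε.1) (by rw [him]; exact hε.2)]
  simp only [Function.comp_apply]
  have : 1 - ex (ε * Complex.I) ≠ 0 := by
    intro h0
    have h2 : ‖ex (ε * Complex.I)‖ = 1 := by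
      rw [← sub_eq_zero.mp h0, norm_one]
    rw [norm_ex, him, Real.exp_eq_one_iff] at h2
    have := mul_pos Real.two_pi_pos hε.1
    linarith
  field_simp

/-- With constant 0, Kronecker's formula would make θ₁₁ vanish at iε for all small ε > 0, because
the Kronecker series is nonzero near its pole. The identity theorem would then give θ₁₁ = 0. -/
lemma kronConst_ne_zero {τ : ℂ} (hτ : 0 < τ.im) : kronConst τ ≠ 0 := by
  intro h0
  obtain ⟨v, hv0⟩ := exists_theta11_ne_zero hτ
  have hv : OffLattice τ v := fun a b h => hv0 (h ▸ theta11_lattice hτ a b)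
  have h1 : ∀ᶠ ε : ℝ in 𝓝[>] 0, theta11 τ (ε * Complex.I) = 0 := by
    have h2 := (tendsto_one_sub_mul_kron hτ hv).eventually_ne one_ne_zero
    filter_upwards [Ioo_mem_nhdsGT hτ, h2] with ε hε h2
    have him : ((ε : ℂ) * Complex.I).im = ε := by simp
    have h3 := kron_mul_theta11_mul hτ hv (by rw [him]; exact hε.1) (by rw [him]; exact hε.2)
    rw [h0, zero_mul] at h3
    exact (mul_eq_zero.mp ((mul_eq_zero.mp h3).resolve_right hv0)).resolve_left
      (right_ne_zero_of_mul h2)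
  have h4 : ∃ᶠ z in 𝓝[≠] 0, theta11 τ z = 0 := tendsto_I_mul.frequently h1.frequently
  have h5 := ((differentiable_theta11 hτ).differentiableOn.analyticOnNhd isOpen_univ)
    |>.eqOn_zero_of_preconnected_of_frequently_eq_zero isPreconnected_univ (Set.mem_univ 0) h4
  exact hv0 (h5 (Set.mem_univ v))

/-- If θ₁₁(v) = 0 off the lattice, Kronecker's formula with its nonzero constant makes θ₁₁ vanish on
a whole open strip. So the zeros are exactly the lattice, without the argument principle; they are
simple because `kronConst` is a multiple of θ₁₁'(0). -/
lemma theta11_ne_zero {τ v : ℂ} (hτ : 0 < τ.im) (hv : OffLattice τ v) : theta11 τ v ≠ 0 := by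
  intro h0
  obtain ⟨d, hd⟩ := exists_kron_mul_theta11 hτ hv
  obtain ⟨z, hz⟩ := exists_theta11_ne_zero hτ
  have h1 : ∀ ξ : ℂ, 0 < ξ.im → ξ.im < τ.im → theta11 τ (ξ + v) = 0 := by
    intro ξ h h'
    have := kron_mul_theta11_mul hτ hv h h'
    rw [h0, mul_zero] at this
    exact (mul_eq_zero.mp this.symm).resolve_left (kronConst_ne_zero hτ)
  have h2 : ∀ᶠ z in 𝓝 (v + τ / 2), theta11 τ z = 0 := by
    have hopen : IsOpen {z : ℂ | v.im < z.im ∧ z.im < v.im + τ.im} :=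
      (isOpen_lt continuous_const Complex.continuous_im).inter
        (isOpen_lt Complex.continuous_im continuous_const)
    have hmem : v + τ / 2 ∈ {z : ℂ | v.im < z.im ∧ z.im < v.im + τ.im} := by
      have : (τ / 2).im = τ.im / 2 := by simp
      simp only [Set.mem_ofPred_eq, Complex.add_im, this]
      constructor <;> linarith
    filter_upwards [hopen.mem_nhds hmem] with z hz
    have := h1 (z - v) (by rw [Complex.sub_im]; linarith [hz.1])
      (by rw [Complex.sub_im]; linarith [hz.2])
    rwa [sub_add_cancel] at this
  have h5 := ((differentiable_theta11 hτ).differentiableOn.analyticOnNhd isOpen_univ)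
    |>.eqOn_zero_of_preconnected_of_eventuallyEq_zero isPreconnected_univ (Set.mem_univ _) h2
  exact hz (h5 (Set.mem_univ z))

lemma deriv_theta11_zero_ne {τ : ℂ} (hτ : 0 < τ.im) : deriv (theta11 τ) 0 ≠ 0 := by
  intro h
  apply kronConst_ne_zero hτ
  simp [kronConst, h]

lemma theta11_eq_zero_iff {τ v : ℂ} (hτ : 0 < τ.im) :
    theta11 τ v = 0 ↔ ∃ a b : ℤ, v = a * τ + b := by
  constructor
  · intro h
    by_contra! hv
    exact theta11_ne_zero hτ hv h
  · rintro ⟨a, b, rfl⟩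
    exact theta11_lattice hτ a b

lemma theta11_add_tau_mul {τ : ℂ} (hτ : 0 < τ.im) (x : ℂ) (m : ℤ) :
    theta11 τ (x + m * τ) = ex (m / 2 - m ^ 2 * τ / 2 - m * x) * theta11 τ x := by
  have hstep : ∀ z, theta11 τ (z + τ) = ex (1 / 2 - τ / 2 - z) * theta11 τ z := fun z => by
    rw [theta11_add_tau hτ, show (1 / 2 - τ / 2 - z) = 1 / 2 + (-(τ / 2) - z) by ring, ex_add,
      ex_half]; ring
  induction m using Int.induction_on with
  | zero => simp [ex_zero]
  | succ i ih =>
    rw [show x + ((i + 1 : ℤ) : ℂ) * τ = (x + (i : ℤ) * τ) + τ by push_cast; ring,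
      hstep, ih, ← mul_assoc, ← ex_add]
    congr 2; push_cast; ring
  | pred i ih =>
    have h := hstep (x + ((-i - 1 : ℤ) : ℂ) * τ)
    rw [show x + ((-i - 1 : ℤ) : ℂ) * τ + τ = x + ((-i : ℤ) : ℂ) * τ by
      push_cast; ring, ih] at h
    rw [← mul_right_inj' (ex_ne_zero
      (1 / 2 - τ / 2 - (x + ((-i - 1 : ℤ) : ℂ) * τ))), ← h, ← mul_assoc, ← ex_add]
    congr 2; push_cast; ring

lemma theta11_add_lattice {τ : ℂ} (hτ : 0 < τ.im) (x : ℂ) (m n : ℤ) :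
    theta11 τ (x + (m * τ + n)) = ex (n / 2 + (m / 2 - m ^ 2 * τ / 2 - m * x)) * theta11 τ x := by
  rw [← add_assoc, theta11_add_int hτ, theta11_add_tau_mul hτ, ← mul_assoc, ← ex_add]

lemma deriv_theta11_lattice_ne {τ : ℂ} (hτ : 0 < τ.im) (m n : ℤ) :
    deriv (theta11 τ) (m * τ + n) ≠ 0 := by
  have h1 : ∀ x, theta11 τ (x + (m * τ + n))
      = ex (n / 2 + (m / 2 - m ^ 2 * τ / 2 - m * x)) * theta11 τ x :=
    fun x => theta11_add_lattice hτ x m n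
  have h2 : deriv (fun x => theta11 τ (x + (m * τ + n))) 0 = deriv (theta11 τ) (m * τ + n) := by
    rw [deriv_comp_add_const, zero_add]
  rw [← h2, funext h1]
  have h3 : DifferentiableAt ℂ (fun x : ℂ => ex (n / 2 + (m / 2 - m ^ 2 * τ / 2 - m * x))) 0 :=
    differentiable_ex.differentiableAt.comp 0 (by fun_prop)
  rw [deriv_fun_mul h3 ((differentiable_theta11 hτ) 0), theta11_zero hτ, mul_zero, zero_add]
  exact mul_ne_zero (ex_ne_zero _) (deriv_theta11_zero_ne hτ)

/-! ### The meromorphic continuation of the Kronecker series -/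

/-- `kronConst * θ₁₁(ξ + v) / (θ₁₁(ξ) θ₁₁(v))`. -/
def kronFn (τ v ξ : ℂ) : ℂ := kronConst τ * theta11 τ (ξ + v) / (theta11 τ ξ * theta11 τ v)

lemma offLattice_of_im {τ ξ : ℂ} {N : ℤ} (hτ : 0 < τ.im) (h1 : N * τ.im < ξ.im)
    (h2 : ξ.im < (N + 1) * τ.im) : OffLattice τ ξ := by
  rintro a b rfl
  have him : ((a : ℂ) * τ + b).im = a * τ.im := by simp
  rw [him] at h1 h2
  have h3 := lt_of_mul_lt_mul_right h1 hτ.le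
  have h4 := lt_of_mul_lt_mul_right h2 hτ.le
  have h5 : N < a := by exact_mod_cast h3
  have h6 : a < N + 1 := by exact_mod_cast h4
  omega

lemma kronFn_add_tau_mul {τ : ℂ} (hτ : 0 < τ.im) (v ξ : ℂ) (N : ℤ) :
    kronFn τ v (ξ + N * τ) = ex (-(N * v)) * kronFn τ v ξ := by
  rw [kronFn, kronFn, add_right_comm, theta11_add_tau_mul hτ, theta11_add_tau_mul hτ]
  have : ex (N / 2 - N ^ 2 * τ / 2 - N * (ξ + v))
      = ex (N / 2 - N ^ 2 * τ / 2 - N * ξ) * ex (-(N * v)) := by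
    rw [← ex_add]; congr 1; ring
  rw [this]
  have := ex_ne_zero (N / 2 - N ^ 2 * τ / 2 - N * ξ)
  generalize ex (N / 2 - N ^ 2 * τ / 2 - N * ξ) = E at *
  rw [show kronConst τ * (E * ex (-(N * v)) * theta11 τ (ξ + v))
    = E * (ex (-(N * v)) * (kronConst τ * theta11 τ (ξ + v))) by ring, mul_assoc E,
    mul_div_mul_left _ _ this, mul_div_assoc]

lemma kronFn_eq_kron {τ v ξ : ℂ} (hτ : 0 < τ.im) (hv : OffLattice τ v) (hξ : 0 < ξ.im)
    (hξ' : ξ.im < τ.im) : kronFn τ v ξ = kron τ v ξ := by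
  have h1 : theta11 τ ξ ≠ 0 :=
    theta11_ne_zero hτ (offLattice_of_im (N := 0) hτ (by simpa) (by simpa))
  have h2 := theta11_ne_zero hτ hv
  rw [kronFn, div_eq_iff (mul_ne_zero h1 h2), ← kron_mul_theta11_mul hτ hv hξ hξ']
  ring

/-- The expansion of the Kronecker function in the strip `N τ₂ < Im ξ < (N+1) τ₂`. -/
lemma hasSum_kronFn {τ v ξ : ℂ} (hτ : 0 < τ.im) (hv : OffLattice τ v) {N : ℤ}
    (h1 : N * τ.im < ξ.im) (h2 : ξ.im < (N + 1) * τ.im) :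
    HasSum (fun n : ℤ => ex (n * ξ) * (ex (-(N * (v + n * τ))) / (1 - ex (v + n * τ))))
      (kronFn τ v ξ) := by
  have him : (ξ - N * τ).im = ξ.im - N * τ.im := by simp
  have hs := hasSum_kron hv (ξ := ξ - N * τ) (by rw [him]; linarith) (by rw [him]; linarith)
  rw [← kronFn_eq_kron hτ hv (by rw [him]; linarith) (by rw [him]; linarith)] at hs
  have h3 := kronFn_add_tau_mul hτ v (ξ - N * τ) N
  rw [sub_add_cancel] at h3
  rw [h3]
  refine hasSum_of_eq (fun n => ?_) (hs.mul_left (ex (-(N * v))))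
  rw [← mul_div_assoc, ← mul_div_assoc, ← ex_add, ← ex_add]
  congr 2; ring

/-! ### The affine `SU(2)` characters -/

/-- The denominator `ϑ_{2,1} - ϑ_{2,-1}` of the characters. -/
lemma oddTheta_two_eq {τ : ℂ} (hτ : 0 < τ.im) (z : ℂ) :
    oddTheta 2 1 τ z = -Complex.I * theta11 τ z := by
  rw [theta11_eq_oddTheta hτ]
  linear_combination oddTheta 2 1 τ z * Complex.I_sq

lemma oddTheta_two_eq_zero_iff {τ z : ℂ} (hτ : 0 < τ.im) :
    oddTheta 2 1 τ z = 0 ↔ ∃ a b : ℤ, z = a * τ + b := by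
  rw [← theta11_eq_zero_iff hτ, oddTheta_two_eq hτ]; simp

lemma deriv_oddTheta_two_ne {τ : ℂ} (hτ : 0 < τ.im) (a b : ℤ) :
    deriv (oddTheta 2 1 τ) (a * τ + b) ≠ 0 := by
  rw [funext (oddTheta_two_eq hτ), deriv_const_mul_field]
  exact mul_ne_zero (neg_ne_zero.mpr Complex.I_ne_zero) (deriv_theta11_lattice_ne hτ a b)

lemma su2Char_def (K : ℕ) (l : ℤ) (τ z : ℂ) : su2Char K l τ z = Filter.limUnder (𝓝[≠] z)
    fun ζ => oddTheta (K + 2) (l + 1) τ ζ / oddTheta 2 1 τ ζ := rfl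

lemma su2Char_of_ne_zero (K : ℕ) (l : ℤ) {τ z : ℂ} (hτ : 0 < τ.im) (hz : oddTheta 2 1 τ z ≠ 0) :
    su2Char K l τ z = oddTheta (K + 2) (l + 1) τ z / oddTheta 2 1 τ z := by
  rw [su2Char_def]
  refine Filter.Tendsto.limUnder_eq ?_
  have h1 := (differentiable_oddTheta (k := K + 2) (by omega) (l + 1) hτ).continuous.tendsto z
  have h2 := (differentiable_oddTheta (k := 2) two_pos 1 hτ).continuous.tendsto z
  exact (h1.div h2 hz).mono_left nhdsWithin_le_nhds

/-- Numerator and denominator both vanish at lattice points, the denominator simply. Dividing each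
by z - z₀ gives a regular quotient whose value at z₀ is the limit in the definition. -/
lemma su2Char_eventuallyEq_lattice (K : ℕ) (l : ℤ) {τ : ℂ} (hτ : 0 < τ.im) (a b : ℤ) :
    su2Char K l τ =ᶠ[𝓝 (a * τ + b)] fun z => dslope (oddTheta (K + 2) (l + 1) τ) (a * τ + b) z
      / dslope (oddTheta 2 1 τ) (a * τ + b) z := by
  set z₀ : ℂ := a * τ + b
  have hN := differentiable_oddTheta (k := K + 2) (by omega) (l + 1) hτ
  have hD := differentiable_oddTheta (k := 2) two_pos 1 hτ
  have hN' : ContinuousAt (dslope (oddTheta (K + 2) (l + 1) τ) z₀) z₀ :=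
    continuousAt_dslope_same.mpr (hN z₀)
  have hD' : ContinuousAt (dslope (oddTheta 2 1 τ) z₀) z₀ := continuousAt_dslope_same.mpr (hD z₀)
  have hD0 : dslope (oddTheta 2 1 τ) z₀ z₀ ≠ 0 := by
    rw [dslope_same]; exact deriv_oddTheta_two_ne hτ a b
  have key : ∀ z, z ≠ z₀ → oddTheta (K + 2) (l + 1) τ z / oddTheta 2 1 τ z
      = dslope (oddTheta (K + 2) (l + 1) τ) z₀ z / dslope (oddTheta 2 1 τ) z₀ z := by
    intro z hz
    rw [dslope_of_ne _ hz, dslope_of_ne _ hz, slope_def_field, slope_def_field,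
      oddTheta_lattice (by omega), oddTheta_lattice two_pos, sub_zero, sub_zero,
      div_div_div_cancel_right₀ (sub_ne_zero.mpr hz)]
  filter_upwards [hD'.eventually_ne hD0] with z hz
  by_cases h : z = z₀
  · subst h
    rw [su2Char_def]
    refine Filter.Tendsto.limUnder_eq ?_
    refine ((hN'.tendsto.div hD'.tendsto hz).mono_left nhdsWithin_le_nhds).congr' ?_
    filter_upwards [self_mem_nhdsWithin] with ζ hζ
    exact (key ζ hζ).symm
  · rw [← key z h]
    refine su2Char_of_ne_zero K l hτ ?_
    rw [dslope_of_ne _ h, slope_def_field, oddTheta_lattice two_pos, sub_zero] at hz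
    exact fun h0 => hz (by rw [h0, zero_div])

lemma differentiable_su2Char (K : ℕ) (l : ℤ) {τ : ℂ} (hτ : 0 < τ.im) :
    Differentiable ℂ (su2Char K l τ) := by
  intro z
  have hN := differentiable_oddTheta (k := K + 2) (by omega) (l + 1) hτ
  have hD := differentiable_oddTheta (k := 2) two_pos 1 hτ
  by_cases h : oddTheta 2 1 τ z = 0
  · obtain ⟨a, b, rfl⟩ := (oddTheta_two_eq_zero_iff hτ).mp h
    refine DifferentiableAt.congr_of_eventuallyEq ?_ (su2Char_eventuallyEq_lattice K l hτ a b)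
    refine DifferentiableAt.div ?_ ?_ ?_
    · exact ((Complex.differentiableOn_dslope Filter.univ_mem).mpr
        hN.differentiableOn).differentiableAt Filter.univ_mem
    · exact ((Complex.differentiableOn_dslope Filter.univ_mem).mpr
        hD.differentiableOn).differentiableAt Filter.univ_mem
    · rw [dslope_same]; exact deriv_oddTheta_two_ne hτ a b
  · refine DifferentiableAt.congr_of_eventuallyEq ((hN z).div (hD z) h) ?_
    filter_upwards [hD.continuous.continuousAt.eventually_ne h] with ζ hζ
    exact su2Char_of_ne_zero K l hτ hζ

lemma su2Char_mul (K : ℕ) (l : ℤ) {τ : ℂ} (hτ : 0 < τ.im) (z : ℂ) :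
    su2Char K l τ z * oddTheta 2 1 τ z = oddTheta (K + 2) (l + 1) τ z := by
  by_cases h : oddTheta 2 1 τ z = 0
  · obtain ⟨a, b, rfl⟩ := (oddTheta_two_eq_zero_iff hτ).mp h
    rw [h, mul_zero, oddTheta_lattice (by omega)]
  · rw [su2Char_of_ne_zero K l hτ h, div_mul_cancel₀ _ h]

/-- The zeros of the denominator are countable, so their complement is dense. Identities between
characters may therefore be checked after clearing the denominator. -/
lemma eq_of_mul_oddTheta_two {τ : ℂ} (hτ : 0 < τ.im) {f g : ℂ → ℂ} (hf : Continuous f)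
    (hg : Continuous g) (h : ∀ z, f z * oddTheta 2 1 τ z = g z * oddTheta 2 1 τ z) (z : ℂ) :
    f z = g z := by
  have hcount : {z : ℂ | oddTheta 2 1 τ z = 0}.Countable := by
    refine (Set.countable_range fun p : ℤ × ℤ => (p.1 * τ + p.2 : ℂ)).mono ?_
    intro z hz
    obtain ⟨a, b, rfl⟩ := (oddTheta_two_eq_zero_iff hτ).mp hz
    exact ⟨(a, b), rfl⟩
  refine congrFun (hf.ext_on (hcount.dense_compl ℝ) hg ?_) z
  intro z hz
  exact mul_right_cancel₀ hz (h z)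

lemma continuous_su2Char (K : ℕ) (l : ℤ) {τ : ℂ} (hτ : 0 < τ.im) : Continuous (su2Char K l τ) :=
  (differentiable_su2Char K l hτ).continuous

lemma su2Char_zero {τ : ℂ} (hτ : 0 < τ.im) (z : ℂ) : su2Char 0 0 τ z = 1 := by
  refine eq_of_mul_oddTheta_two hτ (continuous_su2Char 0 0 hτ) continuous_const (fun z => ?_) z
  rw [su2Char_mul 0 0 hτ, one_mul]; rfl

lemma su2Char_add_one (K : ℕ) (l : ℤ) {τ : ℂ} (hτ : 0 < τ.im) (z : ℂ) :
    su2Char K l τ (z + 1) = ex (l / 2) * su2Char K l τ z := by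
  refine eq_of_mul_oddTheta_two hτ (f := fun z => su2Char K l τ (z + 1))
    (g := fun z => ex (l / 2) * su2Char K l τ z)
    ((continuous_su2Char K l hτ).comp (by fun_prop))
    (continuous_const.mul (continuous_su2Char K l hτ)) (fun z => ?_) z
  have h1 := su2Char_mul K l hτ (z + 1)
  rw [oddTheta_add_one, oddTheta_add_one, ← su2Char_mul K l hτ z] at h1
  push_cast at h1
  rw [add_div, ex_add, ex_half] at h1
  linear_combination -h1

lemma su2Char_add_tau (K : ℕ) (l : ℤ) {τ : ℂ} (hτ : 0 < τ.im) (z : ℂ) :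
    su2Char K l τ (z + τ) = ex (-(K * τ / 4) - K * z / 2) * su2Char K (K - l) τ z := by
  have hc : Continuous fun z : ℂ => ex (-(K * τ / 4) - K * z / 2) :=
    continuous_ex.comp (by fun_prop)
  refine eq_of_mul_oddTheta_two hτ (f := fun z => su2Char K l τ (z + τ))
    (g := fun z => ex (-(K * τ / 4) - K * z / 2) * su2Char K (K - l) τ z)
    ((continuous_su2Char K l hτ).comp (by fun_prop))
    (hc.mul (continuous_su2Char K _ hτ)) (fun z => ?_) z
  have h1 := su2Char_mul K l hτ (z + τ)
  rw [oddTheta_add_tau (k := K + 2) (by omega), oddTheta_add_tau (k := 2) two_pos,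
    show ((K + 2 : ℕ) : ℤ) - (l + 1) = (K - l) + 1 by push_cast; ring,
    ← su2Char_mul K (K - l) hτ z, show ((2 : ℕ) : ℤ) - 1 = 1 by norm_num] at h1
  have h2 : ex (-((K + 2 : ℕ) * τ / 4) - (K + 2 : ℕ) * z / 2)
      = ex (-((2 : ℕ) * τ / 4) - (2 : ℕ) * z / 2) * ex (-(K * τ / 4) - K * z / 2) := by
    rw [← ex_add]; congr 1; push_cast; ring
  rw [h2] at h1
  refine mul_left_cancel₀ (neg_ne_zero.mpr (ex_ne_zero (-((2 : ℕ) * τ / 4) - (2 : ℕ) * z / 2))) ?_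
  linear_combination h1

lemma su2Char_tau_add_one (K : ℕ) (l : ℤ) {τ : ℂ} (hτ : 0 < τ.im) (z : ℂ) :
    su2Char K l (τ + 1) z
      = ex ((l + 1) ^ 2 / (4 * (K + 2)) - 1 / 8) * su2Char K l τ z := by
  have hτ' : 0 < (τ + 1).im := by simpa using hτ
  refine eq_of_mul_oddTheta_two hτ
    (g := fun z => ex ((l + 1) ^ 2 / (4 * (K + 2)) - 1 / 8) * su2Char K l τ z)
    (continuous_su2Char K l hτ')
    (continuous_const.mul (continuous_su2Char K l hτ)) (fun z => ?_) z
  have h1 := su2Char_mul K l hτ' z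
  rw [oddTheta_tau_add_one two_pos, oddTheta_tau_add_one (by omega), ← su2Char_mul K l hτ z] at h1
  have h2 : ex (((l + 1 : ℤ) : ℂ) ^ 2 / (4 * (K + 2 : ℕ)))
      = ex (((1 : ℤ) : ℂ) ^ 2 / (4 * (2 : ℕ))) * ex ((l + 1) ^ 2 / (4 * (K + 2)) - 1 / 8) := by
    rw [← ex_add]; congr 1; push_cast; ring
  rw [h2] at h1
  refine mul_left_cancel₀ (ex_ne_zero (((1 : ℤ) : ℂ) ^ 2 / (4 * (2 : ℕ)))) ?_
  linear_combination h1

lemma oddTheta_two_S {τ : ℂ} (hτ : 0 < τ.im) (x : ℂ) :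
    oddTheta 2 1 τ x = Complex.I / (-(Complex.I * τ)) ^ (1 / 2 : ℂ) * ex (-(x ^ 2 / (2 * τ)))
      * oddTheta 2 1 (-1 / τ) (x / τ) := by
  have hτ0 : τ ≠ 0 := by rintro rfl; simp at hτ
  have hS : SHat 2 1 1 = 1 := by simp [SHat]
  rw [oddTheta_S two_pos 1 hτ, show Finset.Icc (1 : ℤ) ((2 : ℕ) - 1) = {1} by decide,
    Finset.sum_singleton, hS, one_mul]
  congr 3; push_cast; field_simp; ring

lemma sqrt_factor_ne_zero {τ : ℂ} (hτ : 0 < τ.im) : (-(Complex.I * τ)) ^ (1 / 2 : ℂ) ≠ 0 := by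
  have hτ0 : τ ≠ 0 := by rintro rfl; simp at hτ
  rw [Complex.cpow_def_of_ne_zero (by simp [hτ0])]
  exact Complex.exp_ne_zero _

lemma theta11_S {τ : ℂ} (hτ : 0 < τ.im) (x : ℂ) :
    theta11 τ x = Complex.I / (-(Complex.I * τ)) ^ (1 / 2 : ℂ) * ex (-(x ^ 2 / (2 * τ)))
      * theta11 (-1 / τ) (x / τ) := by
  rw [theta11_eq_oddTheta hτ, theta11_eq_oddTheta (im_neg_one_div_pos hτ), oddTheta_two_S hτ]
  ring

/-- The weight-1/2 factors of numerator and denominator cancel, and the indices K + 2 and 2 subtract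
to K. -/
lemma su2Char_S (K : ℕ) (j : ℤ) {τ : ℂ} (hτ : 0 < τ.im) (z : ℂ) :
    su2Char K (j - 1) τ z = ex (-(K * z ^ 2 / (4 * τ)))
      * ∑ p ∈ Finset.Icc (1 : ℤ) (((K + 2 : ℕ) : ℤ) - 1),
        SHat (K + 2) j p * su2Char K (p - 1) (-1 / τ) (z / τ) := by
  have hτ' := im_neg_one_div_pos hτ
  have hτ0 : τ ≠ 0 := by rintro rfl; simp at hτ
  have hc : Continuous fun z : ℂ => ex (-(K * z ^ 2 / (4 * τ))) := continuous_ex.comp (by fun_prop)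
  refine eq_of_mul_oddTheta_two hτ (f := su2Char K (j - 1) τ)
    (g := fun z => ex (-(K * z ^ 2 / (4 * τ)))
      * ∑ p ∈ Finset.Icc (1 : ℤ) (((K + 2 : ℕ) : ℤ) - 1),
        SHat (K + 2) j p * su2Char K (p - 1) (-1 / τ) (z / τ)) (continuous_su2Char K _ hτ)
    (hc.mul (continuous_finsetSum _ fun p _ => continuous_const.mul
      ((continuous_su2Char K _ hτ').comp (by fun_prop)))) (fun z => ?_) z
  rw [su2Char_mul K _ hτ, sub_add_cancel, oddTheta_S (by omega) j hτ, oddTheta_two_S hτ,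
    Finset.mul_sum, Finset.mul_sum, Finset.sum_mul]
  refine Finset.sum_congr rfl fun p _ => ?_
  have h1 := su2Char_mul K (p - 1) hτ' (z / τ)
  rw [sub_add_cancel] at h1
  rw [← h1]
  have h2 : ex (-((K + 2 : ℕ) * z ^ 2 / (4 * τ)))
      = ex (-(K * z ^ 2 / (4 * τ))) * ex (-(z ^ 2 / (2 * τ))) := by
    rw [← ex_add]; congr 1; push_cast; field_simp; ring
  rw [h2]; ring

/-! ### Fourier expansion of entire periodic functions -/

/-- Cauchy's theorem on a rectangle of width 1: the vertical sides cancel by periodicity, and the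
remaining real translation is harmless. -/
lemma integral_add_of_periodic {f : ℂ → ℂ} (hf : Differentiable ℂ f) (hp : ∀ z, f (z + 1) = f z)
    (z : ℂ) : ∫ t in (0 : ℝ)..1, f (t + z) = ∫ t in (0 : ℝ)..1, f t := by
  have h1 := Complex.integral_boundary_rect_eq_zero_of_differentiableOn (fun ζ => f (ζ + z.re))
    0 (1 + z.im * Complex.I) (hf.comp (by fun_prop)).differentiableOn
  have hre : (1 + z.im * Complex.I : ℂ).re = 1 := by simp
  have him : (1 + z.im * Complex.I : ℂ).im = z.im := by simp
  rw [hre, him] at h1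
  simp only [Complex.zero_re, Complex.zero_im, Complex.ofReal_zero, zero_mul, add_zero, zero_add,
    Complex.ofReal_one] at h1
  have h2 : ∀ y : ℝ, f (1 + y * Complex.I + z.re) = f (y * Complex.I + z.re) := fun y => by
    rw [← hp (y * Complex.I + z.re)]; congr 1; ring
  simp only [h2, add_sub_cancel_right] at h1
  have h3 : ∀ t : ℝ, f (t + z.im * Complex.I + z.re) = f (t + z) := fun t => by
    congr 1
    conv_rhs => rw [← Complex.re_add_im z]
    ring
  simp only [h3] at h1
  rw [← sub_eq_zero.mp h1]
  have h4 : Function.Periodic (fun t : ℝ => f t) 1 := fun t => by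
    simp only [Complex.ofReal_add, Complex.ofReal_one, hp]
  have h5 := h4.intervalIntegral_add_eq z.re 0
  have h6 := intervalIntegral.integral_comp_add_right (a := 0) (b := 1) (fun t : ℝ => f t) z.re
  rw [zero_add, add_comm 1] at h6
  rw [zero_add, ← h6] at h5
  simpa only [Complex.ofReal_add] using h5

/-- The Fourier coefficients of a 1-periodic function. -/
def fourierCoef (f : ℂ → ℂ) (r : ℤ) : ℂ := ∫ t in (0 : ℝ)..1, f t * ex (-(r * t))

lemma integral_fourierCoef {f : ℂ → ℂ} (hf : Differentiable ℂ f) (hp : ∀ z, f (z + 1) = f z)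
    (r : ℤ) (z : ℂ) : ∫ t in (0 : ℝ)..1, f (t + z) * ex (-(r * (t + z))) = fourierCoef f r := by
  refine integral_add_of_periodic (f := fun ζ => f ζ * ex (-(r * ζ))) ?_ ?_ z
  · exact hf.mul (differentiable_ex.comp (by fun_prop))
  · intro z
    simp only [hp]
    congr 1
    refine ex_eq_of_sub_int (-r) ?_
    push_cast; ring

/-- Moving the contour to height -A/2π or A/2π, according to the sign of r, gains the factor
e^{-A|r|}. As A is arbitrary, the Fourier series converges at every complex point. -/
lemma exists_bound_fourierCoef {f : ℂ → ℂ} (hf : Differentiable ℂ f)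
    (hp : ∀ z, f (z + 1) = f z) (A : ℝ) :
    ∃ C : ℝ, 0 ≤ C ∧ ∀ r : ℤ, ‖fourierCoef f r‖ ≤ C * Real.exp (-(A * |(r : ℝ)|)) := by
  have key : ∀ y : ℝ, ∃ C : ℝ, 0 ≤ C ∧ ∀ r : ℤ,
      ‖fourierCoef f r‖ ≤ C * Real.exp (2 * Real.pi * (r * y)) := by
    intro y
    have hc : Continuous fun t : ℝ => f (t + y * Complex.I) := hf.continuous.comp (by fun_prop)
    obtain ⟨C, hC⟩ := (isCompact_uIcc (a := (0 : ℝ)) (b := 1)).exists_bound_of_continuousOn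
      hc.continuousOn
    refine ⟨C, (norm_nonneg _).trans (hC 0 (by simp)), fun r => ?_⟩
    rw [← integral_fourierCoef hf hp r (y * Complex.I)]
    have := intervalIntegral.norm_integral_le_of_norm_le_const (a := (0 : ℝ)) (b := 1)
      (f := fun t : ℝ => f (t + y * Complex.I) * ex (-(r * (t + y * Complex.I))))
      (C := C * Real.exp (2 * Real.pi * (r * y))) (fun t ht => ?_)
    · simpa using this
    · rw [norm_mul, norm_ex]
      refine mul_le_mul (hC t (Set.uIoc_subset_uIcc ht)) (le_of_eq ?_) (Real.exp_pos _).le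
        ((norm_nonneg _).trans (hC 0 (by simp)))
      congr 1; simp
  obtain ⟨C₁, h₁, H₁⟩ := key (-(A / (2 * Real.pi)))
  obtain ⟨C₂, h₂, H₂⟩ := key (A / (2 * Real.pi))
  have hpi := Real.pi_ne_zero
  refine ⟨C₁ + C₂, add_nonneg h₁ h₂, fun r => ?_⟩
  rcases le_total 0 (r : ℝ) with h | h
  · refine (H₁ r).trans ?_
    rw [abs_of_nonneg h, show 2 * Real.pi * (r * -(A / (2 * Real.pi))) = -(A * r) by field_simp]
    exact mul_le_mul_of_nonneg_right (by linarith) (Real.exp_pos _).le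
  · refine (H₂ r).trans ?_
    rw [abs_of_nonpos h, show 2 * Real.pi * (r * (A / (2 * Real.pi))) = -(A * -r) by
      field_simp]
    exact mul_le_mul_of_nonneg_right (by linarith) (Real.exp_pos _).le

lemma norm_ex_int_mul_le (r : ℤ) (z : ℂ) :
    ‖ex (r * z)‖ ≤ Real.exp (2 * Real.pi * |z.im| * |(r : ℝ)|) := by
  rw [norm_ex_mul, Real.exp_le_exp]
  have h := neg_abs_le ((r : ℝ) * z.im)
  rw [abs_mul] at h
  have := Real.pi_pos
  nlinarith

lemma summable_fourierCoef {f : ℂ → ℂ} (hf : Differentiable ℂ f)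
    (hp : ∀ z, f (z + 1) = f z) (z : ℂ) : Summable fun r : ℤ => fourierCoef f r * ex (r * z) := by
  obtain ⟨C, hC0, hC⟩ := exists_bound_fourierCoef hf hp (2 * Real.pi * |z.im| + 1)
  refine ((summable_exp_neg_abs one_pos).mul_left C).of_norm_bounded fun r => ?_
  rw [norm_mul]
  refine (mul_le_mul (hC r) (norm_ex_int_mul_le r z) (norm_nonneg _) (by positivity)).trans
    (le_of_eq ?_)
  rw [mul_assoc, ← Real.exp_add]; congr 2; ring

/-- For complex z the real Fourier theorem is applied to t ↦ f(t + z), whose coefficients are those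
of f times y_z^r by contour shift. -/
lemma hasSum_fourierCoef {f : ℂ → ℂ} (hf : Differentiable ℂ f)
    (hp : ∀ z, f (z + 1) = f z) (z : ℂ) :
    HasSum (fun r : ℤ => fourierCoef f r * ex (r * z)) (f z) := by
  have : Fact (0 < (1 : ℝ)) := ⟨one_pos⟩
  have hper : Function.Periodic (fun t : ℝ => f (t + z)) 1 := fun t => by
    simp only [Complex.ofReal_add, Complex.ofReal_one]
    rw [← hp (t + z)]; congr 1; ring
  have hcont : Continuous fun t : ℝ => f (t + z) := hf.continuous.comp (by fun_prop)
  let g : C(AddCircle (1 : ℝ), ℂ) := ⟨hper.lift, continuous_coinduced_dom.mpr hcont⟩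
  have hcoef : ∀ r : ℤ, fourierCoeff g r = fourierCoef f r * ex (r * z) := by
    intro r
    rw [fourierCoeff_eq_intervalIntegral g r 0, ← integral_fourierCoef hf hp r z, zero_add,
      div_one, one_smul, ← intervalIntegral.integral_mul_const]
    refine intervalIntegral.integral_congr fun t _ => ?_
    change fourier (-r) (t : AddCircle (1 : ℝ)) • f (t + z) = _
    have e1 : ex (-(r * (t + z))) * ex (r * z) = ex (-(r * t)) := by
      rw [← ex_add]; congr 1; ring
    rw [mul_assoc, e1, fourier_coe_apply, smul_eq_mul, mul_comm, ex]
    congr 2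
    push_cast; ring
  have hs : Summable (fourierCoeff g) := by
    rw [funext hcoef]; exact summable_fourierCoef hf hp z
  have h := has_pointwise_sum_fourier_series_of_summable hs ((0 : ℝ) : AddCircle (1 : ℝ))
  have h0 : g ((0 : ℝ) : AddCircle (1 : ℝ)) = f z := by
    change f ((0 : ℝ) + z) = f z
    simp
  rw [h0] at h
  refine hasSum_of_eq (fun r => ?_) h
  rw [hcoef, fourier_coe_apply]; simp

/-! ### Fourier expansions of the `SU(2)` characters and the minimal model characters -/

/-- The Fourier coefficients of the affine characters. -/
def su2Coef (K : ℕ) (l : ℤ) (τ : ℂ) (r : ℤ) : ℂ := fourierCoef (fun t => su2Char K l τ (2 * t)) r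

lemma su2Char_two_mul_add_one (K : ℕ) (l : ℤ) {τ : ℂ} (hτ : 0 < τ.im) (t : ℂ) :
    su2Char K l τ (2 * (t + 1)) = su2Char K l τ (2 * t) := by
  rw [show 2 * (t + 1) = 2 * t + 1 + 1 by ring, su2Char_add_one K l hτ, su2Char_add_one K l hτ,
    ← mul_assoc, ← ex_add, add_halves, ex_int, one_mul]

lemma differentiable_su2Char_two_mul (K : ℕ) (l : ℤ) {τ : ℂ} (hτ : 0 < τ.im) :
    Differentiable ℂ fun t => su2Char K l τ (2 * t) :=
  (differentiable_su2Char K l hτ).comp (by fun_prop)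

lemma stringFunction_eq (K : ℕ) (l r : ℤ) (τ : ℂ) :
    stringFunction K l r τ = ex (-(τ * (r ^ 2 / (4 * K)))) * su2Coef K l τ r := by
  rw [stringFunction, su2Coef, fourierCoef]
  congr 1
  · rw [ex]; congr 1; ring
  · refine intervalIntegral.integral_congr fun t _ => ?_
    simp only [ex]
    congr 2; ring

/-- Translation of the contour by τ translates the argument of the character by 2τ, and two τ-steps
return l to l. This is what makes the string functions periodic mod 2K. -/
lemma su2Coef_add_two_mul (K : ℕ) (l : ℤ) {τ : ℂ} (hτ : 0 < τ.im) (r : ℤ) :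
    su2Coef K l τ (r + 2 * K) = ex ((K + r) * τ) * su2Coef K l τ r := by
  have h1 := integral_fourierCoef (differentiable_su2Char_two_mul K l hτ)
    (su2Char_two_mul_add_one K l hτ) r τ
  have h2 : ∀ t : ℝ, su2Char K l τ (2 * (t + τ)) * ex (-(r * (t + τ)))
      = ex (-((K + r) * τ)) * (su2Char K l τ (2 * t) * ex (-((r + 2 * K : ℤ) * t))) := by
    intro t
    rw [show 2 * ((t : ℂ) + τ) = 2 * t + τ + τ by ring, su2Char_add_tau K l hτ,
      su2Char_add_tau K _ hτ, sub_sub_cancel]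
    have : ex (-(K * τ / 4) - K * (2 * t + τ) / 2) * ex (-(K * τ / 4) - K * (2 * t) / 2)
        * ex (-(r * (t + τ))) = ex (-((K + r) * τ)) * ex (-((r + 2 * K : ℤ) * t)) := by
      rw [← ex_add, ← ex_add, ← ex_add]; congr 1; push_cast; ring
    linear_combination su2Char K l τ (2 * t) * this
  simp only [h2] at h1
  rw [intervalIntegral.integral_const_mul] at h1
  rw [su2Coef, su2Coef, ← h1, fourierCoef, ← mul_assoc, ← ex_add, add_neg_cancel, ex_zero, one_mul]

lemma stringFunction_add_two_mul {K : ℕ} (hK : 0 < K) (l : ℤ) {τ : ℂ} (hτ : 0 < τ.im) (r : ℤ) :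
    stringFunction K l (r + 2 * K) τ = stringFunction K l r τ := by
  have : (K : ℂ) ≠ 0 := by exact_mod_cast hK.ne'
  rw [stringFunction_eq, stringFunction_eq, su2Coef_add_two_mul K l hτ, ← mul_assoc, ← ex_add]
  congr 2; push_cast; field_simp; ring

lemma stringFunction_add_two_mul_mul {K : ℕ} (hK : 0 < K) (l : ℤ) {τ : ℂ} (hτ : 0 < τ.im)
    (r m : ℤ) : stringFunction K l (r + 2 * K * m) τ = stringFunction K l r τ := by
  have h : Function.Periodic (fun r => stringFunction K l r τ) (2 * K) :=
    fun r => stringFunction_add_two_mul hK l hτ r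
  have := h.int_mul m r
  rw [mul_comm] at this
  exact this

/-- The terms of the theta series of the coset characters. -/
def cosetTerm (K : ℕ) (l r : ℤ) (τ z : ℂ) (a : ℤ) : ℂ :=
  su2Coef K l τ (r + a)
    * ex (τ * (a ^ 2 / 8) - τ * (r ^ 2 / (4 * (K + 2))) + z * (a / 2 + r / (K + 2)))

lemma su2Coef_zero {τ : ℂ} (hτ : 0 < τ.im) (r : ℤ) : su2Coef 0 0 τ r = if r = 0 then 1 else 0 := by
  simp only [su2Coef, fourierCoef, su2Char_zero hτ, one_mul]
  have := integral_ex_int (-r)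
  push_cast at this
  simp only [neg_mul, neg_eq_zero] at this
  exact this

lemma summable_cosetTerm (K : ℕ) (l r : ℤ) {τ : ℂ} (hτ : 0 < τ.im) (z : ℂ) :
    Summable (cosetTerm K l r τ z) := by
  obtain ⟨C, hC0, hC⟩ := exists_bound_fourierCoef (differentiable_su2Char_two_mul K l hτ)
    (su2Char_two_mul_add_one K l hτ) 0
  have h1 := ((summable_jacobiTheta₂_term_iff (z / 2) (τ / 4)).mpr (by simpa using hτ)).norm
  have h2 := (h1.mul_left ‖ex (-(τ * (r ^ 2 / (4 * (K + 2)))) + z * (r / (K + 2)))‖).mul_left C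
  refine h2.of_norm_bounded fun a => ?_
  rw [cosetTerm, norm_mul]
  refine mul_le_mul ((hC _).trans (by simp)) (le_of_eq ?_) (norm_nonneg _) hC0
  rw [← norm_mul, jacobiTheta₂_term, ex, ex, ← Complex.exp_add]
  congr 2; ring

/-- The periodicity of the string functions lets the finite sum over n mod K and the theta sum
combine into one sum over N = Kp + n. For K = 0 the coefficients of the trivial character are a
Kronecker delta, so the same formula covers the case k = 2. -/
lemma cosetChar_eq (K : ℕ) (l s r : ℤ) (hl : K = 0 → l = 0) {τ : ℂ} (hτ : 0 < τ.im) (z : ℂ) :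
    cosetChar (K + 2) l s r τ z = ∑' N : ℤ, cosetTerm K l r τ z (4 * N - s) := by
  rcases Nat.eq_zero_or_pos K with rfl | hK
  · have hl := hl rfl
    subst hl
    simp only [cosetChar, zero_add, if_true]
    split_ifs with h
    · obtain ⟨N, hN⟩ := h.dvd
      rw [tsum_eq_single N]
      · rw [cosetTerm, su2Coef_zero hτ, if_pos (by omega), one_mul, ← ex_zero]
        have : s = r + 4 * N := by omega
        rw [this]
        congr 1; push_cast; ring
      · intro M hM
        rw [cosetTerm, su2Coef_zero hτ, if_neg (by omega), zero_mul]
    · rw [tsum_congr (fun N => ?_), tsum_zero]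
      rw [cosetTerm, su2Coef_zero hτ, if_neg, zero_mul]
      intro h0
      exact h ((Int.modEq_iff_dvd).mpr ⟨N, by omega⟩)
  · have hK0 : (K : ℂ) ≠ 0 := by exact_mod_cast hK.ne'
    have hK2 : (K : ℂ) + 2 ≠ 0 := by exact_mod_cast (by omega : K + 2 ≠ 0)
    have hinj : Function.Injective fun N : ℤ => 4 * N - s := fun a b h => by
      simp only at h; omega
    rw [tsum_int_eq_sum_range (f := fun N : ℤ => cosetTerm K l r τ z (4 * N - s))
      ((summable_cosetTerm K l r hτ z).comp_injective hinj) hK, cosetChar,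
      if_neg (by omega), Nat.add_sub_cancel]
    refine Finset.sum_congr rfl fun n _ => ?_
    rw [theta_def, ← tsum_mul_left]
    refine tsum_congr fun p => ?_
    have e1 := stringFunction_add_two_mul_mul hK l hτ (r - s + 4 * n) (2 * p)
    rw [← e1, stringFunction_eq, cosetTerm,
      show r - s + 4 * (n : ℤ) + 2 * K * (2 * p) = r + (4 * (K * p + n) - s) by ring,
      mul_comm (ex _) (su2Coef _ _ _ _), mul_assoc, ← ex_add]
    congr 2
    push_cast
    field_simp
    ring

/-- The product `χ_{j-1}^{(K)}(τ;x) θ₁₁(τ;z-x)`. -/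
def charTheta (K : ℕ) (j : ℤ) (τ z x : ℂ) : ℂ := su2Char K (j - 1) τ x * theta11 τ (z - x)

/-- The Fourier coefficients of `t ↦ χ_{j-1}^{(K)}(τ;2t) θ₁₁(τ;z-2t)`. -/
def charThetaCoef (K : ℕ) (j : ℤ) (τ z : ℂ) (r : ℤ) : ℂ :=
  fourierCoef (fun t => charTheta K j τ z (2 * t)) r

/-- Expanding θ₁₁(z - 2t) under the Fourier integral gives a sum over all odd integers 2m + 1 with
phase e^{πi(2m+1)/2}. The classes mod 4 have phases i and -i, which is the combination of χ^{l,1}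
and χ^{l,3} in C[1 1]. -/
lemma minimalChar_eq (K : ℕ) (j r : ℤ) (hj : K = 0 → j = 1) {τ : ℂ} (hτ : 0 < τ.im) (z : ℂ) :
    minimalChar (K + 2) (j - 1) r 1 1 τ z
      = -(ex (-(τ * (r ^ 2 / (4 * (K + 2)))) + z * (r / (K + 2))) * charThetaCoef K j τ z r) := by
  have hf : Continuous fun t : ℝ => su2Char K (j - 1) τ (2 * t) * ex (-(r * t)) :=
    ((continuous_su2Char K _ hτ).comp (by fun_prop)).mul (continuous_ex.comp (by fun_prop))
  have h1 := integral_mul_tsum hf (c := fun m => theta11Coeff τ m * ex ((m + 1 / 2) * z))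
    (summable_theta11 hτ z) (fun m => -(2 * m + 1))
  have e1 : charThetaCoef K j τ z r = ∫ t in (0 : ℝ)..1, su2Char K (j - 1) τ (2 * t) * ex (-(r * t))
      * ∑' m : ℤ, theta11Coeff τ m * ex ((m + 1 / 2) * z) * ex ((-(2 * m + 1) : ℤ) * t) := by
    refine intervalIntegral.integral_congr fun t _ => ?_
    simp only [charTheta]
    rw [← (hasSum_theta11 hτ (z - 2 * t)).tsum_eq, mul_right_comm]
    congr 1
    refine tsum_congr fun m => ?_
    rw [mul_assoc, ← ex_add]
    congr 2; push_cast; ring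
  have e2 : ∀ m : ℤ, ∫ t in (0 : ℝ)..1, su2Char K (j - 1) τ (2 * t) * ex (-(r * t))
      * ex ((-(2 * m + 1) : ℤ) * t) = su2Coef K (j - 1) τ (r + (2 * m + 1)) := by
    intro m
    rw [su2Coef, fourierCoef]
    refine intervalIntegral.integral_congr fun t _ => ?_
    rw [mul_assoc, ← ex_add]
    congr 2; push_cast; ring
  simp only [e2] at h1
  rw [← e1] at h1
  set P := ex (-(τ * (r ^ 2 / (4 * (K + 2)))) + z * (r / (K + 2))) with hP
  have h2 := h1.mul_left P
  have h3 : ∀ m : ℤ, P * (theta11Coeff τ m * ex ((m + 1 / 2) * z)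
      * su2Coef K (j - 1) τ (r + (2 * m + 1)))
      = ex ((2 * m + 1) / 4) * cosetTerm K (j - 1) r τ z (2 * m + 1) := by
    intro m
    have e : P * theta11Coeff τ m * ex ((m + 1 / 2) * z) = ex ((2 * m + 1) / 4)
        * ex (τ * ((2 * m + 1 : ℤ) ^ 2 / 8) - τ * (r ^ 2 / (4 * (K + 2)))
          + z * ((2 * m + 1 : ℤ) / 2 + r / (K + 2))) := by
      rw [hP, theta11Coeff, ← ex_add, ← ex_add, ← ex_add]
      congr 1; push_cast; ring
    rw [cosetTerm]
    linear_combination su2Coef K (j - 1) τ (r + (2 * m + 1)) * e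
  rw [← h2.tsum_eq, tsum_congr h3, tsum_int_eq_sum_range (n := 2) (by
    rw [← funext h3]; exact h2.summable) (by norm_num)]
  simp only [Finset.sum_range_succ, Finset.sum_range_zero, zero_add]
  rw [minimalChar, cosetChar_eq K _ _ r (fun h => by rw [hj h]; rfl) hτ,
    cosetChar_eq K _ _ r (fun h => by rw [hj h]; rfl) hτ]
  -- For even index the odd number is 4m + 1 = 4(m + 1) - 3, so this is the class s = 3, with phase
  -- i; odd indices give 4m + 3 = 4(m + 1) - 1, the class s = 1, with phase -i.
  have e3 : ∑' m : ℤ, ex ((2 * ((((2 : ℕ) : ℤ) * m + ((0 : ℕ) : ℤ) : ℤ) : ℂ) + 1) / 4)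
      * cosetTerm K (j - 1) r τ z (2 * (((2 : ℕ) : ℤ) * m + ((0 : ℕ) : ℤ)) + 1)
      = Complex.I * ∑' N : ℤ, cosetTerm K (j - 1) r τ z (4 * N - (((1 : ℕ) : ℤ) + 2)) := by
    rw [← tsum_mul_left, ← (Equiv.addRight (1 : ℤ)).tsum_eq (fun N : ℤ =>
      Complex.I * cosetTerm K (j - 1) r τ z (4 * N - (((1 : ℕ) : ℤ) + 2)))]
    refine tsum_congr fun m => ?_
    simp only [Equiv.coe_addRight]
    congr 1
    · rw [← ex_quarter]
      refine ex_eq_of_sub_int m ?_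
      push_cast; ring
    · congr 1; push_cast; ring
  have e4 : ∑' m : ℤ, ex ((2 * ((((2 : ℕ) : ℤ) * m + ((1 : ℕ) : ℤ) : ℤ) : ℂ) + 1) / 4)
      * cosetTerm K (j - 1) r τ z (2 * (((2 : ℕ) : ℤ) * m + ((1 : ℕ) : ℤ)) + 1)
      = -Complex.I * ∑' N : ℤ, cosetTerm K (j - 1) r τ z (4 * N - ((1 : ℕ) : ℤ)) := by
    rw [← tsum_mul_left, ← (Equiv.addRight (1 : ℤ)).tsum_eq (fun N : ℤ =>
      -Complex.I * cosetTerm K (j - 1) r τ z (4 * N - ((1 : ℕ) : ℤ)))]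
    refine tsum_congr fun m => ?_
    simp only [Equiv.coe_addRight]
    congr 1
    · rw [← ex_quarter, ← neg_one_mul, ← ex_half, ← ex_add]
      refine ex_eq_of_sub_int m ?_
      push_cast; ring
    · congr 1; push_cast; ring
  rw [e3, e4]
  have e5 : Complex.exp (Real.pi * Complex.I * ((1 : ℕ) : ℂ) * ((1 : ℕ) : ℂ) / 2) = Complex.I := by
    refine Eq.trans ?_ ex_quarter
    rw [ex]; congr 1; push_cast; ring
  rw [e5]; ring

/-! ### Coefficients of `χ θ₁₁` -/

lemma differentiable_charTheta (K : ℕ) (j : ℤ) {τ : ℂ} (hτ : 0 < τ.im) (z : ℂ) :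
    Differentiable ℂ (charTheta K j τ z) :=
  (differentiable_su2Char K _ hτ).mul ((differentiable_theta11 hτ).comp (by fun_prop))

lemma differentiable_charTheta_two_mul (K : ℕ) (j : ℤ) {τ : ℂ} (hτ : 0 < τ.im) (z : ℂ) :
    Differentiable ℂ fun t => charTheta K j τ z (2 * t) :=
  (differentiable_charTheta K j hτ z).comp (by fun_prop)

lemma charTheta_add_one (K : ℕ) (j : ℤ) {τ : ℂ} (hτ : 0 < τ.im) (z x : ℂ) :
    charTheta K j τ z (x + 1) = ex (j / 2) * charTheta K j τ z x := by
  have h1 : theta11 τ (z - (x + 1)) = -theta11 τ (z - x) := by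
    have := theta11_add_one hτ (z - (x + 1))
    rw [show z - (x + 1) + 1 = z - x by ring] at this
    rw [this, neg_neg]
  have h2 : ex (((j - 1 : ℤ) : ℂ) / 2) = -ex (j / 2) := by
    rw [← neg_one_mul, ← ex_half, ← ex_add]
    refine ex_eq_of_sub_int (-1) ?_
    push_cast; ring
  rw [charTheta, charTheta, su2Char_add_one K _ hτ, h1, h2]; ring

lemma charTheta_two_mul_add_one (K : ℕ) (j : ℤ) {τ : ℂ} (hτ : 0 < τ.im) (z t : ℂ) :
    charTheta K j τ z (2 * (t + 1)) = charTheta K j τ z (2 * t) := by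
  rw [show 2 * (t + 1) = 2 * t + 1 + 1 by ring, charTheta_add_one K j hτ, charTheta_add_one K j hτ,
    ← mul_assoc, ← ex_add, add_halves, ex_int, one_mul]

lemma charTheta_add_tau (K : ℕ) (j : ℤ) {τ : ℂ} (hτ : 0 < τ.im) (z x : ℂ) :
    charTheta K j τ z (x + τ)
      = -ex (-((K + 2) * τ / 4) - (K + 2) * x / 2 + z) * charTheta K (K + 2 - j) τ z x := by
  have h1 := theta11_add_tau hτ (z - (x + τ))
  rw [show z - (x + τ) + τ = z - x by ring] at h1
  rw [charTheta, charTheta, su2Char_add_tau K _ hτ, h1,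
    show (K : ℤ) - (j - 1) = K + 2 - j - 1 by ring]
  have h2 : ex (-((K + 2) * τ / 4) - (K + 2) * x / 2 + z) * ex (-(τ / 2) - (z - (x + τ)))
      = ex (-(K * τ / 4) - K * x / 2) := by
    rw [← ex_add]; congr 1; ring
  rw [← h2]; ring

lemma charThetaCoef_eq_zero (K : ℕ) (j : ℤ) {τ : ℂ} (hτ : 0 < τ.im) (z : ℂ) {r : ℤ}
    (hr : ¬ r ≡ j [ZMOD 2]) : charThetaCoef K j τ z r = 0 := by
  have h1 := integral_fourierCoef (differentiable_charTheta_two_mul K j hτ z)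
    (charTheta_two_mul_add_one K j hτ z) r (1 / 2)
  have h2 : ∀ t : ℝ, charTheta K j τ z (2 * (t + 1 / 2)) * ex (-(r * (t + 1 / 2)))
      = ex (j / 2 - r / 2) * (charTheta K j τ z (2 * t) * ex (-(r * t))) := by
    intro t
    rw [show 2 * ((t : ℂ) + 1 / 2) = 2 * t + 1 by ring, charTheta_add_one K j hτ,
      show -((r : ℂ) * (t + 1 / 2)) = -(r * t) + -(r / 2) by ring, ex_add, sub_eq_add_neg, ex_add]
    ring
  simp only [h2] at h1
  rw [intervalIntegral.integral_const_mul] at h1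
  change ex (j / 2 - r / 2) * charThetaCoef K j τ z r = charThetaCoef K j τ z r at h1
  by_contra h0
  have h3 : ex (j / 2 - r / 2) = 1 := mul_right_cancel₀ h0 (by rw [h1, one_mul])
  obtain ⟨n, hn⟩ := (ex_eq_one_iff _).mp h3
  apply hr
  refine (Int.modEq_iff_dvd).mpr ⟨n, ?_⟩
  have : ((j - r : ℤ) : ℂ) = ((2 * n : ℤ) : ℂ) := by
    push_cast; linear_combination 2 * hn
  exact_mod_cast this

/-- Moving the contour by τ/2 translates 2t by τ, which exchanges j with k - j and raises the
frequency by k = K + 2. -/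
lemma charThetaCoef_shift (K : ℕ) (j : ℤ) {τ : ℂ} (hτ : 0 < τ.im) (z : ℂ) (r : ℤ) :
    charThetaCoef K j τ z r = -(ex (-((K + 2) * τ / 4) + z - r * τ / 2)
      * charThetaCoef K (K + 2 - j) τ z (r + (K + 2))) := by
  have h1 := integral_fourierCoef (differentiable_charTheta_two_mul K j hτ z)
    (charTheta_two_mul_add_one K j hτ z) r (τ / 2)
  have h2 : ∀ t : ℝ, charTheta K j τ z (2 * (t + τ / 2)) * ex (-(r * (t + τ / 2)))
      = -ex (-((K + 2) * τ / 4) + z - r * τ / 2)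
        * (charTheta K (K + 2 - j) τ z (2 * t) * ex (-((r + (K + 2) : ℤ) * t))) := by
    intro t
    rw [show 2 * ((t : ℂ) + τ / 2) = 2 * t + τ by ring, charTheta_add_tau K j hτ]
    have : ex (-((K + 2) * τ / 4) - (K + 2) * (2 * t) / 2 + z) * ex (-(r * (t + τ / 2)))
        = ex (-((K + 2) * τ / 4) + z - r * τ / 2) * ex (-((r + (K + 2) : ℤ) * t)) := by
      rw [← ex_add, ← ex_add]; congr 1; push_cast; ring
    linear_combination -charTheta K (K + 2 - j) τ z (2 * t) * this
  simp only [h2] at h1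
  rw [intervalIntegral.integral_const_mul] at h1
  rw [charThetaCoef, charThetaCoef, ← h1, fourierCoef]; ring

lemma charThetaCoef_tau_add_one (K : ℕ) (j : ℤ) {τ : ℂ} (hτ : 0 < τ.im) (z : ℂ) (r : ℤ) :
    charThetaCoef K j (τ + 1) z r
      = ex (j ^ 2 / (4 * (K + 2))) * charThetaCoef K j τ z r := by
  rw [charThetaCoef, charThetaCoef, fourierCoef, fourierCoef,
    ← intervalIntegral.integral_const_mul]
  refine intervalIntegral.integral_congr fun t _ => ?_
  simp only [charTheta]
  rw [su2Char_tau_add_one K _ hτ, theta11_tau_add_one hτ]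
  have : ex ((((j - 1 : ℤ) : ℂ) + 1) ^ 2 / (4 * (K + 2)) - 1 / 8) * ex (1 / 8)
      = ex (j ^ 2 / (4 * (K + 2))) := by
    rw [← ex_add]; congr 1; push_cast; ring
  rw [← this]; ring

lemma hasSum_charTheta (K : ℕ) (j : ℤ) {τ : ℂ} (hτ : 0 < τ.im) (z t : ℂ) :
    HasSum (fun r : ℤ => charThetaCoef K j τ z r * ex (r * t)) (charTheta K j τ z (2 * t)) :=
  hasSum_fourierCoef (differentiable_charTheta_two_mul K j hτ z)
    (charTheta_two_mul_add_one K j hτ z) t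

lemma summable_ex_mul_charThetaCoef (K : ℕ) (j : ℤ) {τ : ℂ} (hτ : 0 < τ.im) (z x : ℂ) (r : ℤ)
    {b : ℤ → ℂ} {M : ℝ} (hb : ∀ n, ‖b n‖ ≤ M) :
    Summable fun n : ℤ => ex (n * x) * b n * charThetaCoef K j τ z (r + 2 * n) := by
  have hM : 0 ≤ M := (norm_nonneg _).trans (hb 0)
  have h1 := summable_fourierCoef (differentiable_charTheta_two_mul K j hτ z)
    (charTheta_two_mul_add_one K j hτ z) (x / 2)
  have hinj : Function.Injective fun n : ℤ => r + 2 * n := fun a b h => by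
    simp only at h; omega
  have h2 := ((h1.comp_injective hinj).norm.mul_left ‖ex (-(r * x / 2))‖).mul_left M
  refine h2.of_norm_bounded fun n => ?_
  simp only [Function.comp_apply]
  rw [← norm_mul, norm_mul, norm_mul]
  have : ex (-(r * x / 2)) * (fourierCoef (fun t => charTheta K j τ z (2 * t)) (r + 2 * n)
      * ex ((r + 2 * n : ℤ) * (x / 2))) = charThetaCoef K j τ z (r + 2 * n) * ex (n * x) := by
    rw [mul_left_comm, ← ex_add, charThetaCoef]; congr 2; push_cast; ring
  rw [this, norm_mul]
  nlinarith [mul_le_mul_of_nonneg_right (hb n) (mul_nonneg (norm_nonneg (ex (n * x)))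
    (norm_nonneg (charThetaCoef K j τ z (r + 2 * n))))]

/-! ### Theta coefficients of the meromorphic Jacobi form, on each horizontal strip -/

/-- The terms of `lerchCoef`. -/
def lerchTerm (K : ℕ) (j : ℤ) (τ v u w : ℂ) (N r n : ℤ) : ℂ :=
  ex (n * (u - v + w)) * (ex (-(N * (v + n * τ))) / (1 - ex (v + n * τ)))
    * charThetaCoef K j τ (w - v) (r + 2 * n)

/-- The normalizing factor `q^{-r²/4k} y_w^{r/k}`. -/
def lerchFactor (K : ℕ) (τ w : ℂ) (r : ℤ) : ℂ :=
  ex (-(τ * (r ^ 2 / (4 * (K + 2)))) + w * (r / (K + 2)))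

/-- The theta coefficients in the strip number `N`. -/
def lerchCoef (K : ℕ) (j : ℤ) (τ v u w : ℂ) (N r : ℤ) : ℂ :=
  lerchFactor K τ w r * ∑' n : ℤ, lerchTerm K j τ v u w N r n

lemma summable_lerchTerm (K : ℕ) (j : ℤ) {τ v : ℂ} (hτ : 0 < τ.im) (hv : OffLattice τ v)
    (u w : ℂ) (N r : ℤ) : Summable (lerchTerm K j τ v u w N r) := by
  obtain ⟨M, hM0, hM⟩ := exists_bound_inv_one_sub_ex hτ hv
  have := (summable_ex_mul_charThetaCoef K j hτ (w - v) (u - v + w - N * τ) r hM).mul_left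
    (ex (-(N * v)))
  refine this.congr fun n => ?_
  rw [lerchTerm, ← mul_assoc, ← mul_assoc, mul_div_assoc', ← ex_add, mul_one, mul_div_assoc',
    ← ex_add]
  congr 3; ring

/-- This is the translation x ↦ x + τ of `charTheta` read on coefficients: it trades one strip for
the next, r for r + k and j for k - j. Hence all strips and all r reduce to finitely many data. -/
lemma lerchCoef_shift (K : ℕ) (j : ℤ) {τ : ℂ} (hτ : 0 < τ.im) (v u w : ℂ) (N r : ℤ) :
    lerchCoef K j τ v u w N r = -lerchCoef K (K + 2 - j) τ v u w (N + 1) (r + (K + 2)) := by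
  have hK : (K : ℂ) + 2 ≠ 0 := by exact_mod_cast (by omega : K + 2 ≠ 0)
  rw [lerchCoef, lerchCoef, ← tsum_mul_left, ← tsum_mul_left, ← tsum_neg]
  refine tsum_congr fun n => ?_
  rw [lerchTerm, lerchTerm, charThetaCoef_shift K j hτ,
    show r + 2 * n + ((K : ℤ) + 2) = r + (K + 2) + 2 * n by ring]
  have : lerchFactor K τ w r * ex (-(N * (v + n * τ)))
      * ex (-((K + 2) * τ / 4) + (w - v) - (r + 2 * n : ℤ) * τ / 2)
      = lerchFactor K τ w (r + (K + 2)) * ex (-((N + 1 : ℤ) * (v + n * τ))) := by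
    rw [lerchFactor, lerchFactor, ← ex_add, ← ex_add, ← ex_add]
    congr 1; push_cast; field_simp; ring
  linear_combination -(ex (n * (u - v + w)) / (1 - ex (v + n * τ))
    * charThetaCoef K (K + 2 - j) τ (w - v) (r + (K + 2) + 2 * n)) * this

lemma lerchCoef_shift_two (K : ℕ) (j : ℤ) {τ : ℂ} (hτ : 0 < τ.im) (v u w : ℂ) (N r : ℤ) :
    lerchCoef K j τ v u w (N + 2) (r + 2 * (K + 2)) = lerchCoef K j τ v u w N r := by
  rw [lerchCoef_shift K j hτ v u w N, lerchCoef_shift K (K + 2 - j) hτ v u w (N + 1), neg_neg]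
  congr 1 <;> ring

lemma lerchCoef_shift_mul (K : ℕ) (j : ℤ) {τ : ℂ} (hτ : 0 < τ.im) (v u w : ℂ) (N r l : ℤ) :
    lerchCoef K j τ v u w N (2 * (K + 2) * l + r) = lerchCoef K j τ v u w (N - 2 * l) r := by
  induction l using Int.induction_on generalizing N with
  | zero => simp
  | succ i ih =>
    rw [show 2 * ((K : ℤ) + 2) * (i + 1) + r = (2 * (K + 2) * i + r) + 2 * (K + 2) by ring,
      show N = (N - 2) + 2 by ring, lerchCoef_shift_two K j hτ, ih]
    congr 1; ring
  | pred i ih =>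
    rw [← lerchCoef_shift_two K j hτ,
      show 2 * ((K : ℤ) + 2) * (-i - 1) + r + 2 * (K + 2) = 2 * (K + 2) * -i + r by ring, ih]
    congr 1; ring

/-- The jump of the theta coefficients between consecutive strips. -/
def lerchStep (K : ℕ) (j : ℤ) (τ v u w : ℂ) (M r : ℤ) : ℂ :=
  lerchCoef K j τ v u w M r - lerchCoef K j τ v u w (M - 1) r

lemma lerchStep_shift (K : ℕ) (j : ℤ) {τ : ℂ} (hτ : 0 < τ.im) (v u w : ℂ) (M r : ℤ) :
    lerchStep K j τ v u w M r = -lerchStep K (K + 2 - j) τ v u w (M + 1) (r + (K + 2)) := by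
  rw [lerchStep, lerchStep, lerchCoef_shift K j hτ, lerchCoef_shift K j hτ v u w (M - 1),
    sub_add_cancel, add_sub_cancel_right]; ring

/-- The expansions in strips 0 and -1 differ by the factor y_v qⁿ, so their difference cancels the
denominator 1 - y_v qⁿ. The remaining sum is the full Fourier series of `charTheta` at u - v + w,
because coefficients of the wrong parity vanish; there the θ₁₁ factor is θ₁₁(-u). Analytically this
is the residue at the pole between the strips. -/
lemma lerchStep_zero (K : ℕ) (j : ℤ) {τ v : ℂ} (hτ : 0 < τ.im) (hv : OffLattice τ v) (u w : ℂ)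
    (r : ℤ) : lerchStep K j τ v u w 0 r = if r ≡ j [ZMOD 2] then
      -theta11 τ u * su2Char K (j - 1) τ (u - v + w)
        * ex (-(τ * (r ^ 2 / (4 * (K + 2)))) - r * ((u - v + w * (1 - 2 / (K + 2))) / 2)) else 0 := by
  have hK : (K : ℂ) + 2 ≠ 0 := by exact_mod_cast (by omega : K + 2 ≠ 0)
  have h1 : lerchStep K j τ v u w 0 r = lerchFactor K τ w r
      * ∑' n : ℤ, ex (n * (u - v + w)) * charThetaCoef K j τ (w - v) (r + 2 * n) := by
    rw [lerchStep, lerchCoef, lerchCoef, ← mul_sub,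
      ← (summable_lerchTerm K j hτ hv u w 0 r).tsum_sub (summable_lerchTerm K j hτ hv u w _ r)]
    congr 1
    refine tsum_congr fun n => ?_
    have := hv.one_sub_ne_zero n
    rw [lerchTerm, lerchTerm]
    simp only [zero_sub, Int.cast_zero, zero_mul, neg_zero, ex_zero, Int.cast_neg, Int.cast_one,
      neg_mul, one_mul, neg_neg]
    field_simp
  rw [h1]
  split_ifs with h
  · have h2 := hasSum_charTheta K j hτ (w - v) ((u - v + w) / 2)
    have hinj : Function.Injective fun n : ℤ => r + 2 * n := fun a b h => by
      simp only at h; omega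
    rw [← hinj.hasSum_iff] at h2
    · have h3 : ∀ n : ℤ, ex (n * (u - v + w)) * charThetaCoef K j τ (w - v) (r + 2 * n)
          = ex (-(r * ((u - v + w) / 2))) * (charThetaCoef K j τ (w - v) (r + 2 * n)
            * ex ((r + 2 * n : ℤ) * ((u - v + w) / 2))) := by
        intro n
        rw [mul_left_comm, ← ex_add, mul_comm]; congr 2; push_cast; ring
      have h4 := h2.tsum_eq
      simp only [Function.comp_apply] at h4
      rw [tsum_congr h3, tsum_mul_left, h4, charTheta, mul_div_cancel₀ _ two_ne_zero,
        show w - v - (u - v + w) = -u by ring, theta11_neg hτ, lerchFactor]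
      have h5 : ex (-(τ * (r ^ 2 / (4 * (K + 2)))) + w * (r / (K + 2)))
          * ex (-(r * ((u - v + w) / 2)))
          = ex (-(τ * (r ^ 2 / (4 * (K + 2)))) - r * ((u - v + w * (1 - 2 / (K + 2))) / 2)) := by
        rw [← ex_add]; congr 1; field_simp; ring
      rw [← h5]; ring
    · intro m hm
      rw [charThetaCoef_eq_zero K j hτ, zero_mul]
      intro hmj
      apply hm
      obtain ⟨n, hn⟩ := (h.trans hmj.symm).dvd
      exact ⟨n, by simp only; omega⟩
  · rw [tsum_congr (g := fun _ => (0 : ℂ)), tsum_zero, mul_zero]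
    intro n
    rw [charThetaCoef_eq_zero K j hτ, mul_zero]
    intro h'
    exact h (by simp only [Int.ModEq] at *; omega)

/-- Quasi-periodicity moves every jump to the boundary of strip 0. Even boundaries keep j, while odd
ones (next lemma) exchange j with k - j; this is the source of the two terms in the correction of
μ̃. -/
lemma lerchStep_even (K : ℕ) (j : ℤ) {τ : ℂ} (hτ : 0 < τ.im) (v u w : ℂ) (m r : ℤ) :
    lerchStep K j τ v u w (-2 * m) r = lerchStep K j τ v u w 0 (r + 2 * (K + 2) * m) := by
  rw [lerchStep, lerchStep, add_comm r, lerchCoef_shift_mul K j hτ, lerchCoef_shift_mul K j hτ]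
  congr 2 <;> ring

lemma lerchStep_odd (K : ℕ) (j : ℤ) {τ : ℂ} (hτ : 0 < τ.im) (v u w : ℂ) (m r : ℤ) :
    lerchStep K j τ v u w (1 - 2 * m) r
      = -lerchStep K (K + 2 - j) τ v u w 0 (r - (K + 2) + 2 * (K + 2) * m) := by
  have := lerchStep_shift K (K + 2 - j) hτ v u w (-2 * m) (r - (K + 2))
  rw [sub_sub_cancel, sub_add_cancel, show -2 * m + 1 = 1 - 2 * m by ring] at this
  rw [← lerchStep_even K _ hτ, this, neg_neg]

/-! ### Relation with the Appell-Lerch sums -/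

/-- Completing the square in n absorbs the q^{n²/k} of the definition into the normalization of the
minimal character, so μ is built from the expansion in strip 0. -/
lemma muTerm_eq (K : ℕ) (j j' : ℤ) (hj : K = 0 → j = 1) {τ : ℂ} (hτ : 0 < τ.im) (v u w : ℂ)
    (n : ℤ) : muTerm (K + 2) j j' τ v u w n
      = -(ex (-(v * (j' / (K + 2)))) * lerchFactor K τ w j') * lerchTerm K j τ v u w 0 j' n := by
  have hK : (K : ℂ) + 2 ≠ 0 := by exact_mod_cast (by omega : K + 2 ≠ 0)
  rw [muTerm, minimalChar_eq K j _ hj hτ, lerchTerm, lerchFactor,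
    show (2 * n + j' : ℤ) = j' + 2 * n by ring]
  have e1 : ∀ x : ℂ, Complex.exp (2 * Real.pi * Complex.I * x) = ex x := fun x => rfl
  rw [show 2 * (Real.pi : ℂ) * Complex.I * τ * (n ^ 2 / (K + 2 : ℕ) + j' * n / (K + 2 : ℕ))
      = 2 * Real.pi * Complex.I * (τ * (n ^ 2 / (K + 2 : ℕ) + j' * n / (K + 2 : ℕ))) by ring,
    show 2 * (Real.pi : ℂ) * Complex.I * n * (u + (1 - 2 / (K + 2 : ℕ)) * (w - v))
      = 2 * Real.pi * Complex.I * (n * (u + (1 - 2 / (K + 2 : ℕ)) * (w - v))) by ring, e1, e1, e1]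
  have h : ex (τ * (n ^ 2 / (K + 2 : ℕ) + j' * n / (K + 2 : ℕ)))
      * ex (n * (u + (1 - 2 / (K + 2 : ℕ)) * (w - v)))
      * ex (-(τ * (((j' + 2 * n : ℤ) : ℂ) ^ 2 / (4 * (K + 2))))
        + (w - v) * ((j' + 2 * n : ℤ) / (K + 2)))
      = ex (-(v * (j' / (K + 2)))) * ex (-(τ * (j' ^ 2 / (4 * (K + 2)))) + w * (j' / (K + 2)))
        * ex (n * (u - v + w)) := by
    rw [← ex_add, ← ex_add, ← ex_add, ← ex_add]
    congr 1; push_cast; field_simp; ring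
  rw [Int.cast_zero, zero_mul, neg_zero, ex_zero]
  linear_combination -(charThetaCoef K j τ (w - v) (j' + 2 * n) / (1 - ex (v + n * τ))) * h

lemma summable_muTerm (K : ℕ) (j j' : ℤ) (hj : K = 0 → j = 1) {τ v : ℂ} (hτ : 0 < τ.im)
    (hv : OffLattice τ v) (u w : ℂ) : Summable (muTerm (K + 2) j j' τ v u w) := by
  rw [funext (muTerm_eq K j j' hj hτ v u w)]
  exact (summable_lerchTerm K j hτ hv u w 0 j').mul_left _

lemma mu_eq (K : ℕ) (j j' : ℤ) (hj : K = 0 → j = 1) {τ : ℂ} (hτ : 0 < τ.im) (v u w : ℂ) :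
    mu (K + 2) j j' τ v u w = -lerchCoef K j τ v u w 0 j' / theta11 τ u := by
  rw [mu, tsum_congr (muTerm_eq K j j' hj hτ v u w), tsum_mul_left, lerchCoef]
  have h : Complex.exp (2 * Real.pi * Complex.I * v * (j' / (K + 2 : ℕ)))
      * ex (-(v * (j' / (K + 2)))) = 1 := by
    rw [ex, ← Complex.exp_add, ← Complex.exp_zero]; congr 1; push_cast; ring
  linear_combination -(lerchFactor K τ w j' * ∑' n : ℤ, lerchTerm K j τ v u w 0 j' n)
    / theta11 τ u * h

lemma mu_tau_add_one (K : ℕ) (j j' : ℤ) (hj : K = 0 → j = 1) {τ : ℂ} (hτ : 0 < τ.im)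
    (v u w : ℂ) : mu (K + 2) j j' (τ + 1) v u w
      = ex (-(1 / 8) + (j ^ 2 - j' ^ 2) / (4 * (K + 2))) * mu (K + 2) j j' τ v u w := by
  have hτ' : 0 < (τ + 1).im := by simpa using hτ
  rw [mu_eq K j j' hj hτ, mu_eq K j j' hj hτ', theta11_tau_add_one hτ]
  have h1 : ∀ n : ℤ, lerchTerm K j (τ + 1) v u w 0 j' n
      = ex (j ^ 2 / (4 * (K + 2))) * lerchTerm K j τ v u w 0 j' n := by
    intro n
    have : ex (v + n * (τ + 1)) = ex (v + n * τ) := ex_eq_of_sub_int n (by ring)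
    rw [lerchTerm, lerchTerm, charThetaCoef_tau_add_one K j hτ, this]
    simp only [Int.cast_zero, zero_mul, neg_zero]
    ring
  rw [lerchCoef, lerchCoef, tsum_congr h1, tsum_mul_left]
  have h2 : lerchFactor K (τ + 1) w j' * ex (j ^ 2 / (4 * (K + 2)))
      = ex (1 / 8) * ex (-(1 / 8) + (j ^ 2 - j' ^ 2) / (4 * (K + 2))) * lerchFactor K τ w j' := by
    rw [lerchFactor, lerchFactor, ← ex_add, ← ex_add, ← ex_add]
    congr 1; ring
  have h3 := ex_ne_zero (1 / 8)
  rw [← mul_assoc, h2]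
  generalize ex (-(1 / 8) + ((j : ℂ) ^ 2 - j' ^ 2) / (4 * (K + 2))) = E
  generalize ∑' n : ℤ, lerchTerm K j τ v u w 0 j' n = S
  rw [show -(ex (1 / 8) * E * lerchFactor K τ w j' * S)
    = ex (1 / 8) * (E * -(lerchFactor K τ w j' * S)) by ring, mul_div_mul_left _ _ h3,
    mul_div_assoc]

section

open MeasureTheory

lemma integrable_gauss : Integrable fun x : ℝ => Real.exp (-(Real.pi * x ^ 2)) := by
  simpa only [neg_mul] using integrable_exp_neg_mul_sq Real.pi_pos

lemma integral_Iic_gauss (c : ℝ) :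
    ∫ x in Set.Iic c, Real.exp (-(Real.pi * x ^ 2)) = (1 + errorE c) / 2 := by
  have h0 : ∫ x in Set.Ioi (0 : ℝ), Real.exp (-(Real.pi * x ^ 2)) = 1 / 2 := by
    have := integral_gaussian_Ioi Real.pi
    simpa only [neg_mul, div_self Real.pi_ne_zero, Real.sqrt_one] using this
  have h1 : ∫ x in Set.Iic (0 : ℝ), Real.exp (-(Real.pi * x ^ 2)) = 1 / 2 := by
    rw [← h0, ← neg_zero, ← integral_comp_neg_Iic]
    simp
  have h2 := intervalIntegral.integral_Iic_sub_Iic (a := 0) (b := c) (μ := volume)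
    integrable_gauss.integrableOn integrable_gauss.integrableOn
  rw [h1] at h2
  rw [errorE, ← h2]; ring

lemma integral_Ioi_gauss (c : ℝ) :
    ∫ x in Set.Ioi c, Real.exp (-(Real.pi * x ^ 2)) = (1 - errorE c) / 2 := by
  have h := intervalIntegral.integral_Iic_add_Ioi (b := c) (μ := volume)
    integrable_gauss.integrableOn integrable_gauss.integrableOn
  have h3 : ∫ x : ℝ, Real.exp (-(Real.pi * x ^ 2)) = 1 := by
    have := integral_gaussian Real.pi
    simpa only [neg_mul, div_self Real.pi_ne_zero, Real.sqrt_one] using this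
  rw [integral_Iic_gauss, h3] at h
  linarith

lemma errorE_neg (c : ℝ) : errorE (-c) = -errorE c := by
  have h : ∫ x in Set.Iic (-c), Real.exp (-(Real.pi * x ^ 2))
      = ∫ x in Set.Ioi c, Real.exp (-(Real.pi * x ^ 2)) := by
    rw [← neg_neg c, ← integral_comp_neg_Iic, neg_neg]; simp
  rw [integral_Iic_gauss, integral_Ioi_gauss] at h
  linarith

lemma one_sub_errorE_nonneg (c : ℝ) : 0 ≤ 1 - errorE c := by
  have : 0 ≤ ∫ x in Set.Ioi c, Real.exp (-(Real.pi * x ^ 2)) :=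
    integral_nonneg fun x => (Real.exp_pos _).le
  rw [integral_Ioi_gauss] at this; linarith

lemma one_add_errorE_nonneg (c : ℝ) : 0 ≤ 1 + errorE c := by
  simpa [errorE_neg] using one_sub_errorE_nonneg (-c)

/-- Translating the tail to the half line x > 0 and using (x + c)² ≥ x² + c² for x, c ≥ 0 gives the
bound with constant exactly 1. -/
lemma one_sub_errorE_le {c : ℝ} (hc : 0 ≤ c) : 1 - errorE c ≤ Real.exp (-(Real.pi * c ^ 2)) := by
  have h1 : ∫ x in Set.Ioi c, Real.exp (-(Real.pi * x ^ 2))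
      ≤ ∫ x in Set.Ioi (0 : ℝ), Real.exp (-(Real.pi * c ^ 2)) * Real.exp (-(Real.pi * x ^ 2)) := by
    rw [← (measurePreserving_add_right volume c).setIntegral_preimage_emb
      (measurableEmbedding_addRight c)]
    simp only [Set.preimage_add_const_Ioi, sub_self]
    refine setIntegral_mono_on ?_ ?_ measurableSet_Ioi fun x hx => ?_
    · exact (integrable_gauss.comp_add_right c).integrableOn
    · exact (integrable_gauss.const_mul _).integrableOn
    · rw [← Real.exp_add]
      refine Real.exp_le_exp.2 ?_
      nlinarith [mul_nonneg (Real.pi_pos.le) (mul_nonneg (le_of_lt hx) hc)]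
  rw [integral_const_mul, integral_Ioi_gauss, integral_Ioi_gauss] at h1
  have : errorE 0 = 0 := by simp [errorE]
  rw [this] at h1
  linarith

lemma one_add_errorE_le {c : ℝ} (hc : c ≤ 0) : 1 + errorE c ≤ Real.exp (-(Real.pi * c ^ 2)) := by
  have := one_sub_errorE_le (neg_nonneg.2 hc)
  simpa [errorE_neg] using this

/-- Integrability of a sum of functions whose `L¹` norms are summable. -/
lemma integrable_of_hasSum {ι α : Type*} [Countable ι] [MeasurableSpace α] {μ : Measure α}
    {F : ι → α → ℂ} {G : α → ℂ} (hF : ∀ i, Integrable (F i) μ)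
    (hs : Summable fun i => ∫ x, ‖F i x‖ ∂μ) (hG : ∀ x, HasSum (fun i => F i x) (G x)) :
    Integrable G μ := by
  refine ⟨?_, ?_⟩
  · refine aestronglyMeasurable_of_tendsto_ae (u := Filter.atTop (α := Finset ι))
      (f := fun s x => ∑ i ∈ s, F i x) (fun s => ?_) (Filter.Eventually.of_forall fun x => hG x)
    exact (integrable_finsetSum s fun i _ => hF i).1
  · have h1 : ∫⁻ x, ‖G x‖ₑ ∂μ ≤ ∫⁻ x, ∑' i, ‖F i x‖ₑ ∂μ :=
      lintegral_mono fun x => by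
        rw [← (hG x).tsum_eq]; exact enorm_tsum_le_tsum_enorm
    refine lt_of_le_of_lt h1 ?_
    rw [lintegral_tsum fun i => (hF i).1.enorm]
    have h2 : ∀ i, ∫⁻ x, ‖F i x‖ₑ ∂μ = ENNReal.ofReal (∫ x, ‖F i x‖ ∂μ) := fun i => by
      rw [ofReal_integral_norm_eq_lintegral_enorm (hF i)]
    rw [tsum_congr h2]
    exact hs.tsum_ofReal_lt_top

lemma sum_Ioc_sub_pred {H : ℤ → ℂ} (a : ℤ) (n : ℕ) :
    ∑ M ∈ Finset.Ioc a (a + n), (H M - H (M - 1)) = H (a + n) - H a := by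
  induction n with
  | zero => simp
  | succ n ih =>
    have : Finset.Ioc a (a + (n + 1 : ℕ)) = insert (a + n + 1) (Finset.Ioc a (a + n)) := by
      ext x; simp only [Finset.mem_Ioc, Finset.mem_insert]; push_cast; omega
    rw [this, Finset.sum_insert (by simp), ih]
    push_cast
    rw [add_sub_cancel_right, ← add_assoc]; ring

lemma hasSum_telescope (H : ℤ → ℂ) (N₀ N : ℤ) :
    HasSum (fun M => (H M - H (M - 1))
      * (if N₀ < M then (if M ≤ N then 1 else 0) else (if M ≤ N then 0 else -1)))
      (H N - H N₀) := by
  rcases le_total N₀ N with h | h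
  · obtain ⟨n, rfl⟩ := Int.le.dest h
    rw [← sum_Ioc_sub_pred N₀ n]
    have := hasSum_sum_of_ne_finset_zero (L := .unconditional ℤ) (f := fun M => (H M - H (M - 1))
      * (if N₀ < M then (if M ≤ N₀ + n then (1 : ℂ) else 0) else (if M ≤ N₀ + n then 0 else -1)))
      (s := Finset.Ioc N₀ (N₀ + n)) (fun M hM => by
        rw [Finset.mem_Ioc] at hM
        split_ifs <;> first | (exfalso; omega) | simp)
    convert this using 1
    refine Finset.sum_congr rfl fun M hM => ?_
    rw [Finset.mem_Ioc] at hM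
    rw [if_pos hM.1, if_pos hM.2, mul_one]
  · obtain ⟨n, rfl⟩ := Int.le.dest h
    rw [← neg_sub, ← sum_Ioc_sub_pred N n]
    have := hasSum_sum_of_ne_finset_zero (L := .unconditional ℤ) (f := fun M => (H M - H (M - 1))
      * (if N + n < M then (if M ≤ N then (1 : ℂ) else 0) else (if M ≤ N then 0 else -1)))
      (s := Finset.Ioc N (N + n)) (fun M hM => by
        rw [Finset.mem_Ioc] at hM
        split_ifs <;> first | (exfalso; omega) | simp)
    convert this using 1
    rw [← Finset.sum_neg_distrib]
    refine Finset.sum_congr rfl fun M hM => ?_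
    rw [Finset.mem_Ioc] at hM
    rw [if_neg (by omega), if_neg (by omega)]; ring

/-- Gaussian integral of a step function with cuts at the points `A M`. -/
lemma integral_step_gauss (H : ℤ → ℂ) (N₀ : ℤ) {A : ℤ → ℝ} {ν : ℝ → ℤ}
    (hν : ∀ M x, M ≤ ν x ↔ x ≤ A M)
    (hs : Summable fun M => (H M - H (M - 1))
      * (((if N₀ < M then 1 else -1) + errorE (A M) : ℝ) : ℂ)) :
    Integrable (fun x : ℝ => H (ν x) * (Real.exp (-(Real.pi * x ^ 2)) : ℝ)) ∧
    ∫ x : ℝ, H (ν x) * (Real.exp (-(Real.pi * x ^ 2)) : ℝ)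
      = H N₀ + 1 / 2 * ∑' M, (H M - H (M - 1))
        * (((if N₀ < M then 1 else -1) + errorE (A M) : ℝ) : ℂ) := by
  set g : ℝ → ℝ := fun x => Real.exp (-(Real.pi * x ^ 2)) with hg
  have hgi : Integrable g := integrable_gauss
  -- The half line on which jump M is active. Choosing its side by comparing M with N₀ makes the
  -- integral the small tail (1 ± E)/2, which allows the interchange of sum and integral.
  set S : ℤ → Set ℝ := fun M => if N₀ < M then Set.Iic (A M) else Set.Ioi (A M) with hS
  have hSm : ∀ M, MeasurableSet (S M) := fun M => by
    rw [hS]; dsimp only; split_ifs; exacts [measurableSet_Iic, measurableSet_Ioi]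
  set e : ℤ → ℝ := fun M => if N₀ < M then 1 else -1 with he
  set F : ℤ → ℝ → ℂ := fun M x => ((H M - H (M - 1)) * e M) * ((S M).indicator g x : ℝ) with hF
  have hsum : ∀ x, HasSum (fun M => F M x) ((H (ν x) - H N₀) * g x) := fun x => by
    refine hasSum_of_eq (fun M => ?_) ((hasSum_telescope H N₀ (ν x)).mul_right (g x : ℂ))
    simp only [hF, hS, he]
    by_cases h1 : N₀ < M <;> by_cases h2 : x ≤ A M
    · simp [h1, (hν M x).2 h2, Set.indicator_of_mem (Set.mem_Iic.2 h2)]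
    · simp [h1, mt (hν M x).1 h2, Set.indicator_of_notMem (mt Set.mem_Iic.1 h2)]
    · simp [h1, (hν M x).2 h2, Set.indicator_of_notMem (mt Set.mem_Ioi.1 (not_lt.2 h2))]
    · simp [h1, mt (hν M x).1 h2, Set.indicator_of_mem (Set.mem_Ioi.2 (not_le.1 h2))]
  have hInd : ∀ M, Integrable ((S M).indicator g) := fun M => hgi.indicator (hSm M)
  have hFi : ∀ M, Integrable (F M) := fun M => ((hInd M).ofReal).const_mul _
  have hSint : ∀ M, ∫ x, (S M).indicator g x = e M * (e M + errorE (A M)) / 2 := fun M => by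
    rw [integral_indicator (hSm M)]
    simp only [hS, he]
    split_ifs
    · rw [integral_Iic_gauss]; ring
    · rw [integral_Ioi_gauss]; ring
  have he2 : ∀ M, e M * e M = 1 := fun M => by simp only [he]; split_ifs <;> norm_num
  have hFint : ∀ M, ∫ x, F M x
      = 1 / 2 * ((H M - H (M - 1)) * ((e M + errorE (A M) : ℝ) : ℂ)) := fun M => by
    have h3 : (e M : ℂ) * e M = 1 := by exact_mod_cast he2 M
    simp only [hF]
    rw [integral_const_mul, integral_complex_ofReal, hSint]
    push_cast
    linear_combination (1 / 2 * (H M - H (M - 1)) * (e M + errorE (A M))) * h3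
  have hFn : ∀ M, ∫ x, ‖F M x‖
      = 1 / 2 * ‖(H M - H (M - 1)) * ((e M + errorE (A M) : ℝ) : ℂ)‖ := fun M => by
    have h4 : ∀ x, ‖F M x‖ = ‖(H M - H (M - 1)) * (e M : ℂ)‖ * (S M).indicator g x := fun x => by
      simp only [hF]
      rw [norm_mul, Complex.norm_real, Real.norm_of_nonneg]
      exact Set.indicator_nonneg (fun _ _ => (Real.exp_pos _).le) _
    have h5 : |e M| = 1 := by
      simp only [he]; split_ifs <;> norm_num
    have h6 : 0 ≤ e M * (e M + errorE (A M)) := by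
      simp only [he]; split_ifs
      · linarith [one_add_errorE_nonneg (A M)]
      · linarith [one_sub_errorE_nonneg (A M)]
    rw [integral_congr_ae (Filter.Eventually.of_forall h4), integral_const_mul, hSint,
      norm_mul, norm_mul, Complex.norm_real, Complex.norm_real, Real.norm_eq_abs, Real.norm_eq_abs,
      h5, ← abs_of_nonneg h6, abs_mul, h5]
    ring
  have hFs : Summable fun M => ∫ x, ‖F M x‖ := by
    rw [funext hFn]; exact hs.norm.mul_left _
  have hi := integrable_of_hasSum hFi hFs hsum
  have hI := hasSum_integral_of_summable_integral_norm hFi hFs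
  have hc : Integrable fun x => H N₀ * (g x : ℂ) := hgi.ofReal.const_mul _
  have heq : ∀ x, H (ν x) * (g x : ℂ) = (H (ν x) - H N₀) * g x + H N₀ * g x := fun x => by ring
  have hg1 : ∫ x, g x = 1 := by
    have := integral_gaussian Real.pi
    simpa only [hg, neg_mul, div_self Real.pi_ne_zero, Real.sqrt_one] using this
  constructor
  · exact (hi.add hc).congr (Filter.Eventually.of_forall fun x => (heq x).symm)
  · rw [integral_congr_ae (Filter.Eventually.of_forall heq), integral_add hi hc,
      integral_const_mul, integral_complex_ofReal, hg1, Complex.ofReal_one, mul_one, ← tsum_mul_left,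
      add_comm, ← integral_congr_ae (Filter.Eventually.of_forall fun x => (hsum x).tsum_eq),
      ← hI.tsum_eq, tsum_congr hFint]

/-- The same with an affine change of variables. -/
lemma integral_floor_gauss (H : ℤ → ℂ) (N₀ : ℤ) {α : ℝ} (hα : 0 < α) (β γ : ℝ)
    (hs : Summable fun M : ℤ => (H M - H (M - 1))
      * (((if N₀ < M then 1 else -1) + errorE (α * ((γ - M) / 2) + β) : ℝ) : ℂ)) :
    Integrable (fun a : ℝ => H ⌊γ - 2 * a⌋ * (Real.exp (-(Real.pi * (α * a + β) ^ 2)) : ℝ)) ∧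
    ∫ a : ℝ, H ⌊γ - 2 * a⌋ * (Real.exp (-(Real.pi * (α * a + β) ^ 2)) : ℝ)
      = 1 / α * (H N₀ + 1 / 2 * ∑' M : ℤ, (H M - H (M - 1))
        * (((if N₀ < M then 1 else -1) + errorE (α * ((γ - M) / 2) + β) : ℝ) : ℂ)) := by
  obtain ⟨h1, h2⟩ := integral_step_gauss H N₀ (A := fun M => α * ((γ - M) / 2) + β)
    (ν := fun x => ⌊γ - 2 * ((x - β) / α)⌋) (fun M x => by
      rw [Int.le_floor, ← sub_le_iff_le_add, ← div_le_iff₀' hα]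
      constructor <;> intro h <;> linarith) hs
  have h3 : ∀ a : ℝ, ⌊γ - 2 * ((α * a + β - β) / α)⌋ = ⌊γ - 2 * a⌋ := fun a => by
    rw [add_sub_cancel_right, mul_div_cancel_left₀ _ hα.ne']
  constructor
  · have := (h1.comp_add_right β).comp_mul_left' hα.ne'
    simpa only [h3] using this
  · rw [← h2, ← integral_add_right_eq_self
      (fun x => H ⌊γ - 2 * ((x - β) / α)⌋ * ((Real.exp (-(Real.pi * x ^ 2)) : ℝ) : ℂ)) β]
    have := Measure.integral_comp_mul_left (fun x => H ⌊γ - 2 * ((x + β - β) / α)⌋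
      * (Real.exp (-(Real.pi * (x + β) ^ 2)) : ℝ)) α
    simp only [h3] at this
    rw [this, abs_of_pos (inv_pos.2 hα), Complex.real_smul]
    push_cast; ring

end

/-! ### Convergence of the series R -/

lemma hasSum_neg_even_add_odd {f : ℤ → ℂ} {a b : ℂ} (he : HasSum (fun m => f (-2 * m)) a)
    (ho : HasSum (fun m => f (1 - 2 * m)) b) : HasSum f (a + b) := by
  have h1 : Function.Injective fun m : ℤ => -2 * m := fun x y h => by dsimp only at h; omega
  have h2 : Function.Injective fun m : ℤ => 1 - 2 * m := fun x y h => by dsimp only at h; omega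
  refine (h1.hasSum_range_iff.2 he).add_isCompl ?_ (h2.hasSum_range_iff.2 ho)
  rw [isCompl_iff, Set.disjoint_iff, codisjoint_iff]
  constructor
  · rintro x ⟨⟨m, rfl⟩, ⟨n, h⟩⟩
    dsimp only at h; omega
  · ext x
    simp only [Set.sup_eq_union, Set.mem_union, Set.mem_range, Set.top_eq_univ, Set.mem_univ,
      iff_true]
    obtain ⟨c, hc⟩ := Int.even_or_odd' x
    rcases hc with hc | hc
    · exact Or.inl ⟨-c, by omega⟩
    · exact Or.inr ⟨-c, by omega⟩

lemma abs_sign_sub_errorE_le {s A : ℝ} (h : 0 ≤ A ∧ s = 1 ∨ A ≤ 0 ∧ s = -1) :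
    |s - errorE A| ≤ Real.exp (-(Real.pi * A ^ 2)) := by
  rcases h with ⟨hA, rfl⟩ | ⟨hA, rfl⟩
  · rw [abs_of_nonneg (one_sub_errorE_nonneg A)]; exact one_sub_errorE_le hA
  · rw [abs_of_nonpos (by linarith [one_add_errorE_nonneg A])]
    linarith [one_add_errorE_le hA]

lemma real_sign_int_add_half (n : ℤ) :
    Real.sign ((n : ℝ) + 1 / 2) = if n < 0 then -1 else 1 := by
  split_ifs with h
  · apply Real.sign_of_neg
    have : (n : ℝ) ≤ -1 := by exact_mod_cast Int.le_sub_one_of_lt h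
    linarith
  · apply Real.sign_of_pos
    have : (0 : ℝ) ≤ n := by exact_mod_cast not_lt.1 h
    linarith

lemma RTerm_eq (k : ℕ) (τ x : ℂ) (n : ℤ) : RTerm k τ x n
    = ((Real.sign ((n : ℝ) + 1 / 2)
      - errorE (((n : ℝ) + 2 * k * x.im / τ.im) * Real.sqrt (τ.im / k)) : ℝ) : ℂ)
      * ex (-(τ * (n ^ 2 / (4 * k))) - n * x) := by
  rw [RTerm, ex]; congr 2; ring

/-- When sgn agrees with the sign of the argument A of E, the difference is at most e^{-πA²}.
Expanding A² shows that this overcompensates the growth of the exponential and leaves at most the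
corresponding theta term. -/
lemma norm_RTerm_le {k : ℕ} (hk : 0 < k) {τ : ℂ} (hτ : 0 < τ.im) (x : ℂ) {n : ℤ}
    (h : 0 ≤ (n : ℝ) + 2 * k * x.im / τ.im ∧ 0 ≤ n ∨ (n : ℝ) + 2 * k * x.im / τ.im ≤ 0 ∧ n < 0) :
    ‖RTerm k τ x n‖ ≤ ‖ex (τ * (n ^ 2 / (4 * k)) + x * n)‖ := by
  have hk' : (0 : ℝ) < k := by exact_mod_cast hk
  have hs : Real.sqrt (τ.im / k) ^ 2 = τ.im / k := Real.sq_sqrt (by positivity)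
  rw [RTerm_eq, norm_mul, Complex.norm_real, Real.norm_eq_abs, norm_ex, norm_ex]
  refine (mul_le_mul_of_nonneg_right (abs_sign_sub_errorE_le ?_) (Real.exp_pos _).le).trans ?_
  · rw [real_sign_int_add_half]
    rcases h with ⟨h1, h2⟩ | ⟨h1, h2⟩
    · exact Or.inl ⟨mul_nonneg h1 (Real.sqrt_nonneg _), if_neg (not_lt.2 h2)⟩
    · exact Or.inr ⟨mul_nonpos_of_nonpos_of_nonneg h1 (Real.sqrt_nonneg _), if_pos h2⟩
  · have e0 : (n : ℂ) ^ 2 / (4 * k) = ((n ^ 2 / (4 * k) : ℝ) : ℂ) := by push_cast; ring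
    have e1 : (-(τ * ((n : ℂ) ^ 2 / (4 * k))) - n * x).im
        = -(τ.im * (n ^ 2 / (4 * k))) - n * x.im := by
      rw [e0, Complex.sub_im, Complex.neg_im, Complex.im_mul_ofReal, ← Complex.ofReal_intCast,
        Complex.im_ofReal_mul]
    have e2 : (τ * ((n : ℂ) ^ 2 / (4 * k)) + x * n).im
        = τ.im * (n ^ 2 / (4 * k)) + x.im * n := by
      rw [e0, Complex.add_im, Complex.im_mul_ofReal, ← Complex.ofReal_intCast,
        Complex.im_mul_ofReal]
    rw [← Real.exp_add, e1, e2, mul_pow, hs]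
    refine Real.exp_le_exp.2 ?_
    have e3 : ((n : ℝ) + 2 * k * x.im / τ.im) ^ 2 * (τ.im / k)
        = τ.im * n ^ 2 / k + 4 * n * x.im + 4 * k * x.im ^ 2 / τ.im := by
      field_simp; ring
    have e4 : 0 ≤ 4 * k * x.im ^ 2 / τ.im := by positivity
    have e5 : τ.im * n ^ 2 / k = 4 * (τ.im * (n ^ 2 / (4 * k))) := by field_simp
    rw [e3, e5]
    nlinarith [mul_nonneg Real.pi_pos.le e4]

/-- The two signs disagree for only finitely many n; elsewhere the theta series dominates. -/
lemma summable_RTerm {k : ℕ} (hk : 0 < k) (r : ℤ) {τ : ℂ} (hτ : 0 < τ.im) (x : ℂ) :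
    Summable fun m : ℤ => RTerm k τ x (r + 2 * k * m) := by
  have hk' : (0 : ℤ) < k := by exact_mod_cast hk
  refine (hasSum_theta hk r hτ x).summable.norm.of_norm_bounded_eventually ?_
  set C : ℤ := ⌈|2 * k * x.im / τ.im|⌉
  have hC : |2 * k * x.im / τ.im| ≤ (C : ℝ) := Int.le_ceil _
  have hinj : Function.Injective fun m : ℤ => r + 2 * k * m := fun a b h => by
    have : 2 * (k : ℤ) * a = 2 * k * b := by dsimp only at h; linarith
    exact mul_left_cancel₀ (by positivity) this
  have hfin : ((fun m : ℤ => r + 2 * k * m) ⁻¹' Set.Icc (-C) C).Finite :=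
    (Set.finite_Icc _ _).preimage hinj.injOn
  filter_upwards [hfin.compl_mem_cofinite] with m hm
  simp only [Set.mem_compl_iff, Set.mem_preimage, Set.mem_Icc, not_and_or, not_le] at hm
  refine (norm_RTerm_le hk hτ x ?_).trans (le_of_eq ?_)
  · obtain ⟨h1, h2⟩ := abs_le.1 hC
    have hC0 : 0 ≤ C := by exact_mod_cast (abs_nonneg _).trans hC
    rcases hm with hm | hm
    · have : ((r + 2 * k * m : ℤ) : ℝ) < -C := by exact_mod_cast hm
      exact Or.inr ⟨by linarith, by omega⟩
    · have : (C : ℝ) < ((r + 2 * k * m : ℤ) : ℝ) := by exact_mod_cast hm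
      exact Or.inl ⟨by linarith, by omega⟩
  · push_cast; congr 3 <;> ring

/-! ### The unfolded integral produces μ and R -/

section

open MeasureTheory

/-- The Gaussian integral of the theta coefficients. -/
lemma integral_lerchCoef (K : ℕ) (j : ℤ) {τ v : ℂ} (hτ : 0 < τ.im) (hv : OffLattice τ v)
    (u w : ℂ) (r N₀ : ℤ) (hN₀ : ∀ M : ℤ, N₀ < M ↔ r - (K + 2) * M < 0) {ω : ℂ}
    (hω : ω = u - v + w * (1 - 2 / (K + 2))) :
    Integrable (fun a : ℝ => lerchCoef K j τ v u w ⌊ω.im / τ.im - 2 * a⌋ r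
      * (Real.exp (-(Real.pi * (2 * √((K + 2) * τ.im) * a
        + r * √(τ.im / (K + 2))) ^ 2)) : ℝ)) ∧
    ∫ a : ℝ, lerchCoef K j τ v u w ⌊ω.im / τ.im - 2 * a⌋ r
      * (Real.exp (-(Real.pi * (2 * √((K + 2) * τ.im) * a
        + r * √(τ.im / (K + 2))) ^ 2)) : ℝ)
      = 1 / ((2 * √((K + 2) * τ.im) : ℝ) : ℂ) * (lerchCoef K j τ v u w N₀ r
        + 1 / 2 * if r ≡ j [ZMOD 2] then
          theta11 τ u * su2Char K (j - 1) τ (u - v + w) * R (K + 2) r τ (ω / 2)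
            - theta11 τ u * su2Char K (K + 2 - j - 1) τ (u - v + w)
              * R (K + 2) (r - (K + 2)) τ (ω / 2) else 0) := by
  have hk0 : (0 : ℝ) < K + 2 := by positivity
  -- The jump at boundary M corresponds to n = r - kM in R: the cut point of the Gaussian is
  -- precisely the argument of E there, and the condition on N₀ makes the sign equal -sgn(n + 1/2).
  have hA : ∀ M : ℤ, 2 * √((K + 2) * τ.im) * ((ω.im / τ.im - M) / 2) + r * √(τ.im / (K + 2))
      = (((r - (K + 2) * M : ℤ) : ℝ) + 2 * ((K + 2 : ℕ) : ℝ) * (ω / 2).im / τ.im)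
        * √(τ.im / (K + 2 : ℕ)) := fun M => by
    have : √((K + 2) * τ.im) = (K + 2) * √(τ.im / (K + 2)) := by
      rw [show ((K : ℝ) + 2) * τ.im = (K + 2) ^ 2 * (τ.im / (K + 2)) by field_simp,
        Real.sqrt_mul (by positivity), Real.sqrt_sq hk0.le]
    rw [this, show (ω / 2).im = ω.im / 2 by simp]
    push_cast
    ring
  have hsgn : ∀ M : ℤ, (if N₀ < M then 1 else -1 : ℝ)
      = -Real.sign (((r - (K + 2) * M : ℤ) : ℝ) + 1 / 2) := fun M => by
    rw [real_sign_int_add_half]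
    by_cases h : N₀ < M
    · rw [if_pos h, if_pos ((hN₀ M).1 h), neg_neg]
    · rw [if_neg h, if_neg (mt (hN₀ M).2 h)]
  have hR : ∀ M : ℤ, ((((if N₀ < M then 1 else -1)
      + errorE (2 * √((K + 2) * τ.im) * ((ω.im / τ.im - M) / 2) + r * √(τ.im / (K + 2))) : ℝ)) : ℂ)
      * ex (-(τ * (((r - (K + 2) * M : ℤ) : ℂ) ^ 2 / (4 * (K + 2))))
        - ((r - (K + 2) * M : ℤ) : ℂ) * (ω / 2))
      = -RTerm (K + 2) τ (ω / 2) (r - (K + 2) * M) := fun M => by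
    rw [RTerm_eq, hsgn, hA]; push_cast; ring
  have hstep0 : ∀ (i n : ℤ), lerchStep K i τ v u w 0 n = if n ≡ i [ZMOD 2] then
      -theta11 τ u * su2Char K (i - 1) τ (u - v + w)
        * ex (-(τ * (n ^ 2 / (4 * (K + 2)))) - n * (ω / 2)) else 0 := fun i n => by
    rw [lerchStep_zero K i hτ hv, hω]
  set c : ℤ → ℂ := fun M => ((((if N₀ < M then 1 else -1)
      + errorE (2 * √((K + 2) * τ.im) * ((ω.im / τ.im - M) / 2) + r * √(τ.im / (K + 2))) : ℝ)) : ℂ)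
    with hc
  -- Even boundaries M = -2m run through n ≡ r mod 2k and give R_{k,r}; odd boundaries M = 1 - 2m
  -- run through n ≡ r - k and give R_{k,r-k} with j replaced by k - j.
  have heven : ∀ m : ℤ, lerchStep K j τ v u w (-2 * m) r * c (-2 * m)
      = (if r ≡ j [ZMOD 2] then theta11 τ u * su2Char K (j - 1) τ (u - v + w) else 0)
        * RTerm (K + 2) τ (ω / 2) (r + 2 * (K + 2 : ℕ) * m) := fun m => by
    have h1 : r - ((K : ℤ) + 2) * (-2 * m) = r + 2 * (K + 2) * m := by ring
    have h2 := hR (-2 * m)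
    rw [h1] at h2
    have h3 : (r + 2 * ((K : ℤ) + 2) * m ≡ j [ZMOD 2]) ↔ r ≡ j [ZMOD 2] := by
      simp only [Int.ModEq, mul_assoc, Int.add_mul_emod_self_left]
    rw [lerchStep_even K j hτ, hstep0]
    simp only [h3]
    push_cast at h2 ⊢
    split_ifs
    · simp only [hc]
      push_cast
      linear_combination (-(theta11 τ u * su2Char K (j - 1) τ (u - v + w))) * h2
    · simp
  have hodd : ∀ m : ℤ, lerchStep K j τ v u w (1 - 2 * m) r * c (1 - 2 * m)
      = (if r ≡ j [ZMOD 2] then -(theta11 τ u * su2Char K (K + 2 - j - 1) τ (u - v + w)) else 0)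
        * RTerm (K + 2) τ (ω / 2) (r - (K + 2) + 2 * (K + 2 : ℕ) * m) := fun m => by
    have h1 : r - ((K : ℤ) + 2) * (1 - 2 * m) = r - (K + 2) + 2 * (K + 2) * m := by ring
    have h2 := hR (1 - 2 * m)
    rw [h1] at h2
    have h3 : (r - (K + 2) + 2 * ((K : ℤ) + 2) * m ≡ K + 2 - j [ZMOD 2]) ↔ r ≡ j [ZMOD 2] := by
      rw [mul_assoc]
      simp only [Int.ModEq, Int.add_mul_emod_self_left]
      omega
    rw [lerchStep_odd K j hτ, hstep0]
    simp only [h3]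
    push_cast at h2 ⊢
    split_ifs
    · simp only [hc]
      push_cast
      linear_combination (theta11 τ u * su2Char K (K + 2 - j - 1) τ (u - v + w)) * h2
    · simp
  have hsum := hasSum_neg_even_add_odd (f := fun M => lerchStep K j τ v u w M r * c M)
    (by
      simp only [heven]
      exact ((summable_RTerm (k := K + 2) (by omega) r hτ (ω / 2)).hasSum).mul_left _)
    (by
      simp only [hodd]
      exact ((summable_RTerm (k := K + 2) (by omega) (r - (K + 2)) hτ (ω / 2)).hasSum).mul_left _)
  obtain ⟨h1, h2⟩ := integral_floor_gauss (fun M => lerchCoef K j τ v u w M r) N₀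
    (α := 2 * √((K + 2) * τ.im)) (by positivity) (r * √(τ.im / (K + 2))) (ω.im / τ.im) hsum.summable
  refine ⟨h1, h2.trans ?_⟩
  have h3 := hsum.tsum_eq
  simp only [lerchStep, hc] at h3
  rw [h3, R, R]
  split_ifs <;> ring

end

/-! ### The kernel on the torus and its unfolding -/

lemma conj_ex (z : ℂ) : (starRingEnd ℂ) (ex z) = ex (-(starRingEnd ℂ) z) := by
  rw [ex, ex, ← Complex.exp_conj]; congr 1
  simp [map_ofNat]

/-- The theta function at the point `aτ + b`, normalized to have a transformation law without
exponential factors. -/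
def thetaChar (k : ℕ) (r : ℤ) (τ : ℂ) (a b : ℝ) : ℂ :=
  ex (k * (a ^ 2 * τ + a * b)) * theta k r τ (a * τ + b)

lemma summable_ex_sq {k : ℕ} (hk : 0 < k) (r : ℤ) {τ : ℂ} (hτ : 0 < τ.im) (a : ℝ) :
    Summable fun l : ℤ => ex (τ * ((2 * k * l + r + 2 * k * a) ^ 2 / (4 * k))) := by
  have hk' : (k : ℂ) ≠ 0 := by exact_mod_cast hk.ne'
  refine ((hasSum_theta hk r hτ (a * τ)).summable.mul_left (ex (k * τ * a ^ 2))).congr fun l => ?_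
  rw [← ex_add]; congr 1; field_simp; ring

/-- At fixed a the conjugate theta function is a Fourier series in b with frequencies -(2kl + r). It
therefore pairs with the theta coefficients of indices ≡ r mod 2k. -/
lemma hasSum_conj_thetaChar {k : ℕ} (hk : 0 < k) (r : ℤ) {τ : ℂ} (hτ : 0 < τ.im) (a b : ℝ) :
    HasSum (fun l : ℤ => ex (k * τ * a ^ 2)
        * (starRingEnd ℂ) (ex (τ * ((2 * k * l + r + 2 * k * a) ^ 2 / (4 * k))))
        * ex (((-(2 * k * l + r) : ℤ) : ℂ) * b))
      (ex (k * (a ^ 2 * τ + a * b)) * (starRingEnd ℂ) (thetaChar k r τ a b)) := by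
  have hk' : (k : ℂ) ≠ 0 := by exact_mod_cast hk.ne'
  have h := ((Complex.hasSum_conj'.2 (hasSum_theta hk r hτ (a * τ + b))).mul_left
    (ex (k * (a ^ 2 * τ + a * b)) * (starRingEnd ℂ) (ex (k * (a ^ 2 * τ + a * b)))))
  rw [thetaChar, map_mul, ← mul_assoc]
  refine hasSum_of_eq (fun l => ?_) h
  rw [mul_assoc, ← map_mul, ← ex_add]
  have e1 : (k * (a ^ 2 * τ + a * b) + (τ * ((2 * k * l + r : ℂ) ^ 2 / (4 * k))
      + (a * τ + b) * (2 * k * l + r : ℂ)))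
      = τ * ((2 * k * l + r + 2 * k * a) ^ 2 / (4 * k)) + ((k * a * b + (2 * k * l + r) * b : ℝ) : ℂ) := by
    push_cast; field_simp; ring
  have e2 : ex (k * (a ^ 2 * τ + a * b)) = ex (k * τ * a ^ 2) * ex (k * a * b) := by
    rw [← ex_add]; congr 1; ring
  rw [e1, ex_add, map_mul, e2, conj_ex ((_ : ℝ) : ℂ), Complex.conj_ofReal]
  have e3 : ex (k * a * b) * ex (-((k * a * b + (2 * k * l + r) * b : ℝ) : ℂ))
      = ex (((-(2 * k * l + r) : ℤ) : ℂ) * b) := by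
    rw [← ex_add]; congr 1; push_cast; ring
  rw [← e3]; ring

/-- The function on the torus whose integral is the completed Appell-Lerch sum. -/
def lerchKernel (K : ℕ) (j r : ℤ) (τ v u w : ℂ) (a b : ℝ) : ℂ :=
  charTheta K j τ (w - v) (2 * (a * τ + b + w / (K + 2)))
    * kronFn τ v (u - v + w * (1 - 2 / (K + 2)) - 2 * (a * τ + b))
    * (ex ((K + 2 : ℕ) * (a ^ 2 * τ + a * b)) * (starRingEnd ℂ) (thetaChar (K + 2) r τ a b))

/-- The integrand of the unfolded integral. -/
def unfolded (K : ℕ) (j r : ℤ) (τ v u w : ℂ) (a : ℝ) : ℂ :=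
  lerchCoef K j τ v u w ⌊(u - v + w * (1 - 2 / (K + 2))).im / τ.im - 2 * a⌋ r
      * (Real.exp (-(Real.pi * (2 * √((K + 2) * τ.im) * a + r * √(τ.im / (K + 2))) ^ 2)) : ℝ)

/-- The Gaussian weight is the squared modulus of a theta term: one factor comes from the
meromorphic side, the other from the conjugate theta function. -/
lemma gauss_eq (K : ℕ) {τ : ℂ} (hτ : 0 < τ.im) (r : ℤ) (a : ℝ) :
    ((Real.exp (-(Real.pi * (2 * √((K + 2) * τ.im) * a + r * √(τ.im / (K + 2))) ^ 2)) : ℝ) : ℂ)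
      = ex (τ * ((r + 2 * (K + 2) * a) ^ 2 / (4 * (K + 2))))
        * (starRingEnd ℂ) (ex (τ * ((r + 2 * (K + 2) * a) ^ 2 / (4 * (K + 2))))) := by
  have hk0 : (0 : ℝ) < K + 2 := by positivity
  rw [Complex.mul_conj, Complex.normSq_eq_norm_sq, norm_ex, ← Real.exp_nat_mul]
  congr 2
  have h1 : √((K + 2) * τ.im) = (K + 2) * √(τ.im / (K + 2)) := by
    rw [show ((K : ℝ) + 2) * τ.im = (K + 2) ^ 2 * (τ.im / (K + 2)) by field_simp,
      Real.sqrt_mul (by positivity), Real.sqrt_sq hk0.le]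
  have h2 : √(τ.im / (K + 2)) ^ 2 = τ.im / (K + 2) := Real.sq_sqrt (by positivity)
  have h3 : ((r : ℂ) + 2 * (K + 2) * a) ^ 2 / (4 * (K + 2))
      = ((((r : ℝ) + 2 * (K + 2) * a) ^ 2 / (4 * (K + 2)) : ℝ) : ℂ) := by push_cast; ring
  rw [h3, Complex.im_mul_ofReal, h1,
    show 2 * ((K + 2) * √(τ.im / (K + 2))) * a + r * √(τ.im / (K + 2))
      = √(τ.im / (K + 2)) * (r + 2 * (K + 2) * a) by ring, mul_pow, h2]
  push_cast
  field_simp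
  ring

section

open MeasureTheory

/-- On a horizontal line inside strip N the Kronecker function may be replaced by its absolutely
convergent expansion there. Termwise integration leaves contour-shifted Fourier coefficients of
`charTheta`. -/
lemma hasSum_integral_charTheta_mul_kronFn (K : ℕ) (j : ℤ) {τ v : ℂ} (hτ : 0 < τ.im)
    (hv : OffLattice τ v) (u w : ℂ) {N : ℤ} {ω : ℂ} (hω : ω = u - v + w * (1 - 2 / (K + 2)))
    {a : ℝ} (h1 : N * τ.im < (ω - 2 * (a * τ)).im) (h2 : (ω - 2 * (a * τ)).im < (N + 1) * τ.im)
    (m : ℤ) :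
    ∫ b in (0 : ℝ)..1, charTheta K j τ (w - v) (2 * (a * τ + b + w / (K + 2)))
        * kronFn τ v (ω - 2 * (a * τ + b)) * ex (((-m : ℤ) : ℂ) * b)
      = ex (τ * (m ^ 2 / (4 * (K + 2))) + m * a * τ) * lerchCoef K j τ v u w N m := by
  have hK : (K : ℂ) + 2 ≠ 0 := by exact_mod_cast (by omega : K + 2 ≠ 0)
  set g : ℤ → ℂ := fun n => ex (-(N * (v + n * τ))) / (1 - ex (v + n * τ)) with hg
  have him : ∀ b : ℝ, (ω - 2 * (a * τ + b)).im = (ω - 2 * (a * τ)).im := fun b => by simp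
  have hkr : ∀ b : ℝ, HasSum (fun n : ℤ => (ex (n * (ω - 2 * (a * τ))) * g n)
      * ex (((-2 * n : ℤ) : ℂ) * b)) (kronFn τ v (ω - 2 * (a * τ + b))) := fun b => by
    refine hasSum_of_eq (fun n => ?_) (hasSum_kronFn hτ hv (N := N)
      (ξ := ω - 2 * (a * τ + b)) ((him b).symm ▸ h1) ((him b).symm ▸ h2))
    rw [mul_right_comm, ← ex_add]; congr 2; push_cast; ring
  have hc : Summable fun n : ℤ => ex (n * (ω - 2 * (a * τ))) * g n := by
    refine (hkr 0).summable.congr fun n => ?_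
    simp [ex_zero]
  set f : ℝ → ℂ := fun b => charTheta K j τ (w - v) (2 * (a * τ + b + w / (K + 2)))
    * ex (((-m : ℤ) : ℂ) * b) with hf
  have hfc : Continuous f := by
    have h3 := (differentiable_charTheta K j hτ (w - v)).continuous
    have h4 := continuous_ex
    exact (h3.comp (by fun_prop)).mul (h4.comp (by fun_prop))
  have hI := integral_mul_tsum hfc hc (fun n => -2 * n)
  have hfour : ∀ n : ℤ, ∫ b in (0 : ℝ)..1, f b * ex (((-2 * n : ℤ) : ℂ) * b)
      = ex ((m + 2 * n) * (a * τ + w / (K + 2))) * charThetaCoef K j τ (w - v) (m + 2 * n) := by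
    intro n
    rw [charThetaCoef, ← integral_fourierCoef (differentiable_charTheta_two_mul K j hτ (w - v))
      (charTheta_two_mul_add_one K j hτ (w - v)) (m + 2 * n) (a * τ + w / (K + 2)),
      ← intervalIntegral.integral_const_mul]
    refine intervalIntegral.integral_congr fun b _ => ?_
    simp only [hf]
    rw [show 2 * ((b : ℂ) + (a * τ + w / (K + 2))) = 2 * (a * τ + b + w / (K + 2)) by ring,
      mul_assoc, ← ex_add, mul_left_comm, ← ex_add]
    congr 2; push_cast; ring
  have hL : ∫ b in (0 : ℝ)..1, charTheta K j τ (w - v) (2 * (a * τ + b + w / (K + 2)))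
        * kronFn τ v (ω - 2 * (a * τ + b)) * ex (((-m : ℤ) : ℂ) * b)
      = ∫ b in (0 : ℝ)..1, f b * ∑' n : ℤ, ex (n * (ω - 2 * (a * τ))) * g n
        * ex (((-2 * n : ℤ) : ℂ) * b) :=
    intervalIntegral.integral_congr fun b _ => by
      rw [(hkr b).tsum_eq, hf]; ring
  rw [hL, ← hI.tsum_eq, lerchCoef, ← tsum_mul_left, ← tsum_mul_left]
  refine tsum_congr fun n => ?_
  rw [hfour, lerchTerm, lerchFactor]
  have e : ex (n * (ω - 2 * (a * τ))) * ex ((m + 2 * n) * (a * τ + w / (K + 2)))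
      = ex (τ * (m ^ 2 / (4 * (K + 2))) + m * a * τ
          + (-(τ * (m ^ 2 / (4 * (K + 2)))) + w * (m / (K + 2)))) * ex (n * (u - v + w)) := by
    rw [← ex_add, ← ex_add, hω]; congr 1; field_simp; ring
  simp only [hg]
  rw [ex_add (τ * ((m : ℂ) ^ 2 / (4 * (K + 2))) + m * a * τ)] at e
  linear_combination (ex (-(N * (v + n * τ))) / (1 - ex (v + n * τ))
    * charThetaCoef K j τ (w - v) (m + 2 * n)) * e

/-- Replacing a by a + l lowers the strip number by 2l, and index 2kl + r in strip N has the same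
coefficient as index r in strip N - 2l. So the l-th term of the conjugate theta series is the
unfolded integrand at a + l. The hypothesis on a keeps the line of integration off the poles. -/
lemma hasSum_integral_lerchKernel (K : ℕ) (j r : ℤ) {τ v : ℂ} (hτ : 0 < τ.im)
    (hv : OffLattice τ v) (u w : ℂ) {a : ℝ}
    (ha : ∀ n : ℤ, (u - v + w * (1 - 2 / (K + 2))).im / τ.im - 2 * a ≠ n) :
    HasSum (fun l : ℤ => unfolded K j r τ v u w (a + l))
      (∫ b in (0 : ℝ)..1, lerchKernel K j r τ v u w a b) := by
  have hK : (K : ℂ) + 2 ≠ 0 := by exact_mod_cast (by omega : K + 2 ≠ 0)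
  obtain ⟨ω, hω⟩ : ∃ ω, ω = u - v + w * (1 - 2 / (K + 2)) := ⟨_, rfl⟩
  set N : ℤ := ⌊ω.im / τ.im - 2 * a⌋ with hN
  have him : (ω - 2 * (a * τ)).im = (ω.im / τ.im - 2 * a) * τ.im := by
    rw [sub_mul, div_mul_cancel₀ _ hτ.ne']; simp [mul_assoc]
  rw [← hω] at ha
  have h1 : N * τ.im < (ω - 2 * (a * τ)).im := by
    rw [him]
    exact mul_lt_mul_of_pos_right (lt_of_le_of_ne (Int.floor_le _) (ha _).symm) hτ
  have h2 : (ω - 2 * (a * τ)).im < (N + 1) * τ.im := by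
    rw [him]
    exact mul_lt_mul_of_pos_right (Int.lt_floor_add_one _) hτ
  set f : ℝ → ℂ := fun b => charTheta K j τ (w - v) (2 * (a * τ + b + w / (K + 2)))
    * kronFn τ v (ω - 2 * (a * τ + b)) with hf
  have hfc : Continuous f := by
    have h3 := (differentiable_charTheta K j hτ (w - v)).continuous
    have h4 := (differentiable_theta11 hτ).continuous
    refine (h3.comp (by fun_prop)).mul (Continuous.div
      (continuous_const.mul (h4.comp (by fun_prop))) ((h4.comp (by fun_prop)).mul continuous_const)
      fun b => mul_ne_zero (theta11_ne_zero hτ ?_) (theta11_ne_zero hτ hv))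
    have him' : (ω - 2 * (a * τ + b)).im = (ω - 2 * (a * τ)).im := by simp
    exact offLattice_of_im (N := N) hτ (him'.symm ▸ h1) (him'.symm ▸ h2)
  have hc : Summable fun l : ℤ => ex ((K + 2 : ℕ) * τ * a ^ 2) * (starRingEnd ℂ)
      (ex (τ * ((2 * (K + 2 : ℕ) * l + r + 2 * (K + 2 : ℕ) * a) ^ 2 / (4 * (K + 2 : ℕ))))) :=
    ((Complex.hasSum_conj'.2 (summable_ex_sq (k := K + 2) (by omega) r hτ a).hasSum).summable).mul_left _
  have hI := integral_mul_tsum hfc hc (fun l => -(2 * (K + 2 : ℕ) * l + r))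
  have hL : ∫ b in (0 : ℝ)..1, lerchKernel K j r τ v u w a b
      = ∫ b in (0 : ℝ)..1, f b * ∑' l : ℤ, ex ((K + 2 : ℕ) * τ * a ^ 2) * (starRingEnd ℂ)
      (ex (τ * ((2 * (K + 2 : ℕ) * l + r + 2 * (K + 2 : ℕ) * a) ^ 2 / (4 * (K + 2 : ℕ)))))
        * ex (((-(2 * (K + 2 : ℕ) * l + r) : ℤ) : ℂ) * b) :=
    intervalIntegral.integral_congr fun b _ => by
      rw [(hasSum_conj_thetaChar (k := K + 2) (by omega) r hτ a b).tsum_eq, lerchKernel, ← hω]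
  rw [hL]
  refine hasSum_of_eq (fun l => ?_) hI
  simp only [hf]
  rw [hasSum_integral_charTheta_mul_kronFn K j hτ hv u w hω h1 h2 (2 * (K + 2 : ℕ) * l + r),
    unfolded, gauss_eq K hτ, ← hω,
    show ω.im / τ.im - 2 * (a + l) = ω.im / τ.im - 2 * a - ((2 * l : ℤ) : ℝ) by push_cast; ring,
    Int.floor_sub_intCast, ← hN]
  have e1 := lerchCoef_shift_mul K j hτ v u w N r l
  push_cast at e1 ⊢
  rw [e1]
  have e2 : ex ((K + 2) * τ * a ^ 2)
      * ex (τ * ((2 * (K + 2) * l + r) ^ 2 / (4 * (K + 2))) + (2 * (K + 2) * l + r) * a * τ)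
      = ex (τ * ((r + 2 * (K + 2) * (a + l)) ^ 2 / (4 * (K + 2)))) := by
    rw [← ex_add]; congr 1; field_simp; ring
  have e3 : (r : ℂ) + 2 * (K + 2) * (a + l) = 2 * (K + 2) * l + r + 2 * (K + 2) * a := by ring
  rw [e3] at e2 ⊢
  linear_combination (lerchCoef K j τ v u w (N - 2 * l) r * (starRingEnd ℂ)
    (ex (τ * ((2 * (K + 2) * l + r + 2 * (K + 2) * a) ^ 2 / (4 * (K + 2)))))) * e2

/-- Unfolding of the integral over a period. -/
lemma integral_lerchKernel (K : ℕ) (j r : ℤ) {τ v : ℂ} (hτ : 0 < τ.im)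
    (hv : OffLattice τ v) (u w : ℂ) (hi : Integrable (unfolded K j r τ v u w)) (y : ℝ) :
    ∫ a in y..(y + 1), ∫ b in (0 : ℝ)..1, lerchKernel K j r τ v u w a b
      = ∫ a : ℝ, unfolded K j r τ v u w a := by
  have h0 : y ≤ y + 1 := by linarith
  -- Values of a whose horizontal line may meet a pole form a countable set, which is null.
  have hcount : (Set.range fun n : ℤ =>
      ((u - v + w * (1 - 2 / (K + 2))).im / τ.im - n) / 2).Countable := Set.countable_range _
  have hae := hcount.ae_notMem (volume : Measure ℝ)
  have h1 : ∫ a in y..(y + 1), ∫ b in (0 : ℝ)..1, lerchKernel K j r τ v u w a b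
      = ∫ a in y..(y + 1), ∑' l : ℤ, unfolded K j r τ v u w (a + l) := by
    refine intervalIntegral.integral_congr_ae ?_
    filter_upwards [hae] with a ha _
    refine (hasSum_integral_lerchKernel K j r hτ hv u w fun n hn => ha ⟨n, ?_⟩).tsum_eq.symm
    dsimp only
    linarith
  have h2 := hi.hasSum_intervalIntegral y
  have h3 := hi.norm.hasSum_intervalIntegral y
  simp only [add_right_comm y _ (1 : ℝ), ← intervalIntegral.integral_comp_add_right] at h2 h3
  rw [h1, ← h2.tsum_eq]
  simp only [intervalIntegral.integral_of_le h0] at h3 ⊢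
  refine (integral_tsum_of_summable_integral_norm (fun l => ?_) h3.summable).symm
  exact (hi.comp_add_right (l : ℝ)).integrableOn

end

/-! ### Integrability of the kernel across its poles -/

section

open MeasureTheory

lemma exists_mul_norm_sub_le_theta11 {τ : ℂ} (hτ : 0 < τ.im) (ξ₀ : ℂ) :
    ∃ c > 0, ∀ᶠ ξ in 𝓝 ξ₀, c * ‖ξ - ξ₀‖ ≤ ‖theta11 τ ξ‖ := by
  by_cases h : theta11 τ ξ₀ = 0
  · have hd : deriv (theta11 τ) ξ₀ ≠ 0 := by
      obtain ⟨m, n, rfl⟩ := (theta11_eq_zero_iff hτ).1 h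
      exact deriv_theta11_lattice_ne hτ m n
    have h1 := ((differentiable_theta11 hτ ξ₀).hasDerivAt.isTheta_sub hd).2
    obtain ⟨C, hC, hb⟩ := h1.exists_pos
    rw [Asymptotics.isBigOWith_iff, Filter.prod_pure, Filter.eventually_map] at hb
    refine ⟨C⁻¹, inv_pos.2 hC, ?_⟩
    filter_upwards [hb] with ξ hξ
    rw [h, sub_zero] at hξ
    rwa [inv_mul_le_iff₀ hC]
  · have hc := (differentiable_theta11 hτ).continuous.norm.continuousAt (x := ξ₀)
    have hpos : 0 < ‖theta11 τ ξ₀‖ := norm_pos_iff.2 h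
    refine ⟨‖theta11 τ ξ₀‖ / 2, by positivity, ?_⟩
    filter_upwards [hc.eventually (lt_mem_nhds (half_lt_self hpos)),
      Metric.ball_mem_nhds ξ₀ one_pos] with ξ h1 h2
    rw [mem_ball_iff_norm] at h2
    nlinarith

lemma integrableOn_inv_sqrt_abs (a b c : ℝ) :
    IntegrableOn (fun x : ℝ => (√|x - c|)⁻¹) (Set.Icc a b) := by
  have h0 : ∀ a b : ℝ, IntervalIntegrable (fun x : ℝ => (√|x|)⁻¹) volume a b := by
    refine fun a b => intervalIntegrable_of_even (f := fun x : ℝ => (√|x|)⁻¹)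
      (fun x => by rw [abs_neg]) (fun x hx => ?_) (by simp) (by simp)
    have := intervalIntegral.intervalIntegrable_rpow' (r := -(1 / 2)) (by norm_num) (a := 0) (b := x)
    refine this.congr fun y hy => ?_
    rw [Set.uIoc_of_le hx.le] at hy
    rw [abs_of_pos hy.1, Real.sqrt_eq_rpow, Real.rpow_neg hy.1.le]
  rcases le_total a b with hab | hab
  · rw [integrableOn_Icc_iff_integrableOn_Ioc, ← intervalIntegrable_iff_integrableOn_Ioc_of_le hab]
    simpa using (h0 (a - c) (b - c)).comp_sub_right c
  · rcases hab.eq_or_lt with rfl | h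
    · simp
    · simp [Set.Icc_eq_empty (not_le.2 h)]

/-- Both |s| and |t| are bounded by multiples of |s - tτ| since τ is not real, so their geometric
mean is too. This separates the variables: 1/|s - tτ| is dominated by a product of integrable
functions |s|^{-1/2} and |t|^{-1/2}. -/
lemma sqrt_abs_mul_le_norm {τ : ℂ} (hτ : 0 < τ.im) :
    ∃ c > 0, ∀ s t : ℝ, c * (√|s| * √|t|) ≤ ‖(s : ℂ) - t * τ‖ := by
  have hn : 0 < ‖τ‖ := norm_pos_iff.2 (by rintro rfl; simp at hτ)
  refine ⟨√(τ.im ^ 2 / ‖τ‖), by positivity, fun s t => ?_⟩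
  have h1 : |t| * τ.im ≤ ‖(s : ℂ) - t * τ‖ := by
    have := Complex.abs_im_le_norm ((s : ℂ) - t * τ)
    simpa [abs_mul, abs_of_pos hτ] using this
  have h2 : |s| * τ.im ≤ ‖τ‖ * ‖(s : ℂ) - t * τ‖ := by
    have := Complex.abs_im_le_norm ((starRingEnd ℂ) τ * ((s : ℂ) - t * τ))
    rw [norm_mul, Complex.norm_conj] at this
    refine le_trans (le_of_eq ?_) this
    have : ((starRingEnd ℂ) τ * ((s : ℂ) - t * τ)).im = -(s * τ.im) := by
      simp; ring
    rw [this, abs_neg, abs_mul, abs_of_pos hτ]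
  rw [← Real.sqrt_mul (abs_nonneg s), ← Real.sqrt_mul (by positivity)]
  refine Real.sqrt_le_iff.2 ⟨norm_nonneg _, ?_⟩
  have h3 := mul_le_mul h1 h2 (by positivity) (norm_nonneg _)
  rw [div_mul_eq_mul_div, div_le_iff₀ hn]
  nlinarith

lemma locallyIntegrable_inv_theta11 {τ : ℂ} (hτ : 0 < τ.im) (ω : ℂ) :
    LocallyIntegrable (fun z : ℝ × ℝ => (theta11 τ (ω - 2 * (((-z.2 : ℝ) : ℂ) * τ + z.1)))⁻¹) := by
  rintro ⟨x₀, y₀⟩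
  set L : ℝ × ℝ → ℂ := fun z => ω - 2 * (((-z.2 : ℝ) : ℂ) * τ + z.1) with hL
  have hLc : Continuous L := by fun_prop
  obtain ⟨c, hc, h1⟩ := exists_mul_norm_sub_le_theta11 hτ (L (x₀, y₀))
  obtain ⟨d, hd, h2⟩ := sqrt_abs_mul_le_norm hτ
  have h3 := (hLc.tendsto (x₀, y₀)).eventually h1
  obtain ⟨ε, hε, h4⟩ := Metric.eventually_nhds_iff_ball.1 h3
  have hball : Metric.ball ((x₀, y₀) : ℝ × ℝ) ε ⊆
      Set.Icc (x₀ - ε) (x₀ + ε) ×ˢ Set.Icc (y₀ - ε) (y₀ + ε) := by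
    intro z hz
    rw [← ball_prod_same, Set.mem_prod, Real.ball_eq_Ioo, Real.ball_eq_Ioo] at hz
    exact ⟨Set.Ioo_subset_Icc_self hz.1, Set.Ioo_subset_Icc_self hz.2⟩
  refine ⟨Metric.ball (x₀, y₀) ε, Metric.ball_mem_nhds _ hε, ?_⟩
  have hG : IntegrableOn (fun z : ℝ × ℝ => (√|z.1 - x₀|)⁻¹ * (√|z.2 - y₀|)⁻¹)
      (Set.Icc (x₀ - ε) (x₀ + ε) ×ˢ Set.Icc (y₀ - ε) (y₀ + ε)) := by
    rw [IntegrableOn, Measure.volume_eq_prod, ← Measure.prod_restrict]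
    exact (integrableOn_inv_sqrt_abs _ _ _).mul_prod (integrableOn_inv_sqrt_abs _ _ _)
  have hmeas : Measurable fun z : ℝ × ℝ => (theta11 τ (L z))⁻¹ :=
    ((differentiable_theta11 hτ).continuous.comp hLc).measurable.inv
  refine Integrable.mono' ((hG.mono_set hball).const_mul (c * (2 * d))⁻¹)
    hmeas.aestronglyMeasurable ?_
  -- On the lines through the centre the majorant has the default value 0⁻¹ = 0 and bounds nothing;
  -- these lines are null.
  have hx : ∀ᵐ z : ℝ × ℝ, z.1 ≠ x₀ := by
    have : ∀ᵐ x : ℝ, x ≠ x₀ := by simp [ae_iff, measure_singleton]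
    exact Measure.quasiMeasurePreserving_fst.ae this
  have hy : ∀ᵐ z : ℝ × ℝ, z.2 ≠ y₀ := by
    have : ∀ᵐ x : ℝ, x ≠ y₀ := by simp [ae_iff, measure_singleton]
    exact Measure.quasiMeasurePreserving_snd.ae this
  rw [ae_restrict_iff' Metric.isOpen_ball.measurableSet]
  filter_upwards [hx, hy] with z hzx hzy hz
  have h5 := h4 z hz
  have h6 : L z - L (x₀, y₀) = -2 * (((z.1 - x₀ : ℝ) : ℂ) - ((z.2 - y₀ : ℝ) : ℂ) * τ) := by
    simp only [hL]; push_cast; ring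
  have h7 := h2 (z.1 - x₀) (z.2 - y₀)
  rw [h6, norm_mul, norm_neg, Complex.norm_ofNat] at h5
  have h8 : 0 < √|z.1 - x₀| := Real.sqrt_pos.2 (abs_pos.2 (sub_ne_zero.2 hzx))
  have h9 : 0 < √|z.2 - y₀| := Real.sqrt_pos.2 (abs_pos.2 (sub_ne_zero.2 hzy))
  rw [norm_inv, ← mul_inv, ← mul_inv]
  refine inv_anti₀ (by positivity) (le_trans ?_ h5)
  calc c * (2 * d) * (√|z.1 - x₀| * √|z.2 - y₀|) = c * (2 * (d * (√|z.1 - x₀| * √|z.2 - y₀|))) := by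
        ring
    _ ≤ _ := by gcongr

lemma continuous_thetaChar {k : ℕ} (hk : 0 < k) (r : ℤ) {τ : ℂ} (hτ : 0 < τ.im) {f g : ℝ × ℝ → ℝ}
    (hf : Continuous f) (hg : Continuous g) : Continuous fun z => thetaChar k r τ (f z) (g z) := by
  have h1 := continuous_ex
  have h2 := (differentiable_theta hk r hτ).continuous
  exact (h1.comp (by fun_prop)).mul (h2.comp (by fun_prop))

/-- The kernel is a continuous function divided by one factor θ₁₁ with simple zeros. The coordinates
(-z.2, z.1) are those in which the S-transformed kernel appears. -/
lemma integrable_lerchKernel (K : ℕ) (j r : ℤ) {τ : ℂ} (hτ : 0 < τ.im) (v u w : ℂ) :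
    Integrable (fun z : ℝ × ℝ => lerchKernel K j r τ v u w (-z.2) z.1)
      ((volume.restrict (Set.Ioc (0 : ℝ) 1)).prod (volume.restrict (Set.Ioc (0 : ℝ) 1))) := by
  set ω : ℂ := u - v + w * (1 - 2 / (K + 2)) with hω
  have h1 := (locallyIntegrable_inv_theta11 hτ ω).integrableOn_isCompact
    (isCompact_Icc.prod isCompact_Icc : IsCompact (Set.Icc (0 : ℝ) 1 ×ˢ Set.Icc (0 : ℝ) 1))
  have h2 := (differentiable_charTheta K j hτ (w - v)).continuous
  have h3 := (differentiable_theta11 hτ).continuous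
  have h4 := continuous_ex
  have h5 : Continuous fun z : ℝ × ℝ =>
      charTheta K j τ (w - v) (2 * (((-z.2 : ℝ) : ℂ) * τ + z.1 + w / (K + 2)))
        * (kronConst τ * theta11 τ (ω - 2 * (((-z.2 : ℝ) : ℂ) * τ + z.1) + v) / theta11 τ v)
        * (ex ((K + 2 : ℕ) * (((-z.2 : ℝ) : ℂ) ^ 2 * τ + ((-z.2 : ℝ) : ℂ) * z.1))
          * (starRingEnd ℂ) (thetaChar (K + 2) r τ (-z.2) z.1)) := by
    refine ((h2.comp (by fun_prop)).mul ((continuous_const.mul (h3.comp (by fun_prop))).div_const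
      _)).mul ((h4.comp (by fun_prop)).mul (Complex.continuous_conj.comp
        (continuous_thetaChar (by omega) r hτ (by fun_prop) (by fun_prop))))
  have h6 := h1.continuousOn_mul h5.continuousOn (isCompact_Icc.prod isCompact_Icc)
  have h7 := h6.mono_set (Set.prod_mono (Set.Ioc_subset_Icc_self (a := (0 : ℝ)) (b := 1))
    (Set.Ioc_subset_Icc_self (a := (0 : ℝ)) (b := 1)))
  rw [IntegrableOn, Measure.volume_eq_prod, ← Measure.prod_restrict] at h7
  refine h7.congr (Filter.Eventually.of_forall fun z => ?_)
  simp only [lerchKernel, kronFn, ← hω]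
  ring

end

/-! ### The kernel under τ ↦ -1/τ -/

lemma kronConst_S {τ : ℂ} (hτ : 0 < τ.im) :
    kronConst τ = Complex.I / (-(Complex.I * τ)) ^ (1 / 2 : ℂ) / τ * kronConst (-1 / τ) := by
  have hτ' := im_neg_one_div_pos hτ
  have h1 : HasDerivAt (fun x : ℂ => -(x ^ 2 / (2 * τ))) 0 0 := by
    exact (((hasDerivAt_id (0 : ℂ)).pow 2).div_const (2 * τ)).neg.congr_deriv (by simp)
  have h2 : HasDerivAt (fun x : ℂ => ex (-(x ^ 2 / (2 * τ)))) 0 0 := by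
    have := (differentiable_ex (-((0 : ℂ) ^ 2 / (2 * τ)))).hasDerivAt.comp (0 : ℂ) h1
    rwa [mul_zero] at this
  have h3 : HasDerivAt (fun x : ℂ => theta11 (-1 / τ) (x / τ))
      (deriv (theta11 (-1 / τ)) 0 * (1 / τ)) 0 := by
    have h4 : HasDerivAt (fun x : ℂ => x / τ) (1 / τ) 0 := (hasDerivAt_id (0 : ℂ)).div_const τ
    have h5 := (differentiable_theta11 hτ' ((0 : ℂ) / τ)).hasDerivAt.comp (0 : ℂ) h4
    rwa [zero_div] at h5
  have h6 := ((h2.mul h3).const_mul (Complex.I / (-(Complex.I * τ)) ^ (1 / 2 : ℂ)))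
  have h7 : theta11 τ = fun x => Complex.I / (-(Complex.I * τ)) ^ (1 / 2 : ℂ)
      * (ex (-(x ^ 2 / (2 * τ))) * theta11 (-1 / τ) (x / τ)) := by
    ext x; rw [theta11_S hτ, mul_assoc]
  have h8 := h6.deriv
  have h9 : deriv (theta11 τ) 0 = Complex.I / (-(Complex.I * τ)) ^ (1 / 2 : ℂ)
      * (deriv (theta11 (-1 / τ)) 0 * (1 / τ)) := by
    conv_lhs => rw [h7]
    refine h8.trans ?_
    simp [ex_zero]
  rw [kronConst, kronConst, h9]
  ring

/-- The square-root factors cancel between the thetas and θ₁₁'(0), leaving weight 1 and the bilinear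
exponent that survives from (ξ + v)² - ξ² - v². -/
lemma kronFn_S {τ : ℂ} (hτ : 0 < τ.im) (v ξ : ℂ) :
    kronFn τ v ξ = 1 / τ * ex (-(ξ * v / τ)) * kronFn (-1 / τ) (v / τ) (ξ / τ) := by
  have hτ0 : τ ≠ 0 := by rintro rfl; simp at hτ
  have hA : Complex.I / (-(Complex.I * τ)) ^ (1 / 2 : ℂ) ≠ 0 :=
    div_ne_zero Complex.I_ne_zero (sqrt_factor_ne_zero hτ)
  rw [kronFn, kronFn, theta11_S hτ (ξ + v), theta11_S hτ ξ, theta11_S hτ v, kronConst_S hτ,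
    add_div]
  have e : ex (-((ξ + v) ^ 2 / (2 * τ)))
      = ex (-(ξ * v / τ)) * (ex (-(ξ ^ 2 / (2 * τ))) * ex (-(v ^ 2 / (2 * τ)))) := by
    rw [← ex_add, ← ex_add]; congr 1; field_simp; ring
  rw [e]
  have h1 := ex_ne_zero (-(ξ ^ 2 / (2 * τ)))
  have h2 := ex_ne_zero (-(v ^ 2 / (2 * τ)))
  generalize ex (-(ξ ^ 2 / (2 * τ))) = E1 at *
  generalize ex (-(v ^ 2 / (2 * τ))) = E2 at *
  generalize Complex.I / (-(Complex.I * τ)) ^ (1 / 2 : ℂ) = A at *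
  rw [show A * E1 * theta11 (-1 / τ) (ξ / τ) * (A * E2 * theta11 (-1 / τ) (v / τ))
    = (A * A * E1 * E2) * (theta11 (-1 / τ) (ξ / τ) * theta11 (-1 / τ) (v / τ)) by ring,
    show A / τ * kronConst (-1 / τ) * (A * (ex (-(ξ * v / τ)) * (E1 * E2))
      * theta11 (-1 / τ) (ξ / τ + v / τ)) = (A * A * E1 * E2) * (1 / τ * ex (-(ξ * v / τ))
      * (kronConst (-1 / τ) * theta11 (-1 / τ) (ξ / τ + v / τ))) by ring,
    mul_div_mul_left _ _ (mul_ne_zero (mul_ne_zero (mul_ne_zero hA hA) h1) h2), mul_div_assoc]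

/-- In the coordinates x = aτ + b, inversion is the rotation (a, b) ↦ (-b, a), and the normalization
absorbs the exponential factor of `theta_S`. -/
lemma thetaChar_S {k : ℕ} (hk : 0 < k) (r : ℤ) {τ : ℂ} (hτ : 0 < τ.im) (a b : ℝ) :
    thetaChar k r τ a b = 1 / ((Real.sqrt (2 * k) : ℂ) * (-(Complex.I * τ)) ^ (1 / 2 : ℂ))
      * ∑ p ∈ Finset.range (2 * k), ex (r * p / (2 * k)) * thetaChar k p (-1 / τ) (-b) a := by
  have hτ0 : τ ≠ 0 := by rintro rfl; simp at hτ
  have e1 : ((a : ℂ) * τ + b) / τ = ((-b : ℝ) : ℂ) * (-1 / τ) + a := by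
    push_cast; field_simp; ring
  have e2 : ex (k * (a ^ 2 * τ + a * b)) * ex (-(k * (a * τ + b) ^ 2 / τ))
      = ex (k * (((-b : ℝ) : ℂ) ^ 2 * (-1 / τ) + ((-b : ℝ) : ℂ) * a)) := by
    rw [← ex_add]; congr 1; push_cast; field_simp; ring
  simp only [thetaChar]
  rw [theta_S hk r hτ, e1, ← e2, Finset.mul_sum, Finset.mul_sum, Finset.mul_sum]
  refine Finset.sum_congr rfl fun p _ => ?_
  ring

/-- The automorphy factor of `lerchKernel`. -/
def kernelFactor (K : ℕ) (τ v u w : ℂ) : ℂ :=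
  Complex.I / (-(Complex.I * τ)) ^ (1 / 2 : ℂ) * (1 / τ)
    * ex ((-(w ^ 2 * (1 - 2 / (K + 2)) / 2) + v ^ 2 / 2 - u * v) / τ)
    * (starRingEnd ℂ)
      (1 / ((Real.sqrt (2 * (K + 2 : ℕ)) : ℂ) * (-(Complex.I * τ)) ^ (1 / 2 : ℂ)))

lemma lerchKernel_S (K : ℕ) (j r : ℤ) {τ : ℂ} (hτ : 0 < τ.im) (v u w : ℂ) (a b : ℝ) :
    lerchKernel K j r τ v u w a b = kernelFactor K τ v u w
      * ∑ p ∈ Finset.Icc (1 : ℤ) (((K + 2 : ℕ) : ℤ) - 1), ∑ p' ∈ Finset.range (2 * (K + 2)),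
        SHat (K + 2) j p * ex (-(r * p' / (2 * (K + 2))))
          * lerchKernel K p p' (-1 / τ) (v / τ) (u / τ) (w / τ) (-b) a := by
  have hτ0 : τ ≠ 0 := by rintro rfl; simp at hτ
  have hK : (K : ℂ) + 2 ≠ 0 := by exact_mod_cast (by omega : K + 2 ≠ 0)
  have hconj : ∀ p : ℕ, (starRingEnd ℂ) (ex (r * p / (2 * (K + 2 : ℕ))))
      = ex (-(r * p / (2 * (K + 2)))) := fun p => by
    rw [conj_ex, show ((r : ℂ) * p / (2 * (K + 2 : ℕ)))
      = ((r * p / (2 * (K + 2)) : ℝ) : ℂ) by push_cast; ring, Complex.conj_ofReal]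
    push_cast; ring_nf
  have e1 : ((a : ℂ) * τ + b + w / (K + 2)) / τ
      = ((-b : ℝ) : ℂ) * (-1 / τ) + a + w / τ / (K + 2) := by
    push_cast; field_simp; ring
  have e2 : (u - v + w * (1 - 2 / (K + 2)) - 2 * (a * τ + b)) / τ
      = u / τ - v / τ + w / τ * (1 - 2 / (K + 2)) - 2 * (((-b : ℝ) : ℂ) * (-1 / τ) + a) := by
    push_cast; field_simp; ring
  have e3 : (w - v - 2 * (a * τ + b + w / (K + 2))) / τ
      = w / τ - v / τ - 2 * (((-b : ℝ) : ℂ) * (-1 / τ) + a + w / τ / (K + 2)) := by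
    rw [← e1]; ring
  -- The exponents of all factors add up to the normalization at (-b, a) plus a term independent of
  -- a and b. This is why the arguments of the kernel are shifted by multiples of w.
  have e4 : ex (-(K * (2 * (a * τ + b + w / (K + 2))) ^ 2 / (4 * τ)))
      * ex (-((w - v - 2 * (a * τ + b + w / (K + 2))) ^ 2 / (2 * τ)))
      * ex (-((u - v + w * (1 - 2 / (K + 2)) - 2 * (a * τ + b)) * v / τ))
      * ex ((K + 2 : ℕ) * (a ^ 2 * τ + a * b))
      = ex ((-(w ^ 2 * (1 - 2 / (K + 2)) / 2) + v ^ 2 / 2 - u * v) / τ)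
        * ex ((K + 2 : ℕ) * (((-b : ℝ) : ℂ) ^ 2 * (-1 / τ) + ((-b : ℝ) : ℂ) * a)) := by
    rw [← ex_add, ← ex_add, ← ex_add, ← ex_add]; congr 1; push_cast; field_simp; ring
  have e5 : charTheta K j τ (w - v) (2 * (a * τ + b + w / (K + 2)))
      = Complex.I / (-(Complex.I * τ)) ^ (1 / 2 : ℂ)
      * ex (-(K * (2 * (a * τ + b + w / (K + 2))) ^ 2 / (4 * τ)))
      * ex (-((w - v - 2 * (a * τ + b + w / (K + 2))) ^ 2 / (2 * τ)))
      * ∑ p ∈ Finset.Icc (1 : ℤ) (((K + 2 : ℕ) : ℤ) - 1), SHat (K + 2) j p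
        * charTheta K p (-1 / τ) (w / τ - v / τ)
          (2 * (((-b : ℝ) : ℂ) * (-1 / τ) + a + w / τ / (K + 2))) := by
    rw [charTheta, su2Char_S K j hτ, theta11_S hτ, e3, ← e1, ← mul_div_assoc]
    simp only [charTheta]
    rw [Finset.mul_sum, Finset.mul_sum, Finset.sum_mul]
    refine Finset.sum_congr rfl fun p _ => ?_
    ring
  have e6 : lerchKernel K j r τ v u w a b = kernelFactor K τ v u w
      * ((∑ p ∈ Finset.Icc (1 : ℤ) (((K + 2 : ℕ) : ℤ) - 1), SHat (K + 2) j p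
        * charTheta K p (-1 / τ) (w / τ - v / τ)
          (2 * (((-b : ℝ) : ℂ) * (-1 / τ) + a + w / τ / (K + 2))))
        * kronFn (-1 / τ) (v / τ)
          (u / τ - v / τ + w / τ * (1 - 2 / (K + 2)) - 2 * (((-b : ℝ) : ℂ) * (-1 / τ) + a))
        * (ex ((K + 2 : ℕ) * (((-b : ℝ) : ℂ) ^ 2 * (-1 / τ) + ((-b : ℝ) : ℂ) * a))
          * ∑ p' ∈ Finset.range (2 * (K + 2)), ex (-(r * p' / (2 * (K + 2))))
            * (starRingEnd ℂ) (thetaChar (K + 2) p' (-1 / τ) (-b) a))) := by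
    rw [lerchKernel, e5, kronFn_S hτ, e2, thetaChar_S (k := K + 2) (by omega) r hτ, map_mul, map_sum,
      kernelFactor]
    simp only [map_mul, hconj]
    linear_combination (Complex.I / (-(Complex.I * τ)) ^ (1 / 2 : ℂ) * (1 / τ)
      * (starRingEnd ℂ)
        (1 / ((Real.sqrt (2 * (K + 2 : ℕ)) : ℂ) * (-(Complex.I * τ)) ^ (1 / 2 : ℂ)))
      * (∑ p ∈ Finset.Icc (1 : ℤ) (((K + 2 : ℕ) : ℤ) - 1), SHat (K + 2) j p
        * charTheta K p (-1 / τ) (w / τ - v / τ)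
          (2 * (((-b : ℝ) : ℂ) * (-1 / τ) + a + w / τ / (K + 2))))
        * kronFn (-1 / τ) (v / τ)
          (u / τ - v / τ + w / τ * (1 - 2 / (K + 2)) - 2 * (((-b : ℝ) : ℂ) * (-1 / τ) + a))
        * ∑ p' ∈ Finset.range (2 * (K + 2)), ex (-(r * p' / (2 * (K + 2))))
            * (starRingEnd ℂ) (thetaChar (K + 2) p' (-1 / τ) (-b) a)) * e4
  rw [e6, Finset.sum_mul, Finset.sum_mul]
  congr 1
  refine Finset.sum_congr rfl fun p _ => ?_
  rw [Finset.mul_sum, Finset.mul_sum]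
  refine Finset.sum_congr rfl fun p' _ => ?_
  rw [lerchKernel]
  push_cast
  ring

/-! ### Inversion of the torus integral -/

section

open MeasureTheory

/-- The integral of `lerchKernel` over the torus. -/
def torusIntegral (K : ℕ) (j r : ℤ) (τ v u w : ℂ) : ℂ := ∫ a : ℝ, unfolded K j r τ v u w a

/-- The unfolding formula is valid over every period interval. Taking [-1, 0] absorbs the sign in
(-b, a), and Fubini exchanges the roles of the coordinates. -/
lemma integral_lerchKernel_rotate (K : ℕ) (j r : ℤ) {τ v : ℂ} (hτ : 0 < τ.im)
    (hv : OffLattice τ v) (u w : ℂ) (hi : Integrable (unfolded K j r τ v u w)) :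
    ∫ z : ℝ × ℝ, lerchKernel K j r τ v u w (-z.2) z.1
      ∂((volume.restrict (Set.Ioc (0 : ℝ) 1)).prod (volume.restrict (Set.Ioc (0 : ℝ) 1)))
      = torusIntegral K j r τ v u w := by
  rw [integral_prod_symm _ (integrable_lerchKernel K j r hτ v u w), torusIntegral,
    ← integral_lerchKernel K j r hτ hv u w hi (-1)]
  have h := intervalIntegral.integral_comp_neg (a := (0 : ℝ)) (b := 1)
    fun a => ∫ b in (0 : ℝ)..1, lerchKernel K j r τ v u w a b
  rw [neg_zero] at h
  rw [show (-1 : ℝ) + 1 = 0 by norm_num, ← h]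
  simp only [intervalIntegral.integral_of_le (zero_le_one (α := ℝ))]

lemma torusIntegral_S (K : ℕ) (j r : ℤ) {τ v : ℂ} (hτ : 0 < τ.im) (hv : OffLattice τ v)
    (hv' : OffLattice (-1 / τ) (v / τ)) (u w : ℂ) (hi : Integrable (unfolded K j r τ v u w))
    (hi' : ∀ p p', Integrable (unfolded K p p' (-1 / τ) (v / τ) (u / τ) (w / τ))) :
    torusIntegral K j r τ v u w = kernelFactor K τ v u w
      * ∑ p ∈ Finset.Icc (1 : ℤ) (((K + 2 : ℕ) : ℤ) - 1), ∑ p' ∈ Finset.range (2 * (K + 2)),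
        SHat (K + 2) j p * ex (-(r * p' / (2 * (K + 2))))
          * torusIntegral K p p' (-1 / τ) (v / τ) (u / τ) (w / τ) := by
  have hτ' := im_neg_one_div_pos hτ
  have hint : ∀ p p' : ℤ, ∀ c : ℂ, Integrable (fun z : ℝ × ℝ =>
      c * lerchKernel K p p' (-1 / τ) (v / τ) (u / τ) (w / τ) (-z.2) z.1)
      ((volume.restrict (Set.Ioc (0 : ℝ) 1)).prod (volume.restrict (Set.Ioc (0 : ℝ) 1))) :=
    fun p p' c => (integrable_lerchKernel K p p' hτ' _ _ _).const_mul c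
  have h1 := integral_lerchKernel K j r hτ hv u w hi 0
  rw [zero_add] at h1
  simp only [intervalIntegral.integral_of_le (zero_le_one (α := ℝ)), lerchKernel_S K j r hτ] at h1
  rw [torusIntegral, ← h1, ← integral_prod (f := fun z : ℝ × ℝ => kernelFactor K τ v u w
      * ∑ p ∈ Finset.Icc (1 : ℤ) (((K + 2 : ℕ) : ℤ) - 1), ∑ p' ∈ Finset.range (2 * (K + 2)),
        SHat (K + 2) j p * ex (-(r * p' / (2 * (K + 2))))
          * lerchKernel K p p' (-1 / τ) (v / τ) (u / τ) (w / τ) (-z.2) z.1)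
    ((integrable_finsetSum _ fun p _ => integrable_finsetSum _ fun p' _ =>
      hint _ _ _).const_mul _), integral_const_mul,
    integral_finsetSum _ fun p _ => integrable_finsetSum _ fun p' _ => hint _ _ _]
  congr 1
  refine Finset.sum_congr rfl fun p _ => ?_
  rw [integral_finsetSum _ fun p' _ => hint _ _ _]
  refine Finset.sum_congr rfl fun p' _ => ?_
  rw [integral_const_mul, integral_lerchKernel_rotate K p p' hτ' hv' _ _ (hi' p p')]

end

/-! ### The torus integral as a completed Appell-Lerch sum -/

section

open MeasureTheory

lemma integrable_unfolded (K : ℕ) (j r : ℤ) {τ v : ℂ} (hτ : 0 < τ.im) (hv : OffLattice τ v)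
    (u w : ℂ) : Integrable (unfolded K j r τ v u w) :=
  (integral_lerchCoef K j hτ hv u w r (r / (K + 2)) (fun M => by
    rw [Int.ediv_lt_iff_lt_mul (by positivity)]; constructor <;> intro h <;> linarith) rfl).1

end

lemma torusIntegral_eq (K : ℕ) (j r : ℤ) {τ v : ℂ} (hτ : 0 < τ.im) (hv : OffLattice τ v)
    (u w : ℂ) : torusIntegral K j r τ v u w
      = 1 / ((2 * √((K + 2) * τ.im) : ℝ) : ℂ) * (lerchCoef K j τ v u w (r / (K + 2)) r
        + 1 / 2 * if r ≡ j [ZMOD 2] then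
          theta11 τ u * su2Char K (j - 1) τ (u - v + w)
              * R (K + 2) r τ ((u - v + w * (1 - 2 / (K + 2))) / 2)
            - theta11 τ u * su2Char K (K + 2 - j - 1) τ (u - v + w)
              * R (K + 2) (r - (K + 2)) τ ((u - v + w * (1 - 2 / (K + 2))) / 2) else 0) :=
  (integral_lerchCoef K j hτ hv u w r (r / (K + 2)) (fun M => by
    rw [Int.ediv_lt_iff_lt_mul (by positivity)]; constructor <;> intro h <;> linarith) rfl).2

/-- Read off from the kernel, where r enters only through ϑ_{k,r}; in the unfolded form the
periodicity is hidden in the strips. -/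
lemma torusIntegral_add_period (K : ℕ) (j r : ℤ) {τ v : ℂ} (hτ : 0 < τ.im) (hv : OffLattice τ v)
    (u w : ℂ) : torusIntegral K j (r + 2 * (K + 2 : ℕ)) τ v u w = torusIntegral K j r τ v u w := by
  rw [torusIntegral, torusIntegral,
    ← integral_lerchKernel K j r hτ hv u w (integrable_unfolded K j r hτ hv u w) 0,
    ← integral_lerchKernel K j _ hτ hv u w (integrable_unfolded K j _ hτ hv u w) 0]
  simp only [lerchKernel, thetaChar, theta_add_two_mul]

lemma R_add_period (k : ℕ) (r : ℤ) (τ x : ℂ) : R k (r + 2 * k) τ x = R k r τ x := by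
  rw [R, R, ← (Equiv.addRight (1 : ℤ)).tsum_eq fun m => RTerm k τ x (r + 2 * k * m)]
  refine tsum_congr fun m => ?_
  simp only [Equiv.coe_addRight]
  congr 1; ring

lemma muTilde_eq (K : ℕ) (j j' : ℤ) (τ v u w : ℂ) : muTilde (K + 2) j j' τ v u w
    = 1 / 2 * (mu (K + 2) j j' τ v u w + mu (K + 2) (K + 2 - j) (K + 2 - j') τ v u w)
      - 1 / 4 * (if j ≡ j' [ZMOD 2] then 1 else 0)
        * (su2Char K (j - 1) τ (u - v + w)
            * RHat (K + 2) j' τ (u - v + w * (1 - 2 / (K + 2)))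
          + su2Char K (K + 2 - j - 1) τ (u - v + w)
            * RHat (K + 2) (K + 2 - j') τ (u - v + w * (1 - 2 / (K + 2)))) := by
  rw [muTilde, Nat.add_sub_cancel]
  push_cast
  rfl

/-- For 0 < r < k the base strips N₀ for r and -r are 0 and -1. The shift relation moves strip -1 to
strip 0 and gives the second sum μ^{k,k-j,k-r}, while the four R series pair into R̂_{k,r} and
R̂_{k,k-r}. -/
lemma torusIntegral_sub_neg (K : ℕ) {j r : ℤ} (hj : j ∈ Finset.Icc (1 : ℤ) (((K + 2 : ℕ) : ℤ) - 1))
    (hr : r ∈ Finset.Icc (1 : ℤ) (((K + 2 : ℕ) : ℤ) - 1)) {τ v u : ℂ} (hτ : 0 < τ.im)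
    (hv : OffLattice τ v) (hu : OffLattice τ u) (w : ℂ) :
    torusIntegral K j r τ v u w - torusIntegral K j (-r) τ v u w
      = -(theta11 τ u / ((√((K + 2) * τ.im) : ℝ) : ℂ)) * muTilde (K + 2) j r τ v u w := by
  rw [Finset.mem_Icc] at hj hr
  push_cast at hj hr
  have hθ := theta11_ne_zero hτ hu
  have h1 : r / ((K : ℤ) + 2) = 0 := Int.ediv_eq_zero_of_lt (by omega) (by omega)
  have h2 : -r / ((K : ℤ) + 2) = -1 := by
    rw [Int.ediv_eq_iff_of_pos (by positivity)]; constructor <;> linarith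
  have h3 := lerchCoef_shift K j hτ v u w (-1) (-r)
  rw [neg_add_cancel, neg_add_eq_sub] at h3
  have h4 := mu_eq K j r (by omega) hτ v u w
  have h5 := mu_eq K (K + 2 - j) (K + 2 - r) (by omega) hτ v u w
  have h6 := R_add_period (K + 2) (-r - (K + 2)) τ ((u - v + w * (1 - 2 / (K + 2))) / 2)
  rw [show -r - ((K : ℤ) + 2) + 2 * ((K + 2 : ℕ) : ℤ) = K + 2 - r by push_cast; ring] at h6
  have h7 : (-r ≡ j [ZMOD 2]) ↔ r ≡ j [ZMOD 2] := by simp only [Int.ModEq]; omega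
  have h8 : (j ≡ r [ZMOD 2]) ↔ r ≡ j [ZMOD 2] := ⟨Int.ModEq.symm, Int.ModEq.symm⟩
  rw [torusIntegral_eq K j r hτ hv, torusIntegral_eq K j (-r) hτ hv, h1, h2, h3, muTilde_eq, h4, h5,
    RHat, RHat, ← h6, neg_sub]
  simp only [h7, h8]
  have hs : ((√((K + 2) * τ.im) : ℝ) : ℂ) ≠ 0 := by
    rw [Complex.ofReal_ne_zero]; positivity
  push_cast
  generalize ((√((K + 2) * τ.im) : ℝ) : ℂ) = s at hs ⊢
  split_ifs
  · field_simp; ring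
  · field_simp; ring

/-! ### The S transformation of μ̃ -/

lemma offLattice_S {τ v : ℂ} (hτ : 0 < τ.im) (hv : OffLattice τ v) :
    OffLattice (-1 / τ) (v / τ) := by
  intro a b h
  have hτ0 : τ ≠ 0 := by rintro rfl; simp at hτ
  refine hv b (-a) ?_
  field_simp at h
  push_cast
  linear_combination h

lemma sqrt_factor_mul_self (τ : ℂ) :
    (-(Complex.I * τ)) ^ (1 / 2 : ℂ) * (-(Complex.I * τ)) ^ (1 / 2 : ℂ) = -(Complex.I * τ) := by
  have := Complex.cpow_nat_inv_pow (-(Complex.I * τ)) (n := 2) two_ne_zero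
  rw [← pow_two, one_div]
  exact_mod_cast this

/-- The conjugate theta function contributes a conjugate weight-1/2 factor; this modulus is balanced
by √τ₂ in the torus integral. -/
lemma sqrt_factor_mul_conj (τ : ℂ) : (-(Complex.I * τ)) ^ (1 / 2 : ℂ)
    * (starRingEnd ℂ) ((-(Complex.I * τ)) ^ (1 / 2 : ℂ)) = (‖τ‖ : ℂ) := by
  rw [Complex.mul_conj, Complex.normSq_eq_norm_sq, pow_two, ← norm_mul, sqrt_factor_mul_self]
  simp

lemma sqrt_im_neg_one_div (c : ℝ) {τ : ℂ} (hτ : 0 < τ.im) :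
    √(c * τ.im) = ‖τ‖ * √(c * (-1 / τ).im) := by
  have hn : 0 < ‖τ‖ := norm_pos_iff.2 (by rintro rfl; simp at hτ)
  have h1 : (-1 / τ).im = τ.im / ‖τ‖ ^ 2 := by
    rw [Complex.div_im, Complex.normSq_eq_norm_sq]; simp [neg_div]
  rw [h1, ← Real.sqrt_sq hn.le, ← Real.sqrt_mul (by positivity), Real.sqrt_sq hn.le]
  congr 1; field_simp

/-- The `S` transformation. -/
lemma muTilde_S (K : ℕ) {j r : ℤ} (hj : j ∈ Finset.Icc (1 : ℤ) (((K + 2 : ℕ) : ℤ) - 1))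
    (hr : r ∈ Finset.Icc (1 : ℤ) (((K + 2 : ℕ) : ℤ) - 1)) {τ v u : ℂ} (hτ : 0 < τ.im)
    (hv : OffLattice τ v) (hu : OffLattice τ u) (w : ℂ) :
    ∑ p ∈ Finset.Icc (1 : ℤ) (((K + 2 : ℕ) : ℤ) - 1),
      ∑ p' ∈ Finset.Icc (1 : ℤ) (((K + 2 : ℕ) : ℤ) - 1),
        SHat (K + 2) j p * SHat (K + 2) r p'
          * muTilde (K + 2) p p' (-1 / τ) (v / τ) (u / τ) (w / τ)
      = -(-(Complex.I * τ)) ^ (1 / 2 : ℂ)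
        * ex (-((u - v) ^ 2 / (2 * τ)) + w ^ 2 * (1 - 2 / (K + 2)) / (2 * τ))
        * muTilde (K + 2) j r τ v u w := by
  have hτ0 : τ ≠ 0 := by rintro rfl; simp at hτ
  have hk0 : ((K + 2 : ℕ) : ℝ) ≠ 0 := by positivity
  have hτ' := im_neg_one_div_pos hτ
  have hv' := offLattice_S hτ hv
  have hu' := offLattice_S hτ hu
  have hsq : (Real.sqrt (2 * (K + 2 : ℕ)) : ℂ) ≠ 0 := by
    rw [Complex.ofReal_ne_zero]; positivity
  have hS : ∀ s : ℤ, torusIntegral K j s τ v u w = _ := fun s =>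
    torusIntegral_S K j s hτ hv hv' u w (integrable_unfolded K j s hτ hv u w)
      fun p p' => integrable_unfolded K p p' hτ' hv' _ _
  have h1 := torusIntegral_sub_neg K hj hr hτ hv hu w
  have hcoef : ∀ p' : ℤ, ex (-(r * p' / (2 * (K + 2)))) - ex (r * p' / (2 * (K + 2)))
      = -(Complex.I * (Real.sqrt (2 * (K + 2 : ℕ)) : ℂ)) * SHat (K + 2) r p' := fun p' => by
    have h2 := ex_sub_ex_neg ((r : ℂ) * p' / (K + 2 : ℕ))
    rw [SHat_eq (k := K + 2) (by omega) r p']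
    have h3 : (r : ℂ) * p' / (K + 2 : ℕ) / 2 = r * p' / (2 * (K + 2)) := by
      push_cast; field_simp
    rw [h3] at h2
    rw [← neg_sub, h2]
    field_simp
  rw [hS r, hS (-r), ← mul_sub, ← Finset.sum_sub_distrib] at h1
  have h4 : ∀ p ∈ Finset.Icc (1 : ℤ) (((K + 2 : ℕ) : ℤ) - 1),
      (∑ p' ∈ Finset.range (2 * (K + 2)), SHat (K + 2) j p * ex (-(r * p' / (2 * (K + 2))))
          * torusIntegral K p p' (-1 / τ) (v / τ) (u / τ) (w / τ))
      - ∑ p' ∈ Finset.range (2 * (K + 2)),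
        SHat (K + 2) j p * ex (-(((-r : ℤ) : ℂ) * p' / (2 * (K + 2))))
          * torusIntegral K p p' (-1 / τ) (v / τ) (u / τ) (w / τ)
      = Complex.I * (Real.sqrt (2 * (K + 2 : ℕ)) : ℂ)
        * (theta11 (-1 / τ) (u / τ) / ((√((K + 2) * (-1 / τ).im) : ℝ) : ℂ))
        * ∑ p' ∈ Finset.Icc (1 : ℤ) (((K + 2 : ℕ) : ℤ) - 1), SHat (K + 2) j p * SHat (K + 2) r p'
          * muTilde (K + 2) p p' (-1 / τ) (v / τ) (u / τ) (w / τ) := by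
    intro p hp
    -- Antisymmetry in r makes the Fourier coefficients odd in p', so p' and -p' combine and μ̃
    -- appears on the transformed side as well.
    have h5 := sum_range_two_mul_odd (k := K + 2) (by omega)
      (fun p' : ℤ => ex (-(r * p' / (2 * (K + 2)))) - ex (r * p' / (2 * (K + 2))))
      (fun p' : ℤ => torusIntegral K p p' (-1 / τ) (v / τ) (u / τ) (w / τ))
      (fun p' => ?_) (fun p' => ?_) (fun p' => ?_)
    · rw [← Finset.sum_sub_distrib]
      have h6 : ∀ p' ∈ Finset.range (2 * (K + 2)),
          SHat (K + 2) j p * ex (-(r * p' / (2 * (K + 2))))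
            * torusIntegral K p p' (-1 / τ) (v / τ) (u / τ) (w / τ)
          - SHat (K + 2) j p * ex (-(((-r : ℤ) : ℂ) * p' / (2 * (K + 2))))
            * torusIntegral K p p' (-1 / τ) (v / τ) (u / τ) (w / τ)
          = SHat (K + 2) j p * ((ex (-(r * ((p' : ℤ) : ℂ) / (2 * (K + 2))))
            - ex (r * ((p' : ℤ) : ℂ) / (2 * (K + 2))))
            * torusIntegral K p p' (-1 / τ) (v / τ) (u / τ) (w / τ)) := fun p' _ => by
        rw [Int.cast_neg, neg_mul, neg_div (2 * ((K : ℂ) + 2)), neg_neg, Int.cast_natCast]; ring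
      rw [Finset.sum_congr rfl h6, ← Finset.mul_sum, h5, Finset.mul_sum, Finset.mul_sum]
      refine Finset.sum_congr rfl fun p' hp' => ?_
      rw [hcoef, torusIntegral_sub_neg K hp hp' hτ' hv' hu' (w / τ)]
      ring
    · rw [Int.cast_neg, mul_neg, neg_div, neg_neg, neg_sub]
    · exact torusIntegral_add_period K p p' hτ' hv' _ _
    · have hK : (K : ℂ) + 2 ≠ 0 := by exact_mod_cast (by omega : K + 2 ≠ 0)
      congr 1
      · refine ex_eq_of_sub_int (-r) ?_
        push_cast; field_simp; ring
      · refine ex_eq_of_sub_int r ?_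
        push_cast; field_simp
  rw [Finset.sum_congr rfl h4, ← Finset.mul_sum] at h1
  have hθ := theta11_ne_zero hτ' hu'
  have hs := sqrt_factor_ne_zero hτ
  have hss := sqrt_factor_mul_self τ
  have hsc := sqrt_factor_mul_conj τ
  have him := sqrt_im_neg_one_div ((K : ℝ) + 2) hτ
  have hα' : ((√((K + 2) * (-1 / τ).im) : ℝ) : ℂ) ≠ 0 := by
    rw [Complex.ofReal_ne_zero]; positivity
  have e : ex (-(u ^ 2 / (2 * τ)))
      = ex ((-(w ^ 2 * (1 - 2 / (K + 2)) / 2) + v ^ 2 / 2 - u * v) / τ)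
        * ex (-((u - v) ^ 2 / (2 * τ)) + w ^ 2 * (1 - 2 / (K + 2)) / (2 * τ)) := by
    rw [← ex_add]; congr 1; field_simp; ring
  have hn : (‖τ‖ : ℂ) ≠ 0 := by simpa using hτ0
  have hE := ex_ne_zero ((-(w ^ 2 * (1 - 2 / (K + 2)) / 2) + v ^ 2 / 2 - u * v) / τ)
  generalize ∑ p ∈ Finset.Icc (1 : ℤ) (((K + 2 : ℕ) : ℤ) - 1),
      ∑ p' ∈ Finset.Icc (1 : ℤ) (((K + 2 : ℕ) : ℤ) - 1),
        SHat (K + 2) j p * SHat (K + 2) r p'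
          * muTilde (K + 2) p p' (-1 / τ) (v / τ) (u / τ) (w / τ) = S at h1 ⊢
  rw [theta11_S hτ u, kernelFactor, him, e, map_div₀, map_one, map_mul, Complex.conj_ofReal,
    Complex.ofReal_mul, ← hsc] at h1
  have hsc0 : (starRingEnd ℂ) ((-(Complex.I * τ)) ^ (1 / 2 : ℂ)) ≠ 0 := by
    intro h; rw [h, mul_zero] at hsc; exact hn hsc.symm
  generalize ex ((-(w ^ 2 * (1 - 2 / (K + 2)) / 2) + v ^ 2 / 2 - u * v) / τ) = E₀ at h1 hE
  generalize ex (-((u - v) ^ 2 / (2 * τ)) + w ^ 2 * (1 - 2 / (K + 2)) / (2 * τ)) = E₁ at h1 ⊢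
  generalize (starRingEnd ℂ) ((-(Complex.I * τ)) ^ (1 / 2 : ℂ)) = s' at h1 hsc0
  generalize (-(Complex.I * τ)) ^ (1 / 2 : ℂ) = s at h1 hs hss ⊢
  generalize muTilde (K + 2) j r τ v u w = M at h1 ⊢
  generalize theta11 (-1 / τ) (u / τ) = θ at h1 hθ
  generalize ((√((K + 2) * (-1 / τ).im) : ℝ) : ℂ) = α at h1 hα'
  generalize (Real.sqrt (2 * (K + 2 : ℕ)) : ℂ) = β at h1 hsq
  -- All nonzero common factors of the two sides are collected; with s = √(-iτ) the rest reads iS/τ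
  -- + E₁M/s = 0, and s² = -iτ turns it into S = -sE₁M.
  have h2 : (Complex.I * θ * E₀ / (s * s' * α)) * (Complex.I * S / τ + E₁ * M / s) = 0 := by
    have h3 : Complex.I / s * (1 / τ) * E₀ * (1 / (β * s'))
        * (Complex.I * β * (θ / α) * S) = (Complex.I * θ * E₀ / (s * s' * α))
          * (Complex.I * S / τ) := by field_simp
    have h4 : Complex.I / s * (E₀ * E₁) * θ / (s * s' * α) * M
      = (Complex.I * θ * E₀ / (s * s' * α)) * (E₁ * M / s) := by field_simp
    rw [mul_add, ← h3, ← h4, h1]; ring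
  have h5 := (mul_eq_zero.1 h2).resolve_left
    (div_ne_zero (mul_ne_zero (mul_ne_zero Complex.I_ne_zero hθ) hE)
      (mul_ne_zero (mul_ne_zero hs hsc0) hα'))
  field_simp at h5
  have h6 : s * (S + s * E₁ * M) = 0 := by
    linear_combination -Complex.I * h5 + E₁ * M * hss + s * S * Complex.I_sq
  have h7 := (mul_eq_zero.1 h6).resolve_left hs
  linear_combination h7

/-! ### The T transformation of μ̃ -/

lemma mu_eq_zero (K : ℕ) {j j' : ℤ} (hj : K = 0 → j = 1) (h : ¬ j ≡ j' [ZMOD 2]) {τ : ℂ}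
    (hτ : 0 < τ.im) (v u w : ℂ) : mu (K + 2) j j' τ v u w = 0 := by
  have h1 : ∀ n : ℤ, lerchTerm K j τ v u w 0 j' n = 0 := fun n => by
    rw [lerchTerm, charThetaCoef_eq_zero K j hτ _ (fun h' => h ?_), mul_zero]
    simp only [Int.ModEq] at h' ⊢
    omega
  rw [mu_eq K j j' hj hτ, lerchCoef, tsum_congr h1]
  simp

/-- The error functions see only Im τ, so just the exponentials change, and n²/4k is constant mod 1
on n ≡ r mod 2k. -/
lemma R_tau_add_one {k : ℕ} (hk : 0 < k) (r : ℤ) (τ x : ℂ) :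
    R k r (τ + 1) x = ex (-(r ^ 2 / (4 * k))) * R k r τ x := by
  have hk' : (k : ℂ) ≠ 0 := by exact_mod_cast hk.ne'
  rw [R, R, ← tsum_mul_left]
  refine tsum_congr fun m => ?_
  rw [RTerm_eq, RTerm_eq, mul_left_comm, ← ex_add, show (τ + 1).im = τ.im by simp]
  congr 1
  refine ex_eq_of_sub_int (-(r * m + k * m ^ 2)) ?_
  push_cast; field_simp; ring

lemma RHat_tau_add_one {k : ℕ} (hk : 0 < k) (r : ℤ) (τ x : ℂ) :
    RHat k r (τ + 1) x = ex (-(r ^ 2 / (4 * k))) * RHat k r τ x := by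
  rw [RHat, RHat, R_tau_add_one hk, R_tau_add_one hk, Int.cast_neg, neg_sq, mul_sub]

/-- The `T` transformation. -/
lemma muTilde_tau_add_one (K : ℕ) {j j' : ℤ} (hj : j ∈ Finset.Icc (1 : ℤ) (((K + 2 : ℕ) : ℤ) - 1))
    {τ : ℂ} (hτ : 0 < τ.im) (v u w : ℂ) : muTilde (K + 2) j j' (τ + 1) v u w
      = ex (-(1 / 8) + (j ^ 2 - j' ^ 2) / (4 * (K + 2))) * muTilde (K + 2) j j' τ v u w := by
  rw [Finset.mem_Icc] at hj
  push_cast at hj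
  have hK : (K : ℂ) + 2 ≠ 0 := by exact_mod_cast (by omega : K + 2 ≠ 0)
  have hτ' : 0 < (τ + 1).im := by simpa using hτ
  by_cases h : j ≡ j' [ZMOD 2]
  · obtain ⟨n, hn⟩ := h.dvd
    have hn' : (j' : ℂ) = j + 2 * n := by
      have : j' = j + 2 * n := by linarith
      exact_mod_cast this
    -- The phases for (j, j') and (k - j, k - j') differ by e^{πi(j'-j)}, which is 1 exactly because
    -- j ≡ j' mod 2.
    have h1 : ex (-(1 / 8) + (((K + 2 - j : ℤ) : ℂ) ^ 2 - ((K + 2 - j' : ℤ) : ℂ) ^ 2)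
        / (4 * (K + 2))) = ex (-(1 / 8) + (j ^ 2 - j' ^ 2) / (4 * (K + 2))) := by
      refine ex_eq_of_sub_int n ?_
      push_cast; rw [hn']; field_simp; ring
    have h2 : ∀ l m : ℤ, ex ((((l - 1 : ℤ) : ℂ) + 1) ^ 2 / (4 * (K + 2)) - 1 / 8)
        * ex (-((m : ℂ) ^ 2 / (4 * (K + 2 : ℕ))))
        = ex (-(1 / 8) + ((l : ℂ) ^ 2 - (m : ℂ) ^ 2) / (4 * (K + 2))) := fun l m => by
      rw [← ex_add]; congr 1; push_cast; ring
    have h3 := h2 j j'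
    have h4 := h2 (K + 2 - j) (K + 2 - j')
    rw [h1] at h4
    rw [muTilde_eq, muTilde_eq, mu_tau_add_one K j j' (by omega) hτ,
      mu_tau_add_one K (K + 2 - j) (K + 2 - j') (by omega) hτ, h1, su2Char_tau_add_one K _ hτ,
      su2Char_tau_add_one K _ hτ, RHat_tau_add_one (by omega), RHat_tau_add_one (by omega),
      if_pos h]
    linear_combination (-(1 / 4) * (su2Char K (j - 1) τ (u - v + w)
            * RHat (K + 2) j' τ (u - v + w * (1 - 2 / (K + 2))))) * h3
      - 1 / 4 * (su2Char K (K + 2 - j - 1) τ (u - v + w)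
            * RHat (K + 2) (K + 2 - j') τ (u - v + w * (1 - 2 / (K + 2)))) * h4
  -- For opposite parities both sums vanish and no correction is present, so μ̃ = 0 on both sides.
  · have h' : ¬ (K + 2 - j : ℤ) ≡ K + 2 - j' [ZMOD 2] := fun h1 => h (by
      simp only [Int.ModEq] at h1 ⊢; omega)
    rw [muTilde_eq, muTilde_eq, mu_eq_zero K (by omega) h hτ, mu_eq_zero K (by omega) h' hτ,
      mu_eq_zero K (by omega) h hτ', mu_eq_zero K (by omega) h' hτ', if_neg h]
    ring

end AppellLerch

end

theorem mainTheorem1 (k : ℕ) (hk : 2 ≤ k) (j j' : ℤ)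
    (hj : j ∈ Finset.Icc (1 : ℤ) (k - 1)) (hj' : j' ∈ Finset.Icc (1 : ℤ) (k - 1))
    (τ v u w : ℂ) (hτ : 0 < τ.im)
    (hv : ∀ a b : ℤ, v ≠ a * τ + b) (hu : ∀ a b : ℤ, u ≠ a * τ + b) :
    Summable (AppellLerch.muTerm k j j' τ v u w) ∧
    (∀ (r : ℤ) (x : ℂ), Summable fun m : ℤ => AppellLerch.RTerm k τ x (r + 2 * k * m)) ∧
    AppellLerch.muTilde k j j' (τ + 1) v u w
      = Complex.exp (-(Real.pi * Complex.I / 4))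
        * Complex.exp (Real.pi * Complex.I * ((j : ℂ) ^ 2 - (j' : ℂ) ^ 2) / (2 * k))
        * AppellLerch.muTilde k j j' τ v u w ∧
    ∑ p ∈ Finset.Icc (1 : ℤ) (k - 1), ∑ p' ∈ Finset.Icc (1 : ℤ) (k - 1),
        AppellLerch.SHat k j p * AppellLerch.SHat k j' p'
          * AppellLerch.muTilde k p p' (-1 / τ) (v / τ) (u / τ) (w / τ)
      = -(-(Complex.I * τ)) ^ (1 / 2 : ℂ)
        * Complex.exp (-(Real.pi * Complex.I * (u - v) ^ 2 / τ))
        * Complex.exp (Real.pi * Complex.I * w ^ 2 * (1 - 2 / k) / τ)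
        * AppellLerch.muTilde k j j' τ v u w := by
  obtain ⟨K, rfl⟩ := Nat.exists_eq_add_of_le' hk
  have hj1 : K = 0 → j = 1 := fun h => by
    rw [Finset.mem_Icc] at hj; push_cast at hj; omega
  refine ⟨AppellLerch.summable_muTerm K j j' hj1 hτ hv u w,
    fun r x => AppellLerch.summable_RTerm (by omega) r hτ x, ?_, ?_⟩
  · rw [AppellLerch.muTilde_tau_add_one K hj hτ, AppellLerch.ex, ← Complex.exp_add]
    congr 2
    have hK : (K : ℂ) + 2 ≠ 0 := by exact_mod_cast (by omega : K + 2 ≠ 0)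
    push_cast
    field_simp
    ring
  · rw [AppellLerch.muTilde_S K hj hj' hτ hv hu w, AppellLerch.ex, mul_assoc _ (Complex.exp _)
      (Complex.exp _), ← Complex.exp_add]
    congr 3
    push_cast
    ring
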